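/- **Data.** Let $0<\nu<1$, let $a,Q,M,U_c,c_0,\gamma_0,\sigma_1,\sigma_2>0$ and $B\in\mathbb R$, and put $D_i=\frac{\sigma_iU_c}{2c_0\gamma_0a}$, $D_i^*=\frac{U_cD_i}{2}$ $(i=1,2)$. Let $L,N,K$ be real functions of $(\eta,x)$, measurable in $\eta$, and write $L(f)(\eta)=L(\eta,f(\eta))$, and similarly for $N,K$. For $0<s_0<r_0$ let $\mathcal C=C[s_0,r_0]\times C_b[r_0,\infty)$ with the maximum of the two sup norms, $\mathcal M=\{f_2\in C_b[r_0,\infty):f_2(r_0)=0,\ f_2(+\infty)=-1\}$ and $\mathcal K=C[s_0,r_0]\times\mathcal M$. For $(f_1,f_2)\in\mathcal K$ put $$H=\int_{s_0}^{r_0}\frac{K(f_1)(v)}{v^\nu}dv+\int_{r_0}^{\infty}\frac{K(f_2)(v)}{v^\nu}dv,$$ and, with $\ell_1=s_0\le\eta\le r_0$ for $i=1$ and $\ell_2=r_0\le\eta\,(\le+\infty)$ for $i=2$, $$E_i(\eta)=\exp\Big(-\int_{\ell_i}^{\eta}\Big[2av\frac{N(f_i)}{L(f_i)}+\frac{D_i}{H}\frac{K(f_i)}{L(f_i)v^\nu}\Big]dv\Big),\quad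 \Phi_i(\eta)=\int_{\ell_i}^\eta\frac{E_i}{L(f_i)v^\nu}dv,$$ $$H_i(\eta)=\int_{\ell_i}^\eta\frac{K(f_i)}{v^\nu E_i}dv,\qquad G_i(\eta)=\int_{\ell_i}^\eta\frac{E_iH_i}{L(f_i)v^\nu}dv .$$ Let $\Psi=\Psi_{r_0,s_0}=(V_1,V_2)$ on $\mathcal K$, where $$V_1(f_1,f_2)(\eta)=s_0^\nu Qe^{-s_0^2}[\Phi_1(r_0)-\Phi_1(\eta)]+\frac{D_1^*}{H^2}[G_1(r_0)-G_1(\eta)],\quad s_0\le\eta\le r_0,$$ $$V_2(f_1,f_2)(\eta)=\Big[\frac{D_2^*}{H^2}G_2(+\infty)-1\Big]\frac{\Phi_2(\eta)}{\Phi_2(+\infty)}-\frac{D_2^*}{H^2}G_2(\eta),\quad \eta\ge r_0.$$ The unknowns are $s_0,r_0,f_1,f_2$; the system is $f_1=V_1(f_1,f_2)$ on $[s_0,r_0]$, $f_2=V_2(f_1,f_2)$ on $[r_0,\infty)$, together with the free-boundary equations $$(1)\quad s_0^\nu Qe^{-s_0^2}\Phi_1(r_0)+\frac{D_1^*}{H^2}G_1(r_0)=B,$$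 $$(2)\quad E_1(r_0)\Big[Qe^{-s_0^2}s_0^\nu+\frac{D_1^*}{H^2}H_1(r_0)\Big]-\frac1{\Phi_2(+\infty)}\Big[1-\frac{D_2^*}{H^2}G_2(+\infty)\Big]=Mr_0^{\nu+1}.$$ **Assumptions (A1)–(A5).** There are given $\mu>2$ and positive constants $L_{im},L_{iM},N_{im},N_{iM},K_{im},K_{iM},\widetilde L_i,\widetilde N_i,\widetilde K_i$ $(i=1,2)$ such that for all $0<s_0<r_0$: for all $f_1,g_1\in C[s_0,r_0]$ and $\eta\in[s_0,r_0]$ $(i=1)$, and for all $f_2,g_2\in\mathcal M$ and $\eta\ge r_0$ $(i=2)$, $$L_{im}\eta^\mu\le L(f_i)(\eta)\le L_{iM}\eta^\mu,\quad N_{im}\eta^{-\mu}\le N(f_i)(\eta)\le N_{iM}\eta^{-\mu},\quad K_{im}\eta^{-\mu}\le K(f_i)(\eta)\le K_{iM}\eta^{-\mu},$$ $$|L(f_i)(\eta)-L(g_i)(\eta)|\le\widetilde L_i\|f_i-g_i\|,\quad|N(f_i)(\eta)-N(g_i)(\eta)|\le\widetilde N_i\|f_i-g_i\|,\quad|K(f_i)(\eta)-K(g_i)(\eta)|\le\widetilde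 K_i\eta^{-\mu}\|f_i-g_i\|.$$ **Bounds.** Let $\kappa=\mu+\nu-1$, $\theta=2\mu+\nu-1$, $x_1=s_0$, $x_2=r_0$. Functions of $(r_0,s_0)$, $0<s_0<r_0$: $$H_{inf}=\tfrac{K_{1m}}{\kappa}\big(s_0^{-\kappa}-r_0^{-\kappa}\big),\quad H_{sup}=\tfrac1\kappa\big(K_{1M}s_0^{-\kappa}+K_{2M}r_0^{-\kappa}\big),\quad \widetilde H=\tfrac1\kappa\big(\widetilde K_1s_0^{-\kappa}+\widetilde K_2r_0^{-\kappa}\big),\quad H_{1inf}=H_{inf},$$ $$E_{i\,inf}=\exp\Big(-\Big[\tfrac{aN_{iM}}{L_{im}(\mu-1)}x_i^{2-2\mu}+\tfrac{D_iK_{iM}}{H_{inf}L_{im}\theta}x_i^{-\theta}\Big]\Big),$$ $$\widetilde E_i=2a\Big[\tfrac{\widetilde N_i}{L_{im}(\mu-2)}x_i^{2-\mu}+\tfrac{N_{iM}\widetilde L_i}{L_{im}^2(3\mu-2)}x_i^{2-3\mu}\Big]+D_i\Big(\tfrac{\widetilde K_i}{H_{inf}L_{im}\theta}x_i^{-\theta}+\tfrac{K_{iM}}{H_{inf}L_{im}}\Big(\tfrac{\widetilde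 H}{H_{inf}\theta}x_i^{-\theta}+\tfrac{\widetilde L_i}{L_{im}(3\mu+\nu-1)}x_i^{1-3\mu-\nu}\Big)\Big),$$ $$\widetilde\Phi_i=\tfrac{\widetilde E_i}{L_{im}\kappa}x_i^{-\kappa}+\tfrac{\widetilde L_i}{L_{im}^2\theta}x_i^{-\theta},\quad H_{i\,sup}=\tfrac{K_{iM}}{E_{i\,inf}\kappa}x_i^{-\kappa},\quad \widetilde H_i=\Big(\widetilde K_i+\tfrac{K_{iM}\widetilde E_i}{E_{i\,inf}}\Big)\tfrac{x_i^{-\kappa}}{E_{i\,inf}\kappa},$$ $$G_{i\,sup}=\tfrac{H_{i\,sup}}{L_{im}\kappa}x_i^{-\kappa},\quad \widetilde G_i=H_{i\,sup}\widetilde\Phi_i+\tfrac{\widetilde H_i}{L_{im}\kappa}x_i^{-\kappa},$$ $$\Phi_{2inf}=\tfrac{E_{2inf}}{L_{2M}\kappa}r_0^{-\kappa},\quad \Phi_{2sup}=\tfrac{1}{L_{2m}\kappa}r_0^{-\kappa},\quad G_{2inf}=\tfrac{K_{2m}E_{2inf}}{2L_{2M}\kappa^2}r_0^{-2\kappa},$$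 $$\varepsilon_1=2s_0^\nu Qe^{-s_0^2}\widetilde\Phi_1+2D_1^*\Big(\tfrac{2G_{1sup}H_{sup}\widetilde H}{H_{inf}^4}+\tfrac{\widetilde G_1}{H_{inf}^2}\Big),\qquad \varepsilon_2=\varepsilon_{21}+D_2^*(\varepsilon_{22}+\varepsilon_{23}),$$ $$\varepsilon_{21}=\tfrac{2\widetilde\Phi_2}{\Phi_{2inf}},\quad\varepsilon_{22}=\tfrac{\widetilde G_2}{H_{inf}^2}+\tfrac{2G_{2sup}H_{sup}\widetilde H}{H_{inf}^4},\quad \varepsilon_{23}=\tfrac{\Phi_{2sup}}{\Phi_{2inf}}\varepsilon_{22}+\tfrac{G_{2sup}}{H_{inf}^2}\varepsilon_{21},$$ $$Z_{inf}=\tfrac{D_1^*E_{1inf}K_{1m}}{2L_{1M}}\Big(\tfrac{r_0^\kappa-s_0^\kappa}{K_{1M}r_0^\kappa+K_{2M}s_0^\kappa}\Big)^2 .$$ **Thresholds.** Let $j_1(s_0)=\lim_{r_0\to\infty}\varepsilon_1(r_0,s_0)$, $j_2(s_0)=\lim_{r_0\to\infty}Z_{inf}(r_0,s_0)$ and $$s_1=\inf\{s_0>0:j_1(s_0)<1\},\qquad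 s_2=\inf\{s_0\ge s_1:j_2(s_0)\ge B\},$$ $$r_i(s_0)=\inf\{r_0>s_0:\varepsilon_i(r_0,s_0)<1\},\quad \overline r_0=\max\{r_1,r_2\},\quad r_B(s_0)=\inf\{r_0>s_0:Z_{inf}(r_0,s_0)\ge B\},$$ $$\Sigma=\{(r_0,s_0):s_0>s_1,\ r_0>\overline r_0(s_0)\}.$$ For $s_0>s_2$ let $S(s_0)$ be the set of all $r_0\in(\overline r_0(s_0),r_B(s_0))$ for which (1) holds with $(f_1,f_2)$ a fixed point of $\Psi_{r_0,s_0}$ in $\mathcal K$. For $r_0\in S(s_0)$ put $$W_{inf}(r_0,s_0)=\tfrac{E_{1inf}}{r_B^{\nu+1}}\Big[Qe^{-s_0^2}s_0^\nu+\tfrac{D_1^*}{H_{sup}^2}H_{1inf}\Big]-\tfrac1{\overline r_0^{\nu+1}\Phi_{2inf}}+\tfrac{1}{r_B^{\nu+1}\Phi_{2sup}}\tfrac{D_2^*}{H_{sup}^2}G_{2inf},$$ $$W_{sup}(r_0,s_0)=\tfrac1{\overline r_0^{\nu+1}}\Big[Qe^{-s_0^2}s_0^\nu+\tfrac{D_1^*}{H_{inf}^2}H_{1sup}+\tfrac1{\Phi_{2inf}}\tfrac{D_2^*}{H_{inf}^2}G_{2sup}\Big],$$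 with $r_B,\overline r_0$ taken at $s_0$ and the other quantities at $(r_0,s_0)$. **Theorem.** Assume (A1)–(A5) and - (i) $\displaystyle\frac{2D_1^*\widetilde K_1}{L_{1m}K_{1m}^2}\Big(\frac{2K_{1M}^2}{K_{1m}^2}+1\Big)<1$; - (ii) for every $s_0>s_2$, at $r_0=\overline r_0(s_0)$ and at the fixed point $(f_1,f_2)\in\mathcal K$ of $\Psi_{r_0,s_0}$ (at every fixed point, should there be several), $\displaystyle\frac{D_1^*G_1(r_0)}{H^2}-B<-Qs_0^\nu e^{-s_0^2}\Phi_1(r_0)$; - (iii) $\displaystyle\frac{D_1^*K_{1m}}{2L_{1M}K_{1M}^2}>B$; - (iv) either $W_{inf}(r_0,s_0)>M$ for all $s_0>s_2$ close to $s_2$ and $W_{sup}(r_0,s_0)<M$ for all large $s_0$, or $W_{sup}(r_0,s_0)<M$ for all $s_0>s_2$ close to $s_2$ and $W_{inf}(r_0,s_0)>M$ for all large $s_0$. Here $r_0=r_0^*(s_0)$, where either (a) the inequalities are required for every choice $r_0^*(s_0)\in S(s_0)$, or (b) $s_0\mapsto r_0^*(s_0)\in S(s_0)$ is one continuous function on $(s_2,\infty)$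 and the inequalities are required for this function only. Then there exist $\widehat s_0>s_2$ and a value $r_0^*=r_0^*(\widehat s_0)$ (in case (a) an element of $S(\widehat s_0)$, in case (b) the value of the given function at $\widehat s_0$) with $(r_0^*,\widehat s_0)\in\Sigma$ such that $\Psi_{r_0^*,\widehat s_0}$ has exactly one fixed point $(f_1^*,f_2^*)$ in $\mathcal K$, and $(f_1^*,f_2^*)$, $r_0=r_0^*$, $s_0=\widehat s_0$ satisfy (1) and (2). -/

import Mathlib

open Set Filter Topology
open scoped BoundedContinuousFunction

noncomputable section

/-- The raw data: physical constants, the coefficient functions `L`, `N`, `K` (evaluated at the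
similarity variable and at the dimensionless temperature), and the constants that occur in the
structural assumptions (`_m`, `_M` for lower and upper bounds, `_t` for Lipschitz constants). -/
structure Contact where
  /-- exponent of the geometry -/
  ν : ℝ
  a : ℝ
  Q : ℝ
  M : ℝ
  B : ℝ
  /-- contact voltage -/
  Uc : ℝ
  c₀ : ℝ
  γ₀ : ℝ
  /-- Thomson coefficient of the liquid zone -/
  σ₁ : ℝ
  /-- Thomson coefficient of the solid zone -/
  σ₂ : ℝ
  L : ℝ → ℝ → ℝ
  N : ℝ → ℝ → ℝ
  K : ℝ → ℝ → ℝ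
  μ : ℝ
  L1m : ℝ
  L1M : ℝ
  N1m : ℝ
  N1M : ℝ
  K1m : ℝ
  K1M : ℝ
  L2m : ℝ
  L2M : ℝ
  N2m : ℝ
  N2M : ℝ
  K2m : ℝ
  K2M : ℝ
  L1t : ℝ
  N1t : ℝ
  K1t : ℝ
  L2t : ℝ
  N2t : ℝ
  K2t : ℝ

/-- `C[s₀, r₀]` with the sup norm. -/
abbrev LiquidSpace (r₀ s₀ : ℝ) : Type := C(Icc s₀ r₀, ℝ)

/-- `C_b[r₀, ∞)` with the sup norm. -/
abbrev SolidSpace (r₀ : ℝ) : Type := Ici r₀ →ᵇ ℝ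

/-- The set `ℳ` of bounded continuous `f₂` on `[r₀, ∞)` with `f₂(r₀) = 0`, `f₂(+∞) = -1`. -/
def solidSet (r₀ : ℝ) : Set (SolidSpace r₀) :=
  {f₂ | f₂ ⟨r₀, self_mem_Ici⟩ = 0 ∧ Tendsto (fun η => f₂ η) atTop (𝓝 (-1))}

/-- The set `𝒦 = C[s₀, r₀] × ℳ`, inside the Banach space `C[s₀, r₀] × C_b[r₀, ∞)` (max norm). -/
def stateSet (r₀ s₀ : ℝ) : Set (LiquidSpace r₀ s₀ × SolidSpace r₀) :=
  {f | f.2 ∈ solidSet r₀}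

/-- Extension by zero to `ℝ` of a function given on `S`, so that it can stand under an integral
sign; the integrals below only use its values on `S`. -/
def zeroExt {S : Set ℝ} (f : S → ℝ) : ℝ → ℝ := Function.extend Subtype.val f 0

namespace Contact

variable (p : Contact)

def D₁ : ℝ := p.σ₁ * p.Uc / (2 * p.c₀ * p.γ₀ * p.a)
def D₂ : ℝ := p.σ₂ * p.Uc / (2 * p.c₀ * p.γ₀ * p.a)
def D₁s : ℝ := p.Uc * p.D₁ / 2
def D₂s : ℝ := p.Uc * p.D₂ / 2

/-! ### The standing assumptions -/

/-- Sign and range conditions on the physical constants, and measurability of the coefficients in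
the similarity variable. -/
structure Standing : Prop where
  ν_pos : 0 < p.ν
  ν_lt_one : p.ν < 1
  a_pos : 0 < p.a
  Q_pos : 0 < p.Q
  M_pos : 0 < p.M
  Uc_pos : 0 < p.Uc
  c₀_pos : 0 < p.c₀
  γ₀_pos : 0 < p.γ₀
  σ₁_pos : 0 < p.σ₁
  σ₂_pos : 0 < p.σ₂
  L_meas : ∀ x, Measurable fun η => p.L η x
  N_meas : ∀ x, Measurable fun η => p.N η x
  K_meas : ∀ x, Measurable fun η => p.K η x

/-- The constants of the structural assumptions are positive. -/
structure PosConsts : Prop where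
  L1m : 0 < p.L1m
  L1M : 0 < p.L1M
  N1m : 0 < p.N1m
  N1M : 0 < p.N1M
  K1m : 0 < p.K1m
  K1M : 0 < p.K1M
  L2m : 0 < p.L2m
  L2M : 0 < p.L2M
  N2m : 0 < p.N2m
  N2M : 0 < p.N2M
  K2m : 0 < p.K2m
  K2M : 0 < p.K2M
  L1t : 0 < p.L1t
  N1t : 0 < p.N1t
  K1t : 0 < p.K1t
  L2t : 0 < p.L2t
  N2t : 0 < p.N2t
  K2t : 0 < p.K2t

/-- Bounds of the coefficients in the liquid zone. -/
def A1 : Prop :=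
  ∀ s₀ r₀ : ℝ, 0 < s₀ → s₀ < r₀ → ∀ (f : LiquidSpace r₀ s₀) (η : Icc s₀ r₀),
    (p.L1m * (η : ℝ) ^ p.μ ≤ p.L η (f η) ∧ p.L η (f η) ≤ p.L1M * (η : ℝ) ^ p.μ) ∧
    (p.N1m * (η : ℝ) ^ (-p.μ) ≤ p.N η (f η) ∧ p.N η (f η) ≤ p.N1M * (η : ℝ) ^ (-p.μ)) ∧
    (p.K1m * (η : ℝ) ^ (-p.μ) ≤ p.K η (f η) ∧ p.K η (f η) ≤ p.K1M * (η : ℝ) ^ (-p.μ))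

/-- Bounds of the coefficients in the solid zone. -/
def A2 : Prop :=
  ∀ r₀ : ℝ, 0 < r₀ → ∀ f ∈ solidSet r₀, ∀ η : Ici r₀,
    (p.L2m * (η : ℝ) ^ p.μ ≤ p.L η (f η) ∧ p.L η (f η) ≤ p.L2M * (η : ℝ) ^ p.μ) ∧
    (p.N2m * (η : ℝ) ^ (-p.μ) ≤ p.N η (f η) ∧ p.N η (f η) ≤ p.N2M * (η : ℝ) ^ (-p.μ)) ∧
    (p.K2m * (η : ℝ) ^ (-p.μ) ≤ p.K η (f η) ∧ p.K η (f η) ≤ p.K2M * (η : ℝ) ^ (-p.μ))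

/-- Lipschitz conditions in the liquid zone. -/
def A3 : Prop :=
  ∀ s₀ r₀ : ℝ, 0 < s₀ → s₀ < r₀ → ∀ (f g : LiquidSpace r₀ s₀) (η : Icc s₀ r₀),
    |p.L η (f η) - p.L η (g η)| ≤ p.L1t * ‖f - g‖ ∧
    |p.N η (f η) - p.N η (g η)| ≤ p.N1t * ‖f - g‖ ∧
    |p.K η (f η) - p.K η (g η)| ≤ p.K1t * (η : ℝ) ^ (-p.μ) * ‖f - g‖

/-- Lipschitz conditions in the solid zone. -/
def A4 : Prop :=
  ∀ r₀ : ℝ, 0 < r₀ → ∀ f ∈ solidSet r₀, ∀ g ∈ solidSet r₀, ∀ η : Ici r₀,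
    |p.L η (f η) - p.L η (g η)| ≤ p.L2t * ‖f - g‖ ∧
    |p.N η (f η) - p.N η (g η)| ≤ p.N2t * ‖f - g‖ ∧
    |p.K η (f η) - p.K η (g η)| ≤ p.K2t * (η : ℝ) ^ (-p.μ) * ‖f - g‖

def A5 : Prop := 2 < p.μ

/-! ### The integral operators

`f₁`, `f₂` are real functions on `ℝ` of which only the values on `[s₀, r₀]`, respectively on
`[r₀, ∞)`, matter. The suffix `Top` denotes the value at `η = +∞`. -/

section operators

variable (r₀ s₀ : ℝ) (f₁ f₂ : ℝ → ℝ)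

def F₁ (η : ℝ) : ℝ := ∫ v in s₀..η, p.K v (f₁ v) / v ^ p.ν

def F₂Top : ℝ := ∫ v in Ioi r₀, p.K v (f₂ v) / v ^ p.ν

def H : ℝ := p.F₁ s₀ f₁ r₀ + p.F₂Top r₀ f₂

def E₁ (η : ℝ) : ℝ :=
  Real.exp (-∫ v in s₀..η, (2 * p.a * v * (p.N v (f₁ v) / p.L v (f₁ v)) +
    p.D₁ / p.H r₀ s₀ f₁ f₂ * (p.K v (f₁ v) / (p.L v (f₁ v) * v ^ p.ν))))

def E₂ (η : ℝ) : ℝ :=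
  Real.exp (-∫ v in r₀..η, (2 * p.a * v * (p.N v (f₂ v) / p.L v (f₂ v)) +
    p.D₂ / p.H r₀ s₀ f₁ f₂ * (p.K v (f₂ v) / (p.L v (f₂ v) * v ^ p.ν))))

def Φ₁ (η : ℝ) : ℝ := ∫ v in s₀..η, p.E₁ r₀ s₀ f₁ f₂ v / (p.L v (f₁ v) * v ^ p.ν)

def Φ₂ (η : ℝ) : ℝ := ∫ v in r₀..η, p.E₂ r₀ s₀ f₁ f₂ v / (p.L v (f₂ v) * v ^ p.ν)

def Φ₂Top : ℝ := ∫ v in Ioi r₀, p.E₂ r₀ s₀ f₁ f₂ v / (p.L v (f₂ v) * v ^ p.ν)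

def H₁ (η : ℝ) : ℝ := ∫ v in s₀..η, p.K v (f₁ v) / (v ^ p.ν * p.E₁ r₀ s₀ f₁ f₂ v)

def H₂ (η : ℝ) : ℝ := ∫ v in r₀..η, p.K v (f₂ v) / (v ^ p.ν * p.E₂ r₀ s₀ f₁ f₂ v)

def G₁ (η : ℝ) : ℝ :=
  ∫ v in s₀..η, p.E₁ r₀ s₀ f₁ f₂ v / (p.L v (f₁ v) * v ^ p.ν) * p.H₁ r₀ s₀ f₁ f₂ v

def G₂ (η : ℝ) : ℝ :=
  ∫ v in r₀..η, p.E₂ r₀ s₀ f₁ f₂ v / (p.L v (f₂ v) * v ^ p.ν) * p.H₂ r₀ s₀ f₁ f₂ v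

def G₂Top : ℝ :=
  ∫ v in Ioi r₀, p.E₂ r₀ s₀ f₁ f₂ v / (p.L v (f₂ v) * v ^ p.ν) * p.H₂ r₀ s₀ f₁ f₂ v

def V₁ (η : ℝ) : ℝ :=
  s₀ ^ p.ν * p.Q * Real.exp (-s₀ ^ 2) * (p.Φ₁ r₀ s₀ f₁ f₂ r₀ - p.Φ₁ r₀ s₀ f₁ f₂ η) +
    p.D₁s / p.H r₀ s₀ f₁ f₂ ^ 2 * (p.G₁ r₀ s₀ f₁ f₂ r₀ - p.G₁ r₀ s₀ f₁ f₂ η)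

def V₂ (η : ℝ) : ℝ :=
  (p.D₂s / p.H r₀ s₀ f₁ f₂ ^ 2 * p.G₂Top r₀ s₀ f₁ f₂ - 1) *
      (p.Φ₂ r₀ s₀ f₁ f₂ η / p.Φ₂Top r₀ s₀ f₁ f₂) -
    p.D₂s / p.H r₀ s₀ f₁ f₂ ^ 2 * p.G₂ r₀ s₀ f₁ f₂ η

/-- The first free-boundary equation. -/
def FreeBdry₁ : Prop :=
  s₀ ^ p.ν * p.Q * Real.exp (-s₀ ^ 2) * p.Φ₁ r₀ s₀ f₁ f₂ r₀ +
    p.D₁s / p.H r₀ s₀ f₁ f₂ ^ 2 * p.G₁ r₀ s₀ f₁ f₂ r₀ = p.B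

/-- The second free-boundary equation. -/
def FreeBdry₂ : Prop :=
  p.E₁ r₀ s₀ f₁ f₂ r₀ * (p.Q * Real.exp (-s₀ ^ 2) * s₀ ^ p.ν +
      p.D₁s / p.H r₀ s₀ f₁ f₂ ^ 2 * p.H₁ r₀ s₀ f₁ f₂ r₀) -
    1 / p.Φ₂Top r₀ s₀ f₁ f₂ * (1 - p.D₂s / p.H r₀ s₀ f₁ f₂ ^ 2 * p.G₂Top r₀ s₀ f₁ f₂) =
  p.M * r₀ ^ (p.ν + 1)

/-- `X = Z - B`, where `Z = D₁* G₁(r₀) / H²`. -/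
def X : ℝ := p.D₁s * p.G₁ r₀ s₀ f₁ f₂ r₀ / p.H r₀ s₀ f₁ f₂ ^ 2 - p.B

def Y : ℝ := -(p.Q * s₀ ^ p.ν * Real.exp (-s₀ ^ 2) * p.Φ₁ r₀ s₀ f₁ f₂ r₀)

end operators

/-- The operator `Ψ = (V₁, V₂)`, its values taken as plain functions on `[s₀, r₀]` and
`[r₀, ∞)`. -/
def Ψ (r₀ s₀ : ℝ) (f : LiquidSpace r₀ s₀ × SolidSpace r₀) : (Icc s₀ r₀ → ℝ) × (Ici r₀ → ℝ) :=
  (fun η => p.V₁ r₀ s₀ (zeroExt f.1) (zeroExt f.2) η,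
   fun η => p.V₂ r₀ s₀ (zeroExt f.1) (zeroExt f.2) η)

/-- `f ∈ 𝒦` is a fixed point of `Ψ`: `f₁ = V₁(f₁, f₂)` on `[s₀, r₀]` and `f₂ = V₂(f₁, f₂)` on
`[r₀, ∞)`. -/
def IsFixedPoint (r₀ s₀ : ℝ) (f : LiquidSpace r₀ s₀ × SolidSpace r₀) : Prop :=
  f ∈ stateSet r₀ s₀ ∧ p.Ψ r₀ s₀ f = (⇑f.1, ⇑f.2)

/-! ### The bounds from which the thresholds are built -/

section bounds

/-- The exponent `μ + ν - 1`. -/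
def κ : ℝ := p.μ + p.ν - 1

variable (r₀ s₀ : ℝ)

def Hinf : ℝ := p.K1m / p.κ * (1 / s₀ ^ p.κ - 1 / r₀ ^ p.κ)

def Hsup : ℝ := 1 / p.κ * (p.K1M / s₀ ^ p.κ + p.K2M / r₀ ^ p.κ)

def Ht : ℝ := 1 / p.κ * (p.K1t / s₀ ^ p.κ + p.K2t / r₀ ^ p.κ)

def E1inf : ℝ :=
  Real.exp (-(p.a * (p.N1M / (p.L1m * (p.μ - 1))) * (1 / s₀ ^ (2 * p.μ - 2)) +
    p.D₁ * p.K1M / (p.Hinf r₀ s₀ * p.L1m * (2 * p.μ + p.ν - 1)) *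
      (1 / s₀ ^ (2 * p.μ + p.ν - 1))))

def E1t : ℝ :=
  2 * p.a * (p.N1t / (p.L1m * (p.μ - 2)) * (1 / s₀ ^ (p.μ - 2)) +
    p.N1M * p.L1t / (p.L1m ^ 2 * (3 * p.μ - 2)) * (1 / s₀ ^ (3 * p.μ - 2))) +
  p.D₁ * (p.K1t / (p.Hinf r₀ s₀ * p.L1m * (2 * p.μ + p.ν - 1)) *
      (1 / s₀ ^ (2 * p.μ + p.ν - 1)) +
    p.K1M / (p.Hinf r₀ s₀ * p.L1m) *
      (p.Ht r₀ s₀ / (p.Hinf r₀ s₀ * (2 * p.μ + p.ν - 1)) * (1 / s₀ ^ (2 * p.μ + p.ν - 1)) +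
        p.L1t / (p.L1m * (3 * p.μ + p.ν - 1)) * (1 / s₀ ^ (3 * p.μ + p.ν - 1))))

def Φ1t : ℝ :=
  p.E1t r₀ s₀ / (p.L1m * p.κ) * (1 / s₀ ^ p.κ) +
    p.L1t / (p.L1m ^ 2 * (2 * p.μ + p.ν - 1)) * (1 / s₀ ^ (2 * p.μ + p.ν - 1))

/-- Lower bound of `H₁(r₀)`. -/
def H1inf : ℝ := p.K1m / p.κ * (1 / s₀ ^ p.κ - 1 / r₀ ^ p.κ)

def H1sup : ℝ := p.K1M / p.E1inf r₀ s₀ * (1 / p.κ) * (1 / s₀ ^ p.κ)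

def H1t : ℝ :=
  (p.K1t + p.K1M * p.E1t r₀ s₀ / p.E1inf r₀ s₀) * (1 / (p.E1inf r₀ s₀ * p.κ)) * (1 / s₀ ^ p.κ)

def G1sup : ℝ := p.H1sup r₀ s₀ / p.L1m * (1 / p.κ) * (1 / s₀ ^ p.κ)

def G1t : ℝ :=
  p.H1sup r₀ s₀ * p.Φ1t r₀ s₀ + p.H1t r₀ s₀ / p.L1m * (1 / p.κ) * (1 / s₀ ^ p.κ)

def E2inf : ℝ :=
  Real.exp (-(p.a * (p.N2M / (p.L2m * (p.μ - 1))) * (1 / r₀ ^ (2 * p.μ - 2)) +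
    p.D₂ * p.K2M / (p.Hinf r₀ s₀ * p.L2m * (2 * p.μ + p.ν - 1)) *
      (1 / r₀ ^ (2 * p.μ + p.ν - 1))))

def E2t : ℝ :=
  2 * p.a * (p.N2t / (p.L2m * (p.μ - 2)) * (1 / r₀ ^ (p.μ - 2)) +
    p.N2M * p.L2t / (p.L2m ^ 2 * (3 * p.μ - 2)) * (1 / r₀ ^ (3 * p.μ - 2))) +
  p.D₂ * (p.K2t / (p.Hinf r₀ s₀ * p.L2m * (2 * p.μ + p.ν - 1)) *
      (1 / r₀ ^ (2 * p.μ + p.ν - 1)) +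
    p.K2M / (p.Hinf r₀ s₀ * p.L2m) *
      (p.Ht r₀ s₀ / (p.Hinf r₀ s₀ * (2 * p.μ + p.ν - 1)) * (1 / r₀ ^ (2 * p.μ + p.ν - 1)) +
        p.L2t / (p.L2m * (3 * p.μ + p.ν - 1)) * (1 / r₀ ^ (3 * p.μ + p.ν - 1))))

/-- Lower bound of `Φ₂(+∞)`. -/
def Φ2infTop : ℝ := p.E2inf r₀ s₀ / p.L2M * (1 / p.κ) * (1 / r₀ ^ p.κ)

def Φ2sup : ℝ := 1 / p.L2m * (1 / p.κ) * (1 / r₀ ^ p.κ)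

def Φ2t : ℝ :=
  p.E2t r₀ s₀ / p.L2m * (1 / p.κ) * (1 / r₀ ^ p.κ) +
    p.L2t / p.L2m ^ 2 * (1 / (2 * p.μ + p.ν - 1)) * (1 / r₀ ^ (2 * p.μ + p.ν - 1))

def H2sup : ℝ := p.K2M / p.E2inf r₀ s₀ * (1 / p.κ) * (1 / r₀ ^ p.κ)

def H2t : ℝ :=
  (p.K2t + p.K2M * p.E2t r₀ s₀ / p.E2inf r₀ s₀) * (1 / (p.E2inf r₀ s₀ * p.κ)) * (1 / r₀ ^ p.κ)

/-- Lower bound of `G₂(+∞)`. -/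
def G2infTop : ℝ := p.K2m * p.E2inf r₀ s₀ / (2 * p.L2M * p.κ ^ 2) * (1 / r₀ ^ p.κ) ^ 2

def G2sup : ℝ := p.H2sup r₀ s₀ / p.L2m * (1 / p.κ) * (1 / r₀ ^ p.κ)

def G2t : ℝ :=
  p.H2sup r₀ s₀ * p.Φ2t r₀ s₀ + p.H2t r₀ s₀ / p.L2m * (1 / p.κ) * (1 / r₀ ^ p.κ)

/-- Lipschitz bound of `V₁`. -/
def ε₁ : ℝ :=
  2 * s₀ ^ p.ν * p.Q * Real.exp (-s₀ ^ 2) * p.Φ1t r₀ s₀ +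
    2 * p.D₁s * (p.G1sup r₀ s₀ * 2 * p.Hsup r₀ s₀ * p.Ht r₀ s₀ / p.Hinf r₀ s₀ ^ 4 +
      p.G1t r₀ s₀ / p.Hinf r₀ s₀ ^ 2)

def ε21 : ℝ := 2 * p.Φ2t r₀ s₀ / p.Φ2infTop r₀ s₀

def ε22 : ℝ :=
  p.G2t r₀ s₀ / p.Hinf r₀ s₀ ^ 2 +
    2 * p.G2sup r₀ s₀ * p.Hsup r₀ s₀ * p.Ht r₀ s₀ / p.Hinf r₀ s₀ ^ 4

def ε23 : ℝ :=
  p.Φ2sup r₀ / p.Φ2infTop r₀ s₀ * p.ε22 r₀ s₀ +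
    p.G2sup r₀ s₀ / p.Hinf r₀ s₀ ^ 2 * p.ε21 r₀ s₀

/-- Lipschitz bound of `V₂`. -/
def ε₂ : ℝ := p.ε21 r₀ s₀ + p.D₂s * (p.ε22 r₀ s₀ + p.ε23 r₀ s₀)

/-- Lower bound of `Z`. -/
def Zinf : ℝ :=
  p.D₁s * p.E1inf r₀ s₀ * p.K1m / (2 * p.L1M) *
    ((r₀ ^ p.κ - s₀ ^ p.κ) / (p.K1M * r₀ ^ p.κ + p.K2M * s₀ ^ p.κ)) ^ 2

end bounds

/-! ### Thresholds -/

/-- `j₁(s₀) = ε₁(+∞, s₀)`. -/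
def j₁ (s₀ : ℝ) : ℝ := limUnder atTop fun r₀ => p.ε₁ r₀ s₀

/-- The threshold `s₁`: the decreasing function `j₁` is below `1` exactly beyond `s₁`. -/
def s₁ : ℝ := sInf {s₀ | 0 < s₀ ∧ p.j₁ s₀ < 1}

/-- The point `r₁(s₀) > s₀` beyond which `ε₁(·, s₀)` is below `1`. -/
def r₁ (s₀ : ℝ) : ℝ := sInf {r₀ | s₀ < r₀ ∧ p.ε₁ r₀ s₀ < 1}

/-- The point `r₂(s₀) > s₀` beyond which `ε₂(·, s₀)` is below `1`. -/
def r₂ (s₀ : ℝ) : ℝ := sInf {r₀ | s₀ < r₀ ∧ p.ε₂ r₀ s₀ < 1}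

def rbar (s₀ : ℝ) : ℝ := max (p.r₁ s₀) (p.r₂ s₀)

/-- The set `Σ` of pairs `(r₀, s₀)`. -/
def sigmaSet : Set (ℝ × ℝ) := {q | p.s₁ < q.2 ∧ p.rbar q.2 < q.1}

/-- `j₂(s₀) = Z_inf(+∞, s₀)`. -/
def j₂ (s₀ : ℝ) : ℝ := limUnder atTop fun r₀ => p.Zinf r₀ s₀

def s₂ : ℝ := sInf {s₀ | p.s₁ ≤ s₀ ∧ p.B ≤ p.j₂ s₀}

/-- The point `r_B(s₀) > s₀` at which the increasing function `Z_inf(·, s₀)` reaches `B`. -/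
def rB (s₀ : ℝ) : ℝ := sInf {r₀ | s₀ < r₀ ∧ p.B ≤ p.Zinf r₀ s₀}

/-- The solutions `r₀*(s₀)` in `(r̄₀(s₀), r_B(s₀))` of the first free-boundary equation, in which
`(f₁, f₂)` is the fixed point of `Ψ`. -/
def firstSolutions (s₀ : ℝ) : Set ℝ :=
  {r₀ | r₀ ∈ Ioo (p.rbar s₀) (p.rB s₀) ∧
    ∃ f, p.IsFixedPoint r₀ s₀ f ∧ p.FreeBdry₁ r₀ s₀ (zeroExt f.1) (zeroExt f.2)}

/-- `W_inf(s₀)`, with `r₀` the value of `r₀*(s₀)`. -/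
def Winf (r₀ s₀ : ℝ) : ℝ :=
  p.E1inf r₀ s₀ / p.rB s₀ ^ (p.ν + 1) *
      (p.Q * Real.exp (-s₀ ^ 2) * s₀ ^ p.ν + p.D₁s / p.Hsup r₀ s₀ ^ 2 * p.H1inf r₀ s₀) -
    1 / (p.rbar s₀ ^ (p.ν + 1) * p.Φ2infTop r₀ s₀) +
    1 / (p.rB s₀ ^ (p.ν + 1) * p.Φ2sup r₀) * (p.D₂s / p.Hsup r₀ s₀ ^ 2) * p.G2infTop r₀ s₀

/-- `W_sup(s₀)`, with `r₀` the value of `r₀*(s₀)`. -/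
def Wsup (r₀ s₀ : ℝ) : ℝ :=
  1 / p.rbar s₀ ^ (p.ν + 1) *
    (p.Q * Real.exp (-s₀ ^ 2) * s₀ ^ p.ν + p.D₁s / p.Hinf r₀ s₀ ^ 2 * p.H1sup r₀ s₀ +
      1 / p.Φ2infTop r₀ s₀ * (p.D₂s / p.Hinf r₀ s₀ ^ 2) * p.G2sup r₀ s₀)

/-! ### The hypotheses on the thresholds -/

/-- The smallness condition `j₁(+∞) < 1`. -/
def HipEps1 : Prop :=
  2 * p.D₁s * p.K1t / (p.L1m * p.K1m ^ 2) * (2 * p.K1M ^ 2 / p.K1m ^ 2 + 1) < 1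

/-- `X < Y` at `(r̄₀(s₀), s₀)`, evaluated at the fixed point of `Ψ`, for every `s₀ > s₂`. -/
def HipXY : Prop :=
  ∀ s₀, p.s₂ < s₀ → ∀ f, p.IsFixedPoint (p.rbar s₀) s₀ f →
    p.X (p.rbar s₀) s₀ (zeroExt f.1) (zeroExt f.2) < p.Y (p.rbar s₀) s₀ (zeroExt f.1) (zeroExt f.2)

def HipZinfty : Prop := p.B < p.D₁s * p.K1m / (2 * p.L1M * p.K1M ^ 2)

/-- The inequalities between `W_inf`, `W_sup` and `M` near the two ends `s₂` and `+∞`, where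
`R s₀` is the set of values admitted for `r₀*(s₀)`. -/
def HipW (R : ℝ → Set ℝ) : Prop :=
  ((∀ᶠ s₀ in 𝓝[>] p.s₂, ∀ r₀ ∈ R s₀, p.M < p.Winf r₀ s₀) ∧
    (∀ᶠ s₀ in atTop, ∀ r₀ ∈ R s₀, p.Wsup r₀ s₀ < p.M)) ∨
  ((∀ᶠ s₀ in 𝓝[>] p.s₂, ∀ r₀ ∈ R s₀, p.Wsup r₀ s₀ < p.M) ∧
    (∀ᶠ s₀ in atTop, ∀ r₀ ∈ R s₀, p.M < p.Winf r₀ s₀))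

/-- The admissible meanings of `s₀ ↦ r₀*(s₀)` on `(s₂, ∞)`: either every solution of the first
free-boundary equation is admitted, or a single one is chosen, continuously in `s₀`. -/
def IsRStar (R : ℝ → Set ℝ) : Prop :=
  (∀ s₀, p.s₂ < s₀ → R s₀ = p.firstSolutions s₀) ∨
  ∃ ρ : ℝ → ℝ, ContinuousOn ρ (Ioi p.s₂) ∧
    ∀ s₀, p.s₂ < s₀ → ρ s₀ ∈ p.firstSolutions s₀ ∧ R s₀ = {ρ s₀}

end Contact

end

/-! For a fixed pair `(r, s)` the operator `Ψ` is a contraction once `ε₁ ≤ 1` and `ε₂ ≤ 1`, so its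
fixed point is unique and moves continuously with `(r, s)`. Inserting it into the free-boundary
equations leaves two scalar equations in the plane: `face r s = B`, where `face` is `V₁` at `η = s`,
and `flux r s = M`, where `flux` is the left side of the second equation divided by `r ^ (ν + 1)`.
They are solved on the region `rbar s ≤ r ≤ rB s` with `s₂ < s`.

On the lower graph `face < B` is exactly `HipXY`. On the upper graph `face > Zinf = B`, because
`face` exceeds `Zinf` by at least a positive `Q`-term. On solutions of the first equation `Winf ≤
flux ≤ Wsup`, so `HipW` gives `flux - M` opposite signs at some `a` near `s₂` and some large `b`. If
a continuous branch of solutions is given, the ordinary intermediate value theorem finishes. If not,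
the zeros of `face - B` need not form a graph, and a planar intermediate value theorem is used
(`exists_common_zero_between`). It prescribes the sign of the second function on the vertical sides
only at zeros of the first. Its proof is an angle argument: without a common zero, `F + iG` has a
continuous logarithm on the square, and the sign conditions on the four sides are incompatible with
a single-valued argument.

The contraction estimates reduce to three nonnegative densities on the line: the exponent `w` of
`E_i`, `l = 1 / (L v^ν)` and `k = K / v^ν`, each cut off to its zone. The densities of `Φ_i`, `H_i`,
`G_i` are Lipschitz in these for the `L¹` norm, and integrating powers of `v` produces the stated
constants. The estimates are slightly better than `ε₁`, `ε₂` (namely `ε₁ / 2` and `q₂ < ε₂`), so the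
contraction persists on the curve `r = rbar s`, where the larger of the two thresholds makes an `ε`
equal to `1`. The planar argument and `HipXY` both need this boundary.

After scaling, `ε₁`, `ε₂` and `Zinf` depend only on `s⁻¹` or `r⁻¹`, on `(s / r) ^ κ`, and for `ε₁`
on the coefficient `cQ s`. They are continuous and strictly monotone in `r`, so the infima defining
the thresholds are genuine level points, continuous in `s`. `HipEps1` and `HipZinfty` are the limits
of `j₁ < 1` and `B < j₂` as `s → ∞`.

For continuity of the fixed point the operator is extended to bounded continuous functions on the
whole line, a space independent of `(r, s)`. Dominated convergence and the contraction estimate with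
a parameter then apply. -/

set_option linter.unusedSectionVars false

/-! ### A planar intermediate value theorem. -/

noncomputable section

/-- A nowhere vanishing continuous function on the plane has a continuous logarithm on any compact
set. -/
theorem exists_continuous_log {φ : ℝ × ℝ → ℂ} (hφ : Continuous φ) (h0 : ∀ x, φ x ≠ 0)
    {C : Set (ℝ × ℝ)} (hC : IsCompact C) :
    ∃ θ : ℝ × ℝ → ℂ, ContinuousOn θ C ∧ ∀ x ∈ C, Complex.exp (θ x) = φ x := by
  have hcpt : IsCompact (Icc (0 : ℝ) 1 ×ˢ C) := isCompact_Icc.prod hC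
  have hcont : Continuous fun q : ℝ × ℝ × ℝ => φ (q.1 • q.2) := by fun_prop
  obtain ⟨δ, hδ, hmin⟩ : ∃ δ > 0, ∀ q ∈ Icc (0 : ℝ) 1 ×ˢ C, δ ≤ ‖φ (q.1 • q.2)‖ := by
    rcases (Icc (0 : ℝ) 1 ×ˢ C).eq_empty_or_nonempty with he | hne
    · exact ⟨1, one_pos, by simp [he]⟩
    · obtain ⟨q₀, _, hq⟩ := hcpt.exists_isMinOn hne hcont.norm.continuousOn
      exact ⟨_, norm_pos_iff.2 (h0 _), fun q hq' => hq hq'⟩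
  obtain ⟨ε, hε, hunif⟩ := Metric.uniformContinuousOn_iff.1
    (hcpt.uniformContinuousOn_of_continuous hcont.continuousOn) δ hδ
  obtain ⟨n, hn⟩ := exists_nat_one_div_lt hε
  set N : ℝ := (n : ℝ) + 1 with hN
  have hNpos : 0 < N := by positivity
  -- A logarithm of `x ↦ φ ((k / N) • x)` is built by induction on `k`. It is constant at `k = 0`;
  -- each step adds the principal logarithm of the quotient of two consecutive values.
  have key : ∀ k : ℕ, (k : ℝ) ≤ N → ∃ θ : ℝ × ℝ → ℂ, ContinuousOn θ C ∧
      ∀ x ∈ C, Complex.exp (θ x) = φ ((k / N : ℝ) • x) := by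
    intro k
    induction k with
    | zero =>
      intro _
      exact ⟨fun _ => Complex.log (φ 0), continuousOn_const, fun x _ => by
        simp [Complex.exp_log (h0 0)]⟩
    | succ k ih =>
      intro hk
      push_cast at hk
      obtain ⟨θ, hθ, hexp⟩ := ih (by linarith)
      have hslit : ∀ x ∈ C, φ (((k + 1) / N : ℝ) • x) / φ ((k / N : ℝ) • x) ∈
          Complex.slitPlane := by
        intro x hx
        have m1 : (k / N : ℝ) ∈ Icc (0 : ℝ) 1 :=
          ⟨by positivity, (div_le_one hNpos).2 (by linarith)⟩
        have m2 : ((k + 1) / N : ℝ) ∈ Icc (0 : ℝ) 1 :=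
          ⟨by positivity, (div_le_one hNpos).2 (by linarith)⟩
        have hd := hunif (((k + 1) / N : ℝ), x) ⟨m2, hx⟩ ((k / N : ℝ), x) ⟨m1, hx⟩ (by
          rw [Prod.dist_eq, dist_self, Real.dist_eq, ← sub_div, add_sub_cancel_left,
            abs_of_pos (by positivity)]
          simpa using ⟨by simpa [hN] using hn, hε⟩)
        have hb := hmin ((k / N : ℝ), x) ⟨m1, hx⟩
        simp only [dist_eq_norm] at hd
        -- Numerator and denominator differ by less than `δ`, which is at most the norm of the
        -- denominator. The quotient is therefore within distance `1` of `1` and misses the branch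
        -- cut.
        apply Complex.mem_slitPlane_of_norm_lt_one (z := _ - 1) ?_ |> fun h => by
          simpa using h
        rw [div_sub_one (h0 _), norm_div, div_lt_one (norm_pos_iff.2 (h0 _))]
        linarith
      refine ⟨fun x => θ x + Complex.log (φ (((k + 1) / N : ℝ) • x) / φ ((k / N : ℝ) • x)),
        hθ.add (ContinuousOn.clog ?_ hslit), fun x hx => ?_⟩
      · exact (Continuous.div (by fun_prop) (by fun_prop) fun _ => h0 _).continuousOn
      · rw [Complex.exp_add, hexp x hx, Complex.exp_log (div_ne_zero (h0 _) (h0 _)),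
          mul_div_cancel₀ _ (h0 _)]
        push_cast
        rfl
  obtain ⟨θ, hθ, hexp⟩ := key (n + 1) (by simp [hN])
  refine ⟨θ, hθ, fun x hx => ?_⟩
  rw [hexp x hx, hN]
  push_cast
  rw [div_self (by positivity), one_smul]

/-- If `f` avoids all the points `a + 2πj` on a segment, then a bracket of its initial value
between two consecutive ones is a bracket of its final value. -/
theorem bracket_of_avoid {f : ℝ → ℝ} (hf : ContinuousOn f (Icc 0 1)) {a : ℝ}
    (hav : ∀ t ∈ Icc (0 : ℝ) 1, ∀ j : ℤ, f t ≠ a + 2 * Real.pi * j) :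
    ∃ j : ℤ, ∀ t ∈ Icc (0 : ℝ) 1, a + 2 * Real.pi * j < f t ∧ f t < a + 2 * Real.pi * (j + 1) := by
  have hpi := Real.pi_pos
  set j := ⌊(f 0 - a) / (2 * Real.pi)⌋ with hj
  have h1 : a + 2 * Real.pi * j ≤ f 0 := by
    have := Int.floor_le ((f 0 - a) / (2 * Real.pi))
    rw [le_div_iff₀ (by positivity)] at this
    linarith
  have h2 : f 0 < a + 2 * Real.pi * (j + 1) := by
    have := Int.lt_floor_add_one ((f 0 - a) / (2 * Real.pi))
    rw [div_lt_iff₀ (by positivity)] at this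
    linarith
  refine ⟨j, fun t ht => ⟨?_, ?_⟩⟩
  · by_contra! hc
    have hsub : Icc 0 t ⊆ Icc (0 : ℝ) 1 := Icc_subset_Icc_right ht.2
    obtain ⟨x, hx, hfx⟩ := intermediate_value_Icc' ht.1 (hf.mono hsub) ⟨hc, h1⟩
    exact hav x (hsub hx) j hfx
  · by_contra! hc
    have hsub : Icc 0 t ⊆ Icc (0 : ℝ) 1 := Icc_subset_Icc_right ht.2
    obtain ⟨x, hx, hfx⟩ := intermediate_value_Icc ht.1 (hf.mono hsub) ⟨h2.le, hc⟩
    exact hav x (hsub hx) (j + 1) (by rw [hfx]; push_cast; ring)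

/-- A planar intermediate value theorem: `F` is negative on the lower and positive on the upper side
of the unit square, and on the zeros of `F` in the left and right sides `G` has opposite signs. -/
theorem exists_common_zero_unitSquare {F G : ℝ × ℝ → ℝ} (hF : Continuous F) (hG : Continuous G)
    (hbot : ∀ x ∈ Icc (0 : ℝ) 1, F (x, 0) < 0) (htop : ∀ x ∈ Icc (0 : ℝ) 1, 0 < F (x, 1))
    (hleft : ∀ y ∈ Icc (0 : ℝ) 1, F (0, y) = 0 → 0 < G (0, y))
    (hright : ∀ y ∈ Icc (0 : ℝ) 1, F (1, y) = 0 → G (1, y) < 0) :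
    ∃ q ∈ Icc (0 : ℝ) 1 ×ˢ Icc (0 : ℝ) 1, F q = 0 ∧ G q = 0 := by
  by_contra! hno
  -- Clamping to the square makes `F + iG` nowhere zero on the whole plane, as the logarithm
  -- requires, without changing it on the square.
  let cl : ℝ × ℝ → ℝ × ℝ := fun q => (max 0 (min 1 q.1), max 0 (min 1 q.2))
  have hcl : Continuous cl := by fun_prop
  have hclm : ∀ q, cl q ∈ Icc (0 : ℝ) 1 ×ˢ Icc (0 : ℝ) 1 := fun q => by
    simp [cl]
  have hcle : ∀ q ∈ Icc (0 : ℝ) 1 ×ˢ Icc (0 : ℝ) 1, cl q = q := fun q hq => by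
    obtain ⟨⟨h1, h2⟩, h3, h4⟩ := hq
    simp [cl, h1, h2, h3, h4]
  obtain ⟨θ, hθ, hexp⟩ := exists_continuous_log
    (φ := fun q => (F (cl q) : ℂ) + G (cl q) * Complex.I)
    (by fun_prop) (fun q h => by
      have h1 := congrArg Complex.re h
      have h2 := congrArg Complex.im h
      simp at h1 h2
      exact hno _ (hclm q) h1 h2)
    (C := Icc (0 : ℝ) 1 ×ˢ Icc (0 : ℝ) 1) (isCompact_Icc.prod isCompact_Icc)
  have hre : ∀ q ∈ Icc (0 : ℝ) 1 ×ˢ Icc (0 : ℝ) 1,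
      F q = Real.exp (θ q).re * Real.cos (θ q).im := fun q hq => by
    have := congrArg Complex.re (hexp q hq)
    simpa [Complex.exp_re, hcle q hq] using this.symm
  have him : ∀ q ∈ Icc (0 : ℝ) 1 ×ˢ Icc (0 : ℝ) 1,
      G q = Real.exp (θ q).re * Real.sin (θ q).im := fun q hq => by
    have := congrArg Complex.im (hexp q hq)
    simpa [Complex.exp_im, hcle q hq] using this.symm
  have hcim : ContinuousOn (fun q => (θ q).im) (Icc (0 : ℝ) 1 ×ˢ Icc (0 : ℝ) 1) :=
    Complex.continuous_im.comp_continuousOn hθ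
  have hpi := Real.pi_pos
  have c1 : ∀ j : ℤ, Real.cos (Real.pi / 2 + 2 * Real.pi * j) = 0 := fun j => by
    rw [show Real.pi / 2 + 2 * Real.pi * j = Real.pi / 2 + j * (2 * Real.pi) by ring,
      Real.cos_add_int_mul_two_pi, Real.cos_pi_div_two]
  have c2 : ∀ j : ℤ, Real.cos (-(Real.pi / 2) + 2 * Real.pi * j) = 0 := fun j => by
    rw [show -(Real.pi / 2) + 2 * Real.pi * j = -(Real.pi / 2) + j * (2 * Real.pi) by ring,
      Real.cos_add_int_mul_two_pi, Real.cos_neg, Real.cos_pi_div_two]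
  have c3 : ∀ j : ℤ, Real.sin (Real.pi / 2 + 2 * Real.pi * j) = 1 := fun j => by
    rw [show Real.pi / 2 + 2 * Real.pi * j = Real.pi / 2 + j * (2 * Real.pi) by ring,
      Real.sin_add_int_mul_two_pi, Real.sin_pi_div_two]
  have c4 : ∀ j : ℤ, Real.sin (-(Real.pi / 2) + 2 * Real.pi * j) = -1 := fun j => by
    rw [show -(Real.pi / 2) + 2 * Real.pi * j = -(Real.pi / 2) + j * (2 * Real.pi) by ring,
      Real.sin_add_int_mul_two_pi, Real.sin_neg, Real.sin_pi_div_two]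
  have i0 : (0 : ℝ) ∈ Icc (0 : ℝ) 1 := by simp
  have i1 : (1 : ℝ) ∈ Icc (0 : ℝ) 1 := by simp
  have hne : ∀ q ∈ Icc (0 : ℝ) 1 ×ˢ Icc (0 : ℝ) 1, F q ≠ 0 → ∀ j : ℤ,
      (θ q).im ≠ Real.pi / 2 + 2 * Real.pi * j ∧ (θ q).im ≠ -(Real.pi / 2) + 2 * Real.pi * j :=
    fun q hq hFq j => ⟨fun h => hFq (by rw [hre q hq, h, c1, mul_zero]),
      fun h => hFq (by rw [hre q hq, h, c2, mul_zero])⟩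
  have hx : ∀ y ∈ Icc (0 : ℝ) 1, ContinuousOn (fun x => (θ (x, y)).im) (Icc 0 1) := fun y hy =>
    hcim.comp (by fun_prop) fun x hx => ⟨hx, hy⟩
  have hy : ∀ x ∈ Icc (0 : ℝ) 1, ContinuousOn (fun y => (θ (x, y)).im) (Icc 0 1) := fun x hx =>
    hcim.comp (by fun_prop) fun y hy => ⟨hx, hy⟩
  -- On the lower and upper sides `F ≠ 0`, so the angle misses both `π/2 + 2πℤ` and `-π/2 + 2πℤ`. On
  -- the left side a zero of `F` has positive sine, so only `-π/2 + 2πℤ` is known to be missed; on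
  -- the right side only `π/2 + 2πℤ`.
  obtain ⟨b, hb⟩ := bracket_of_avoid (hx 0 i0) (a := Real.pi / 2) fun t ht j =>
    (hne (t, 0) ⟨ht, i0⟩ (hbot t ht).ne j).1
  obtain ⟨b', hb'⟩ := bracket_of_avoid (hx 0 i0) (a := -(Real.pi / 2)) fun t ht j =>
    (hne (t, 0) ⟨ht, i0⟩ (hbot t ht).ne j).2
  obtain ⟨c, hc⟩ := bracket_of_avoid (hx 1 i1) (a := Real.pi / 2) fun t ht j =>
    (hne (t, 1) ⟨ht, i1⟩ (htop t ht).ne' j).1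
  obtain ⟨c', hc'⟩ := bracket_of_avoid (hx 1 i1) (a := -(Real.pi / 2)) fun t ht j =>
    (hne (t, 1) ⟨ht, i1⟩ (htop t ht).ne' j).2
  obtain ⟨l, hl⟩ := bracket_of_avoid (hy 0 i0) (a := -(Real.pi / 2)) fun t ht j h => by
    have hz : F (0, t) = 0 := by rw [hre (0, t) ⟨i0, ht⟩, h, c2, mul_zero]
    have hg := hleft t ht hz
    rw [him (0, t) ⟨i0, ht⟩, h, c4] at hg
    linarith [Real.exp_pos (θ (0, t)).re]
  obtain ⟨m, hm⟩ := bracket_of_avoid (hy 1 i1) (a := Real.pi / 2) fun t ht j h => by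
    have hz : F (1, t) = 0 := by rw [hre (1, t) ⟨i1, ht⟩, h, c1, mul_zero]
    have hg := hright t ht hz
    rw [him (1, t) ⟨i1, ht⟩, h, c3] at hg
    linarith [Real.exp_pos (θ (1, t)).re]
  have huniq : ∀ {a x : ℝ} {j k : ℤ}, a + 2 * Real.pi * j < x → x < a + 2 * Real.pi * (j + 1) →
      a + 2 * Real.pi * k < x → x < a + 2 * Real.pi * (k + 1) → j = k := by
    intro a x j k h1 h2 h3 h4
    have e1 : (j : ℝ) < k + 1 := by
      have : 2 * Real.pi * (j : ℝ) < 2 * Real.pi * (k + 1) := by linarith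
      exact lt_of_mul_lt_mul_left this (by positivity)
    have e2 : (k : ℝ) < j + 1 := by
      have : 2 * Real.pi * (k : ℝ) < 2 * Real.pi * (j + 1) := by linarith
      exact lt_of_mul_lt_mul_left this (by positivity)
    have e1' : j < k + 1 := by exact_mod_cast e1
    have e2' : k < j + 1 := by exact_mod_cast e2
    omega
  have hsign : ∀ x : ℝ, ∀ j : ℤ, x < Real.pi / 2 + 2 * Real.pi * j →
      -(Real.pi / 2) + 2 * Real.pi * j < x → 0 < Real.cos x := fun x j h1 h2 => by
    rw [← Real.cos_sub_int_mul_two_pi x j]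
    exact Real.cos_pos_of_mem_Ioo ⟨by linarith, by linarith⟩
  have hsign' : ∀ x : ℝ, ∀ j : ℤ, Real.pi / 2 + 2 * Real.pi * j < x →
      x < -(Real.pi / 2) + 2 * Real.pi * (j + 1) → Real.cos x < 0 := fun x j h1 h2 => by
    rw [← Real.cos_sub_int_mul_two_pi x j]
    exact Real.cos_neg_of_pi_div_two_lt_of_lt (by linarith) (by linarith)
  have hposF : ∀ q ∈ Icc (0 : ℝ) 1 ×ˢ Icc (0 : ℝ) 1, 0 < F q → 0 < Real.cos (θ q).im :=
    fun q hq h => by rw [hre q hq] at h; exact (pos_iff_pos_of_mul_pos h).1 (Real.exp_pos _)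
  have hnegF : ∀ q ∈ Icc (0 : ℝ) 1 ×ˢ Icc (0 : ℝ) 1, F q < 0 → Real.cos (θ q).im < 0 :=
    fun q hq h => by
      rw [hre q hq] at h
      exact neg_of_mul_neg_right h (Real.exp_pos _).le
  -- the brackets of the lower side, of the upper side, of the left side, of the right side
  have ebl : b' = l := huniq (hb' 0 i0).1 (hb' 0 i0).2 (hl 0 i0).1 (hl 0 i0).2
  have etl : c' = l := huniq (hc' 0 i0).1 (hc' 0 i0).2 (hl 1 i1).1 (hl 1 i1).2
  have ebm : b = m := huniq (hb 1 i1).1 (hb 1 i1).2 (hm 0 i0).1 (hm 0 i0).2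
  have etm : c = m := huniq (hc 1 i1).1 (hc 1 i1).2 (hm 1 i1).1 (hm 1 i1).2
  have hbc : (b : ℝ) = c := by rw [ebm, etm]
  have hbc' : (b' : ℝ) = c' := by rw [ebl, etl]
  -- The sign of the cosine puts the lower left angle in the upper half of its bracket `b'`, and the
  -- upper left angle in the lower half of its bracket `c'`.
  have k1 : Real.pi / 2 + 2 * Real.pi * b' < (θ (0, 0)).im := by
    by_contra! h
    rcases h.lt_or_eq with h | h
    · exact (hsign _ _ h (hb' 0 i0).1).not_gt (hnegF _ ⟨i0, i0⟩ (hbot 0 i0))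
    · exact (hne (0, 0) ⟨i0, i0⟩ (hbot 0 i0).ne b').1 h
  have k2 : (θ (0, 1)).im < Real.pi / 2 + 2 * Real.pi * c' := by
    by_contra! h
    rcases h.lt_or_eq with h | h
    · exact (hsign' _ _ h (hc' 0 i0).2).not_gt (hposF _ ⟨i0, i1⟩ (htop 0 i0))
    · exact (hne (0, 1) ⟨i0, i1⟩ (htop 0 i0).ne' c').1 h.symm
  have k3 := hb 0 i0
  have k4 := hc 0 i0
  have k5 := hb' 0 i0
  have k6 : (b' : ℝ) < b + 1 := by
    have : 2 * Real.pi * (b' : ℝ) < 2 * Real.pi * (b + 1) := by linarith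
    exact lt_of_mul_lt_mul_left this (by positivity)
  have k7 : (c : ℝ) < c' := by
    have : 2 * Real.pi * (c : ℝ) < 2 * Real.pi * c' := by linarith
    exact lt_of_mul_lt_mul_left this (by positivity)
  -- Integrality improves `b' < b + 1` to `b' ≤ b`, and the contradiction is `c < c' = b' ≤ b = c`.
  have k8 : (b' : ℝ) ≤ b := by
    have : b' < b + 1 := by exact_mod_cast k6
    have : b' ≤ b := by omega
    exact_mod_cast this
  linarith

/-- The planar intermediate value theorem between two graphs. -/
theorem exists_common_zero_between {a b : ℝ} (hab : a < b) {lo hi : ℝ → ℝ}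
    (hlo : ContinuousOn lo (Icc a b)) (hhi : ContinuousOn hi (Icc a b))
    (hlt : ∀ s ∈ Icc a b, lo s < hi s) {F G : ℝ → ℝ → ℝ}
    (hF : ContinuousOn (fun q : ℝ × ℝ => F q.1 q.2) {q | q.2 ∈ Icc a b ∧ q.1 ∈ Icc (lo q.2) (hi q.2)})
    (hG : ContinuousOn (fun q : ℝ × ℝ => G q.1 q.2) {q | q.2 ∈ Icc a b ∧ q.1 ∈ Icc (lo q.2) (hi q.2)})
    (hbot : ∀ s ∈ Icc a b, F (lo s) s < 0) (htop : ∀ s ∈ Icc a b, 0 < F (hi s) s)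
    (hleft : ∀ r ∈ Ioo (lo a) (hi a), F r a = 0 → 0 < G r a)
    (hright : ∀ r ∈ Ioo (lo b) (hi b), F r b = 0 → G r b < 0) :
    ∃ s ∈ Icc a b, ∃ r ∈ Ioo (lo s) (hi s), F r s = 0 ∧ G r s = 0 := by
  let sg : ℝ → ℝ := fun x => a + max 0 (min 1 x) * (b - a)
  have hsgc : Continuous sg := by fun_prop
  have hsg : ∀ x, sg x ∈ Icc a b := fun x => by
    have h1 : 0 ≤ max 0 (min 1 x) := le_max_left _ _
    have h2 : max 0 (min 1 x) ≤ 1 := max_le zero_le_one (min_le_left _ _)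
    exact ⟨by simp only [sg]; nlinarith, by simp only [sg]; nlinarith⟩
  have hloc : Continuous fun x => lo (sg x) := hlo.comp_continuous hsgc hsg
  have hhic : Continuous fun x => hi (sg x) := hhi.comp_continuous hsgc hsg
  -- `T` straightens the region between the graphs. The clamps make it continuous on the whole plane
  -- with all its values in the region.
  let T : ℝ × ℝ → ℝ × ℝ := fun q =>
    (lo (sg q.1) + max 0 (min 1 q.2) * (hi (sg q.1) - lo (sg q.1)), sg q.1)
  have hT : Continuous T := by
    have e1 := hloc.comp (continuous_fst (X := ℝ) (Y := ℝ))
    have e2 := hhic.comp (continuous_fst (X := ℝ) (Y := ℝ))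
    have e3 : Continuous fun q : ℝ × ℝ => max 0 (min 1 q.2) := by fun_prop
    exact (e1.add (e3.mul (e2.sub e1))).prodMk (hsgc.comp continuous_fst)
  have hTm : ∀ q, T q ∈ {q : ℝ × ℝ | q.2 ∈ Icc a b ∧ q.1 ∈ Icc (lo q.2) (hi q.2)} := fun q => by
    have h1 : 0 ≤ max 0 (min 1 q.2) := le_max_left _ _
    have h2 : max 0 (min 1 q.2) ≤ 1 := max_le zero_le_one (min_le_left _ _)
    have h3 := hlt _ (hsg q.1)
    exact ⟨hsg _, by simp only [T]; nlinarith, by simp only [T]; nlinarith⟩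
  have hbot' : ∀ x, T (x, 0) = (lo (sg x), sg x) := fun x => by simp [T]
  have htop' : ∀ x, T (x, 1) = (hi (sg x), sg x) := fun x => by simp [T]
  have e0 : sg 0 = a := by simp [sg]
  have e1 : sg 1 = b := by simp [sg]
  -- `F` does not vanish on the two graphs, so its zeros lie strictly between them, where the side
  -- hypotheses apply.
  have hin : ∀ q, F (T q).1 (T q).2 = 0 → (T q).1 ∈ Ioo (lo (T q).2) (hi (T q).2) := fun q h => by
    obtain ⟨h1, h2, h3⟩ := hTm q
    refine ⟨h2.lt_of_ne fun he => ?_, h3.lt_of_ne fun he => ?_⟩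
    · have := hbot _ h1
      rw [he] at this
      linarith
    · have := htop _ h1
      rw [← he] at this
      linarith
  obtain ⟨q, _, hq1, hq2⟩ := exists_common_zero_unitSquare
    (F := fun q => F (T q).1 (T q).2) (G := fun q => G (T q).1 (T q).2)
    (hF.comp_continuous hT hTm) (hG.comp_continuous hT hTm)
    (fun x _ => by rw [hbot']; exact hbot _ (hsg x))
    (fun x _ => by rw [htop']; exact htop _ (hsg x))
    (fun y _ h => by
      have := hin _ h
      have e : (T (0, y)).2 = a := e0
      rw [e] at this h ⊢
      exact hleft _ this h)
    (fun y _ h => by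
      have := hin _ h
      have e : (T (1, y)).2 = b := e1
      rw [e] at this h ⊢
      exact hright _ this h)
  exact ⟨(T q).2, (hTm q).1, (T q).1, hin q hq1, hq1, hq2⟩

end

/-! ### Primitives on the line and `L¹` estimates for the kernels. -/

noncomputable section

open MeasureTheory in
/-- The primitive of an integrable function vanishing at `-∞`. -/
def prim (φ : ℝ → ℝ) (η : ℝ) : ℝ := ∫ v in Iic η, φ v

section primitives

open MeasureTheory

variable {φ ψ : ℝ → ℝ}

theorem integrable_abs_sub (hφ : Integrable φ) (hψ : Integrable ψ) :
    Integrable fun v => |φ v - ψ v| := (hφ.sub hψ).abs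

theorem abs_setIntegral_sub_le (hφ : Integrable φ) (hψ : Integrable ψ) (S : Set ℝ) :
    |(∫ v in S, φ v) - ∫ v in S, ψ v| ≤ ∫ v, |φ v - ψ v| := by
  rw [← integral_sub hφ.integrableOn hψ.integrableOn]
  refine (abs_integral_le_integral_abs).trans ?_
  exact setIntegral_le_integral (hφ.sub hψ).abs (Eventually.of_forall fun _ => abs_nonneg _)

theorem abs_integral_sub_le (hφ : Integrable φ) (hψ : Integrable ψ) :
    |(∫ v, φ v) - ∫ v, ψ v| ≤ ∫ v, |φ v - ψ v| := by
  simpa using abs_setIntegral_sub_le hφ hψ univ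

theorem abs_prim_sub_le (hφ : Integrable φ) (hψ : Integrable ψ) (η : ℝ) :
    |prim φ η - prim ψ η| ≤ ∫ v, |φ v - ψ v| := abs_setIntegral_sub_le hφ hψ _

theorem integral_sub_prim (hφ : Integrable φ) (η : ℝ) :
    (∫ v, φ v) - prim φ η = ∫ v in Ioi η, φ v := by
  rw [prim, ← integral_add_compl (measurableSet_Iic (a := η)) hφ, compl_Iic, add_sub_cancel_left]

/-- A total integral minus a primitive is a single integral over `Ioi η`, so the `L¹` distance is
paid once and not twice. -/
theorem abs_tail_sub_le (hφ : Integrable φ) (hψ : Integrable ψ) (η : ℝ) :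
    |((∫ v, φ v) - prim φ η) - ((∫ v, ψ v) - prim ψ η)| ≤ ∫ v, |φ v - ψ v| := by
  rw [integral_sub_prim hφ, integral_sub_prim hψ]
  exact abs_setIntegral_sub_le hφ hψ _

theorem prim_nonneg (h : ∀ v, 0 ≤ φ v) (η : ℝ) : 0 ≤ prim φ η :=
  integral_nonneg fun v => h v

theorem prim_le_integral (hφ : Integrable φ) (h : ∀ v, 0 ≤ φ v) (η : ℝ) : prim φ η ≤ ∫ v, φ v :=
  setIntegral_le_integral hφ (Eventually.of_forall h)

theorem prim_continuous (hφ : Integrable φ) : Continuous (prim φ) := by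
  have h : ∀ η, prim φ η = prim φ 0 + ∫ v in (0 : ℝ)..η, φ v := fun η => by
    rw [prim, prim, ← intervalIntegral.integral_Iic_sub_Iic hφ.integrableOn hφ.integrableOn]
    ring
  rw [show prim φ = _ from funext h]
  exact continuous_const.add (intervalIntegral.continuous_primitive
    (fun _ _ => hφ.intervalIntegrable) 0)

theorem prim_tendsto (hφ : Integrable φ) : Tendsto (prim φ) atTop (𝓝 (∫ v, φ v)) :=
  (aecover_Iic tendsto_id).integral_tendsto_of_countably_generated hφ

end primitives

/-- `exp (-∫ w)`. -/
def expE (w : ℝ → ℝ) (η : ℝ) : ℝ := Real.exp (-prim w η)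

/-- The integrand of `Φ`. -/
def phiF (w l : ℝ → ℝ) (v : ℝ) : ℝ := expE w v * l v

/-- The integrand of `H_i`. -/
def hF (w k : ℝ → ℝ) (v : ℝ) : ℝ := k v / expE w v

/-- The integrand of `G`. -/
def gF (w l k : ℝ → ℝ) (v : ℝ) : ℝ := expE w v * l v * prim (hF w k) v

open MeasureTheory in
/-- Nonnegativity and integrability of the densities from which the operators are built. -/
structure GoodTriple (w l k : ℝ → ℝ) : Prop where
  w_int : Integrable w
  l_int : Integrable l
  k_int : Integrable k
  w_nonneg : ∀ v, 0 ≤ w v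
  l_nonneg : ∀ v, 0 ≤ l v
  k_nonneg : ∀ v, 0 ≤ k v

section kernel

open MeasureTheory

variable {w l k w' l' k' : ℝ → ℝ}

theorem expE_pos (w : ℝ → ℝ) (η : ℝ) : 0 < expE w η := Real.exp_pos _

/-- With `x ≤ y`, factoring out `exp (-x) ≤ 1` leaves `1 - exp (x - y) ≤ y - x`. -/
theorem abs_exp_neg_sub_le {x y : ℝ} (hx : 0 ≤ x) (hy : 0 ≤ y) :
    |Real.exp (-x) - Real.exp (-y)| ≤ |x - y| := by
  wlog h : x ≤ y generalizing x y
  · rw [abs_sub_comm, abs_sub_comm x]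
    exact this hy hx (le_of_not_ge h)
  rw [abs_of_nonneg (sub_nonneg.2 (Real.exp_le_exp.2 (by linarith))), abs_of_nonpos (by linarith)]
  have h1 : Real.exp (-y) = Real.exp (-x) * Real.exp (x - y) := by
    rw [← Real.exp_add]; ring_nf
  have h2 := Real.add_one_le_exp (x - y)
  have h3 : Real.exp (-x) ≤ 1 := Real.exp_le_one_iff.2 (by linarith)
  have h4 := Real.exp_pos (-x)
  rw [h1]
  nlinarith

namespace GoodTriple

variable (T : GoodTriple w l k) (T' : GoodTriple w' l' k')
include T

theorem expE_le_one (η : ℝ) : expE w η ≤ 1 :=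
  Real.exp_le_one_iff.2 (by linarith [prim_nonneg T.w_nonneg η])

theorem exp_le_expE (η : ℝ) : Real.exp (-∫ v, w v) ≤ expE w η :=
  Real.exp_le_exp.2 (by linarith [prim_le_integral T.w_int T.w_nonneg η])

theorem expE_continuous : Continuous (expE w) :=
  Real.continuous_exp.comp (prim_continuous T.w_int).neg

theorem phiF_nonneg (v : ℝ) : 0 ≤ phiF w l v := mul_nonneg (expE_pos _ _).le (T.l_nonneg v)

theorem phiF_int : Integrable (phiF w l) := by
  refine T.l_int.bdd_mul (c := 1) T.expE_continuous.aestronglyMeasurable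
    (Eventually.of_forall fun v => ?_)
  rw [Real.norm_eq_abs, abs_of_pos (expE_pos _ _)]
  exact T.expE_le_one v

theorem phiF_le (v : ℝ) : phiF w l v ≤ l v :=
  mul_le_of_le_one_left (T.l_nonneg v) (T.expE_le_one v)

theorem hF_nonneg (v : ℝ) : 0 ≤ hF w k v := div_nonneg (T.k_nonneg v) (expE_pos _ _).le

theorem hF_int : Integrable (hF w k) := by
  have h : hF w k = fun v => (expE w v)⁻¹ * k v := by
    funext v; rw [hF, div_eq_inv_mul]
  rw [h]
  refine T.k_int.bdd_mul (c := (Real.exp (-∫ v, w v))⁻¹)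
    (T.expE_continuous.inv₀ fun v => (expE_pos _ _).ne').aestronglyMeasurable
    (Eventually.of_forall fun v => ?_)
  rw [norm_inv, Real.norm_eq_abs, abs_of_pos (expE_pos _ _)]
  exact inv_anti₀ (Real.exp_pos _) (T.exp_le_expE v)

theorem integral_hF_le {e : ℝ} (he : 0 < e) (hle : ∀ η, e ≤ expE w η) :
    ∫ v, hF w k v ≤ (∫ v, k v) / e := by
  rw [← integral_div]
  exact integral_mono T.hF_int (T.k_int.div_const e) fun v =>
    div_le_div_of_nonneg_left (T.k_nonneg v) he (hle v)

theorem prim_hF_nonneg (η : ℝ) : 0 ≤ prim (hF w k) η := prim_nonneg T.hF_nonneg η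

theorem prim_hF_le (η : ℝ) : prim (hF w k) η ≤ ∫ v, hF w k v :=
  prim_le_integral T.hF_int T.hF_nonneg η

theorem gF_nonneg (v : ℝ) : 0 ≤ gF w l k v :=
  mul_nonneg (T.phiF_nonneg v) (T.prim_hF_nonneg v)

theorem gF_int : Integrable (gF w l k) := by
  have h : gF w l k = fun v => prim (hF w k) v * phiF w l v := by
    funext v; rw [gF, phiF, mul_comm]
  rw [h]
  refine T.phiF_int.bdd_mul (c := ∫ v, hF w k v)
    (prim_continuous T.hF_int).aestronglyMeasurable (Eventually.of_forall fun v => ?_)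
  rw [Real.norm_eq_abs, abs_of_nonneg (T.prim_hF_nonneg v)]
  exact T.prim_hF_le v

theorem integral_phiF_le : ∫ v, phiF w l v ≤ ∫ v, l v :=
  integral_mono T.phiF_int T.l_int T.phiF_le

theorem le_integral_phiF {e : ℝ} (hle : ∀ η, e ≤ expE w η) :
    e * ∫ v, l v ≤ ∫ v, phiF w l v := by
  rw [← integral_const_mul]
  exact integral_mono (T.l_int.const_mul e) T.phiF_int fun v =>
    mul_le_mul_of_nonneg_right (hle v) (T.l_nonneg v)

theorem integral_gF_le : ∫ v, gF w l k v ≤ (∫ v, hF w k v) * ∫ v, l v := by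
  rw [← integral_const_mul]
  refine integral_mono T.gF_int (T.l_int.const_mul _) fun v => ?_
  rw [gF, mul_comm]
  exact mul_le_mul (T.prim_hF_le v) (T.phiF_le v) (T.phiF_nonneg v)
    (integral_nonneg T.hF_nonneg)

include T'

theorem abs_expE_sub_le (η : ℝ) : |expE w η - expE w' η| ≤ ∫ v, |w v - w' v| :=
  (abs_exp_neg_sub_le (prim_nonneg T.w_nonneg η) (prim_nonneg T'.w_nonneg η)).trans
    (abs_prim_sub_le T.w_int T'.w_int η)

/-- In the product splitting, the two exponentials differ uniformly by at most the `L¹` distance of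
the exponents, and the exponential left over is at most `1`. -/
theorem integral_abs_phiF_sub_le : ∫ v, |phiF w l v - phiF w' l' v| ≤
    (∫ v, |w v - w' v|) * (∫ v, l v) + ∫ v, |l v - l' v| := by
  rw [← integral_const_mul, ← integral_add (T.l_int.const_mul _) (integrable_abs_sub T.l_int T'.l_int)]
  refine integral_mono (integrable_abs_sub T.phiF_int T'.phiF_int)
    ((T.l_int.const_mul _).add (integrable_abs_sub T.l_int T'.l_int)) fun v => ?_
  have h : phiF w l v - phiF w' l' v =
      (expE w v - expE w' v) * l v + expE w' v * (l v - l' v) := by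
    simp only [phiF]; ring
  simp only [h]
  refine (abs_add_le _ _).trans ?_
  rw [abs_mul, abs_mul, abs_of_nonneg (T.l_nonneg v), abs_of_pos (expE_pos w' v)]
  exact add_le_add (mul_le_mul_of_nonneg_right (T.abs_expE_sub_le T' v) (T.l_nonneg v))
    (mul_le_of_le_one_left (abs_nonneg _) (T'.expE_le_one v))

/-- The exponential now stands in a denominator, so both exponentials need a common lower bound `e`.
It appears squared in the term that exchanges them. -/
theorem integral_abs_hF_sub_le {e : ℝ} (he : 0 < e) (hle : ∀ η, e ≤ expE w η)
    (hle' : ∀ η, e ≤ expE w' η) : ∫ v, |hF w k v - hF w' k' v| ≤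
    (∫ v, |k v - k' v|) / e + (∫ v, |w v - w' v|) / e ^ 2 * ∫ v, k' v := by
  rw [← integral_div, ← integral_const_mul,
    ← integral_add ((integrable_abs_sub T.k_int T'.k_int).div_const e) (T'.k_int.const_mul _)]
  refine integral_mono (integrable_abs_sub T.hF_int T'.hF_int)
    (((integrable_abs_sub T.k_int T'.k_int).div_const e).add (T'.k_int.const_mul _)) fun v => ?_
  have p := expE_pos w v
  have p' := expE_pos w' v
  have h : hF w k v - hF w' k' v = (k v - k' v) / expE w v +
      (expE w' v - expE w v) / (expE w v * expE w' v) * k' v := by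
    simp only [hF]; field_simp; ring
  simp only [h]
  refine (abs_add_le _ _).trans ?_
  rw [abs_div, abs_mul, abs_div, abs_of_nonneg (T'.k_nonneg v), abs_of_pos p,
    abs_of_pos (mul_pos p p'), abs_sub_comm (expE w' v)]
  have h1 : e ^ 2 ≤ expE w v * expE w' v := by
    rw [sq]; exact mul_le_mul (hle v) (hle' v) he.le p.le
  refine add_le_add (div_le_div_of_nonneg_left (abs_nonneg _) he (hle v))
    (mul_le_mul_of_nonneg_right ?_ (T'.k_nonneg v))
  exact div_le_div₀ (integral_nonneg fun _ => abs_nonneg _) (T.abs_expE_sub_le T' v)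
    (by positivity) h1

/-- The density of `G` is that of `Φ` times the primitive of `hF`. Both factors have `L¹` estimates,
and the primitive is bounded by its total integral. -/
theorem integral_abs_gF_sub_le : ∫ v, |gF w l k v - gF w' l' k' v| ≤
    (∫ v, hF w k v) * (∫ v, |phiF w l v - phiF w' l' v|) +
      (∫ v, |hF w k v - hF w' k' v|) * ∫ v, l' v := by
  have i1 := (integrable_abs_sub T.phiF_int T'.phiF_int)
  rw [← integral_const_mul, ← integral_const_mul,
    ← integral_add (i1.const_mul _) (T'.l_int.const_mul _)]
  refine integral_mono (integrable_abs_sub T.gF_int T'.gF_int)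
    ((i1.const_mul _).add (T'.l_int.const_mul _)) fun v => ?_
  have h : gF w l k v - gF w' l' k' v = prim (hF w k) v * (phiF w l v - phiF w' l' v) +
      (prim (hF w k) v - prim (hF w' k') v) * phiF w' l' v := by
    simp only [gF, phiF]; ring
  simp only [h]
  refine (abs_add_le _ _).trans ?_
  rw [abs_mul, abs_mul, abs_of_nonneg (T.prim_hF_nonneg v), abs_of_nonneg (T'.phiF_nonneg v)]
  refine add_le_add (mul_le_mul_of_nonneg_right (T.prim_hF_le v) (abs_nonneg _))
    (mul_le_mul (abs_prim_sub_le T.hF_int T'.hF_int v) (T'.phiF_le v) (T'.phiF_nonneg v)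
      (integral_nonneg fun _ => abs_nonneg _))

end GoodTriple

/-- Convergence in `L¹`. -/
def TendstoL1 {ι : Type*} (F : ι → ℝ → ℝ) (L : Filter ι) (f : ℝ → ℝ) : Prop :=
  Tendsto (fun i => ∫ v, |F i v - f v|) L (𝓝 0)

theorem TendstoL1.tendsto_integral {ι : Type*} {F : ι → ℝ → ℝ} {L : Filter ι} {f : ℝ → ℝ}
    (h : TendstoL1 F L f) (hF : ∀ᶠ i in L, Integrable (F i)) (hf : Integrable f) :
    Tendsto (fun i => ∫ v, F i v) L (𝓝 (∫ v, f v)) := by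
  rw [tendsto_iff_norm_sub_tendsto_zero]
  refine squeeze_zero' (Eventually.of_forall fun _ => norm_nonneg _) ?_ h
  filter_upwards [hF] with i hi
  exact abs_integral_sub_le hi hf

theorem squeeze_zero_of_le {ι : Type*} {L : Filter ι} {F G : ι → ℝ} (h0 : ∀ i, 0 ≤ F i)
    (h : ∀ᶠ i in L, F i ≤ G i) {c : ℝ} (hG : Tendsto G L (𝓝 c)) (hc : c = 0) :
    Tendsto F L (𝓝 0) :=
  squeeze_zero' (Eventually.of_forall h0) h (hc ▸ hG)

section limits

variable {ι : Type*} {L : Filter ι} {W Λ κ : ι → ℝ → ℝ}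
  (hT : ∀ᶠ i in L, GoodTriple (W i) (Λ i) (κ i)) (T : GoodTriple w l k)
  (hw : TendstoL1 W L w) (hl : TendstoL1 Λ L l) (hk : TendstoL1 κ L k)
include hT T hw

/-- Supplies the lower bound required for dividing by the exponential. Since `∫ W i` tends to `∫ w`,
it is eventually below `∫ w + 1`, which gives one constant for the limit and for the tail of the
family. -/
theorem tendsto_integral_expE_bound : ∃ e > 0, (∀ η, e ≤ expE w η) ∧
    ∀ᶠ i in L, ∀ η, e ≤ expE (W i) η := by
  refine ⟨Real.exp (-((∫ v, w v) + 1)), Real.exp_pos _, fun η =>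
    (Real.exp_le_exp.2 (by linarith)).trans (T.exp_le_expE η), ?_⟩
  have h := hw.tendsto_integral (hT.mono fun i h => h.w_int) T.w_int
  filter_upwards [hT, h.eventually_lt_const (lt_add_one _)] with i hi h1 η
  exact (Real.exp_le_exp.2 (by linarith)).trans (hi.exp_le_expE η)

theorem tendsto_expE (η : ι → ℝ) :
    Tendsto (fun i => expE (W i) (η i) - expE w (η i)) L (𝓝 0) := by
  rw [tendsto_zero_iff_norm_tendsto_zero]
  refine squeeze_zero_of_le (fun _ => norm_nonneg _) ?_ hw rfl
  filter_upwards [hT] with i hi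
  exact hi.abs_expE_sub_le T _

include hl

/-- The difference estimates double as continuity statements, because their right-hand sides tend to
zero. The same holds for the densities of `H_i` and `G`. -/
theorem tendstoL1_phiF : TendstoL1 (fun i => phiF (W i) (Λ i)) L (phiF w l) := by
  have h := hl.tendsto_integral (hT.mono fun i h => h.l_int) T.l_int
  refine squeeze_zero_of_le (fun _ => integral_nonneg fun _ => abs_nonneg _) ?_
    ((hw.mul h).add hl) (by simp)
  filter_upwards [hT] with i hi
  exact hi.integral_abs_phiF_sub_le T

omit hl in
include hk in
theorem tendstoL1_hF : TendstoL1 (fun i => hF (W i) (κ i)) L (hF w k) := by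
  obtain ⟨e, he, h1, h2⟩ := tendsto_integral_expE_bound hT T hw
  refine squeeze_zero_of_le (fun _ => integral_nonneg fun _ => abs_nonneg _) ?_
    ((hk.div_const e).add ((hw.div_const (e ^ 2)).mul_const (∫ v, k v))) (by simp)
  filter_upwards [hT, h2] with i hi h2
  exact hi.integral_abs_hF_sub_le T he h2 h1

include hk in
theorem tendstoL1_gF : TendstoL1 (fun i => gF (W i) (Λ i) (κ i)) L (gF w l k) := by
  have h1 := tendstoL1_hF hT T hw hk
  have h2 := tendstoL1_phiF hT T hw hl
  have h3 := h1.tendsto_integral (hT.mono fun i h => h.hF_int) T.hF_int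
  refine squeeze_zero_of_le (fun _ => integral_nonneg fun _ => abs_nonneg _) ?_
    ((h3.mul h2).add (h1.mul_const (∫ v, l v))) (by simp)
  filter_upwards [hT] with i hi
  exact hi.integral_abs_gF_sub_le T

end limits

end kernel

end

/-! ### Pointwise form of the structural assumptions. -/

noncomputable section

/-- The constants that belong to one of the two zones. -/
structure Zone where
  D : ℝ
  Lm : ℝ
  LM : ℝ
  NM : ℝ
  Km : ℝ
  KM : ℝ
  Lt : ℝ
  Nt : ℝ
  Kt : ℝ

structure Zone.Pos (z : Zone) : Prop where
  D : 0 < z.D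
  Lm : 0 < z.Lm
  LM : 0 < z.LM
  NM : 0 < z.NM
  Km : 0 < z.Km
  KM : 0 < z.KM
  Lt : 0 < z.Lt
  Nt : 0 < z.Nt
  Kt : 0 < z.Kt

namespace Contact

variable (p : Contact)

/-- Constants of the liquid zone. -/
def zone₁ : Zone := ⟨p.D₁, p.L1m, p.L1M, p.N1M, p.K1m, p.K1M, p.L1t, p.N1t, p.K1t⟩

/-- Constants of the solid zone. -/
def zone₂ : Zone := ⟨p.D₂, p.L2m, p.L2M, p.N2M, p.K2m, p.K2M, p.L2t, p.N2t, p.K2t⟩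

variable {p}

theorem zone₁_pos (hp : p.Standing) (hc : p.PosConsts) : p.zone₁.Pos := by
  have := hp.Uc_pos; have := hp.c₀_pos; have := hp.γ₀_pos; have := hp.σ₁_pos; have := hp.a_pos
  exact ⟨by simp only [zone₁, D₁]; positivity, hc.L1m, hc.L1M, hc.N1M, hc.K1m, hc.K1M, hc.L1t,
    hc.N1t, hc.K1t⟩

theorem zone₂_pos (hp : p.Standing) (hc : p.PosConsts) : p.zone₂.Pos := by
  have := hp.Uc_pos; have := hp.c₀_pos; have := hp.γ₀_pos; have := hp.σ₂_pos; have := hp.a_pos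
  exact ⟨by simp only [zone₂, D₂]; positivity, hc.L2m, hc.L2M, hc.N2M, hc.K2m, hc.K2M, hc.L2t,
    hc.N2t, hc.K2t⟩

variable (p)

/-- The bounds and Lipschitz conditions of a zone, pointwise in both arguments, together with
the conditions on the constants that the estimates need. -/
structure Coeffs (z : Zone) : Prop where
  pos : z.Pos
  ν_pos : 0 < p.ν
  a_pos : 0 < p.a
  two_lt_μ : 2 < p.μ
  L_meas : ∀ x, Measurable fun η => p.L η x
  N_meas : ∀ x, Measurable fun η => p.N η x
  K_meas : ∀ x, Measurable fun η => p.K η x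
  L_lo : ∀ v x : ℝ, 0 < v → z.Lm * v ^ p.μ ≤ p.L v x
  L_hi : ∀ v x : ℝ, 0 < v → p.L v x ≤ z.LM * v ^ p.μ
  N_nonneg : ∀ v x : ℝ, 0 < v → 0 ≤ p.N v x
  N_hi : ∀ v x : ℝ, 0 < v → p.N v x ≤ z.NM * v ^ (-p.μ)
  K_lo : ∀ v x : ℝ, 0 < v → z.Km * v ^ (-p.μ) ≤ p.K v x
  K_hi : ∀ v x : ℝ, 0 < v → p.K v x ≤ z.KM * v ^ (-p.μ)
  L_lip : ∀ v x y : ℝ, 0 < v → |p.L v x - p.L v y| ≤ z.Lt * |x - y|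
  N_lip : ∀ v x y : ℝ, 0 < v → |p.N v x - p.N v y| ≤ z.Nt * |x - y|
  K_lip : ∀ v x y : ℝ, 0 < v → |p.K v x - p.K v y| ≤ z.Kt * v ^ (-p.μ) * |x - y|

variable {p}

/-- The assumptions are tested on constant functions on `[v, v + 1]`, evaluated at the left endpoint
`v`. This reaches every `v > 0` and every state `x`, and the norm of a difference of constants is
`|x - y|`. -/
theorem coeffs_zone₁ (hp : p.Standing) (hc : p.PosConsts) (hA1 : p.A1) (hA3 : p.A3) (hA5 : p.A5) :
    p.Coeffs p.zone₁ := by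
  have key : ∀ v x : ℝ, 0 < v → _ := fun v x hv =>
    hA1 v (v + 1) hv (by linarith) (ContinuousMap.const _ x) ⟨v, le_rfl, by linarith⟩
  have lip : ∀ v x y : ℝ, 0 < v → _ := fun v x y hv =>
    hA3 v (v + 1) hv (by linarith) (ContinuousMap.const _ x) (ContinuousMap.const _ y)
      ⟨v, le_rfl, by linarith⟩
  have hn : ∀ v x y : ℝ, 0 < v → ‖(ContinuousMap.const (Icc v (v + 1)) x : LiquidSpace (v + 1) v) -
      ContinuousMap.const _ y‖ ≤ |x - y| := fun v x y hv => by
    rw [ContinuousMap.norm_le _ (abs_nonneg _)]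
    intro t
    simp
  simp only [ContinuousMap.const_apply] at key lip
  refine ⟨zone₁_pos hp hc, hp.ν_pos, hp.a_pos, hA5, hp.L_meas, hp.N_meas, hp.K_meas,
    fun v x hv => (key v x hv).1.1, fun v x hv => (key v x hv).1.2, fun v x hv => ?_,
    fun v x hv => (key v x hv).2.1.2, fun v x hv => (key v x hv).2.2.1,
    fun v x hv => (key v x hv).2.2.2, fun v x y hv => ?_, fun v x y hv => ?_,
    fun v x y hv => ?_⟩
  · exact (mul_nonneg hc.N1m.le (Real.rpow_nonneg hv.le _)).trans (key v x hv).2.1.1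
  · exact (lip v x y hv).1.trans (mul_le_mul_of_nonneg_left (hn v x y hv) hc.L1t.le)
  · exact (lip v x y hv).2.1.trans (mul_le_mul_of_nonneg_left (hn v x y hv) hc.N1t.le)
  · exact (lip v x y hv).2.2.trans (mul_le_mul_of_nonneg_left (hn v x y hv)
      (mul_nonneg hc.K1t.le (Real.rpow_nonneg hv.le _)))

/-- A function in `ℳ` on `[v/2, ∞)` with prescribed value `x` at `v`. -/
def bump (v x : ℝ) (η : ℝ) : ℝ :=
  -(max 0 (min 1 (η / (v / 2) - 1))) + (x + 1) * max 0 (1 - |η / (v / 2) - 2|)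

theorem abs_bump_le (v x η : ℝ) : |bump v x η| ≤ 1 + |x + 1| := by
  refine (abs_add_le _ _).trans (add_le_add ?_ ?_)
  · rw [abs_neg, abs_of_nonneg (le_max_left _ _)]
    exact max_le zero_le_one (min_le_left _ _)
  · rw [abs_mul, abs_of_nonneg (le_max_left (0 : ℝ) (1 - _))]
    refine mul_le_of_le_one_right (abs_nonneg _) (max_le zero_le_one ?_)
    linarith [abs_nonneg (η / (v / 2) - 2)]

theorem bump_continuous (v x : ℝ) : Continuous (bump v x) := by
  unfold bump; fun_prop

/-- `bump` as an element of `C_b[v/2, ∞)`. -/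
def bumpSolid (v x : ℝ) : SolidSpace (v / 2) :=
  BoundedContinuousFunction.ofNormedAddCommGroup (fun η => bump v x η)
    ((bump_continuous v x).comp continuous_subtype_val) (1 + |x + 1|) fun η => abs_bump_le v x η

theorem bumpSolid_mem {v : ℝ} (hv : 0 < v) (x : ℝ) : bumpSolid v x ∈ solidSet (v / 2) := by
  have hv' : v / 2 ≠ 0 := by positivity
  constructor
  · simp only [bumpSolid, BoundedContinuousFunction.coe_ofNormedAddCommGroup, bump]
    rw [div_self hv']
    norm_num
  · refine tendsto_const_nhds.congr' ?_
    filter_upwards [eventually_ge_atTop (⟨3 * (v / 2), by simp; linarith⟩ : Ici (v / 2))]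
      with η hη
    have h : 3 ≤ (η : ℝ) / (v / 2) := by
      rw [le_div_iff₀ (by positivity)]; exact hη
    simp only [bumpSolid, BoundedContinuousFunction.coe_ofNormedAddCommGroup, bump]
    rw [min_eq_left (by linarith), abs_of_nonneg (by linarith), max_eq_right (by norm_num),
      max_eq_left (by linarith)]
    ring

theorem bumpSolid_apply {v : ℝ} (hv : 0 < v) (x : ℝ) (h : v ∈ Ici (v / 2)) :
    bumpSolid v x ⟨v, h⟩ = x := by
  have e : v / (v / 2) = 2 := by field_simp
  simp only [bumpSolid, BoundedContinuousFunction.coe_ofNormedAddCommGroup, bump, e]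
  norm_num

/-- The two bumps differ by `x - y` times a tent of height `1`. -/
theorem norm_bumpSolid_sub_le (v x y : ℝ) : ‖bumpSolid v x - bumpSolid v y‖ ≤ |x - y| := by
  rw [BoundedContinuousFunction.norm_le (abs_nonneg _)]
  intro η
  have e : (bumpSolid v x - bumpSolid v y) η = (x - y) * max 0 (1 - |(η : ℝ) / (v / 2) - 2|) := by
    simp only [bumpSolid, BoundedContinuousFunction.coe_ofNormedAddCommGroup, bump,
      BoundedContinuousFunction.coe_sub, Pi.sub_apply]
    ring
  rw [e, norm_mul, Real.norm_eq_abs, Real.norm_eq_abs, abs_of_nonneg (le_max_left (0 : ℝ) (1 - _))]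
  refine mul_le_of_le_one_right (abs_nonneg _) (max_le zero_le_one ?_)
  linarith [abs_nonneg ((η : ℝ) / (v / 2) - 2)]

/-- Constant functions do not belong to `ℳ`. The bumps on `[v/2, ∞)` do, they take any prescribed
value at the interior point `v`, and their distance is at most the distance of these values. -/
theorem coeffs_zone₂ (hp : p.Standing) (hc : p.PosConsts) (hA2 : p.A2) (hA4 : p.A4) (hA5 : p.A5) :
    p.Coeffs p.zone₂ := by
  have hm : ∀ v : ℝ, 0 < v → v ∈ Ici (v / 2) := fun v hv => by simp; linarith
  have key : ∀ v x : ℝ, (hv : 0 < v) → _ := fun v x hv =>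
    hA2 (v / 2) (by positivity) _ (bumpSolid_mem hv x) ⟨v, hm v hv⟩
  have lip : ∀ v x y : ℝ, (hv : 0 < v) → _ := fun v x y hv =>
    hA4 (v / 2) (by positivity) _ (bumpSolid_mem hv x) _ (bumpSolid_mem hv y) ⟨v, hm v hv⟩
  have hn := norm_bumpSolid_sub_le
  have hb : ∀ v x : ℝ, (hv : 0 < v) → bumpSolid v x ⟨v, hm v hv⟩ = x := fun v x hv =>
    bumpSolid_apply hv x _
  simp +contextual only [hb] at key lip
  refine ⟨zone₂_pos hp hc, hp.ν_pos, hp.a_pos, hA5, hp.L_meas, hp.N_meas, hp.K_meas,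
    fun v x hv => (key v x hv).1.1, fun v x hv => (key v x hv).1.2, fun v x hv => ?_,
    fun v x hv => (key v x hv).2.1.2, fun v x hv => (key v x hv).2.2.1,
    fun v x hv => (key v x hv).2.2.2, fun v x y hv => ?_, fun v x y hv => ?_,
    fun v x y hv => ?_⟩
  · exact (mul_nonneg hc.N2m.le (Real.rpow_nonneg hv.le _)).trans (key v x hv).2.1.1
  · exact (lip v x y hv).1.trans (mul_le_mul_of_nonneg_left (hn v x y) hc.L2t.le)
  · exact (lip v x y hv).2.1.trans (mul_le_mul_of_nonneg_left (hn v x y) hc.N2t.le)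
  · exact (lip v x y hv).2.2.trans (mul_le_mul_of_nonneg_left (hn v x y)
      (mul_nonneg hc.K2t.le (Real.rpow_nonneg hv.le _)))

end Contact

open MeasureTheory

/-- The power `v ^ (-(q + 1))`, cut off below `ℓ`. -/
def tailPow (q ℓ : ℝ) : ℝ → ℝ := (Ioi ℓ).indicator fun v => v ^ (-(q + 1))

theorem tailPow_int {q ℓ : ℝ} (hq : 0 < q) (hℓ : 0 < ℓ) : Integrable (tailPow q ℓ) :=
  (integrable_indicator_iff measurableSet_Ioi).2
    (integrableOn_Ioi_rpow_of_lt (by linarith) hℓ)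

theorem integral_tailPow {q ℓ : ℝ} (hq : 0 < q) (hℓ : 0 < ℓ) :
    ∫ v, tailPow q ℓ v = ℓ⁻¹ ^ q / q := by
  rw [tailPow, integral_indicator measurableSet_Ioi, integral_Ioi_rpow_of_lt (by linarith) hℓ,
    show -(q + 1) + 1 = -q by ring, Real.rpow_neg hℓ.le, Real.inv_rpow hℓ.le, neg_div_neg_eq]

/-- Superposition of Carathéodory functions. -/
theorem measurable_indicator_comp {c : ℝ → ℝ → ℝ} (hm : ∀ x, Measurable fun v => c v x)
    (hcont : ∀ v, 0 < v → Continuous (c v)) {f : ℝ → ℝ} (hf : Measurable f) :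
    Measurable ((Ioi 0).indicator fun v => c v (f v)) := by
  -- Continuity in the state variable is known only for `v > 0`. The indicator replaces the
  -- coefficient elsewhere by zero, so that the Carathéodory conditions hold at every `v`.
  have h := measurable_uncurry_of_continuous_of_measurable
    (u := fun x v => (Ioi (0 : ℝ)).indicator (fun v => c v x) v) (fun v => by
      by_cases hv : 0 < v
      · simpa [indicator, hv] using hcont v hv
      · simpa [indicator, hv] using continuous_const) fun x => (hm x).indicator measurableSet_Ioi
  exact h.comp (hf.prodMk measurable_id)

end

/-! ### Pointwise bounds and Lipschitz estimates of the densities. -/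

noncomputable section

open MeasureTheory

/-- From `x / y - x' / y' = (x - x') / y + x' (y' - y) / (y y')`. Every quotient of coefficients
below is treated by it. -/
theorem abs_div_sub_div_le {x y x' y' m : ℝ} (hm : 0 < m) (hy : m ≤ y) (hy' : m ≤ y')
    (hx' : 0 ≤ x') : |x / y - x' / y'| ≤ |x - x'| / m + x' * |y - y'| / m ^ 2 := by
  have h1 : 0 < y := hm.trans_le hy
  have h2 : 0 < y' := hm.trans_le hy'
  have h : x / y - x' / y' = (x - x') / y + x' * (y' - y) / (y * y') := by
    field_simp; ring
  rw [h]
  refine (abs_add_le _ _).trans ?_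
  rw [abs_div, abs_div, abs_mul, abs_of_nonneg hx', abs_of_pos h1, abs_of_pos (mul_pos h1 h2),
    abs_sub_comm y']
  have h3 : m ^ 2 ≤ y * y' := by rw [sq]; exact mul_le_mul hy hy' hm.le h1.le
  gcongr

theorem Set.indicator_apply_le_of {S : Set ℝ} {φ b : ℝ → ℝ} (hb : ∀ v, 0 ≤ b v)
    (h : ∀ v ∈ S, φ v ≤ b v) (v : ℝ) : S.indicator φ v ≤ b v :=
  indicator_apply_le' (h v) fun _ => hb v

theorem abs_indicator_sub_le {S : Set ℝ} {φ ψ b : ℝ → ℝ} (hb : ∀ v, 0 ≤ b v)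
    (h : ∀ v ∈ S, |φ v - ψ v| ≤ b v) (v : ℝ) : |S.indicator φ v - S.indicator ψ v| ≤ b v := by
  by_cases hv : v ∈ S
  · simpa [hv] using h v hv
  · simpa [hv] using hb v

theorem tailPow_nonneg (q : ℝ) {ℓ : ℝ} (hℓ : 0 < ℓ) (v : ℝ) : 0 ≤ tailPow q ℓ v :=
  indicator_nonneg (fun _ hv => Real.rpow_nonneg (hℓ.trans hv).le _) v

theorem tailPow_of_mem (q : ℝ) {ℓ v : ℝ} (hv : ℓ < v) : tailPow q ℓ v = v ^ (-(q + 1)) :=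
  indicator_of_mem (mem_Ioi.2 hv) _

namespace Contact

variable (p : Contact) (z : Zone)

/-- The density of the exponent of `E_i`, on the set `S`, with `h` in place of `H`. -/
def zw (S : Set ℝ) (h : ℝ) (f : ℝ → ℝ) : ℝ → ℝ := S.indicator fun v =>
  2 * p.a * v * (p.N v (f v) / p.L v (f v)) + z.D / h * (p.K v (f v) / (p.L v (f v) * v ^ p.ν))

/-- The density `1 / (L(f) v^ν)` on `S`. -/
def zl (S : Set ℝ) (f : ℝ → ℝ) : ℝ → ℝ := S.indicator fun v => 1 / (p.L v (f v) * v ^ p.ν)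

/-- The density `K(f) / v^ν` on `S`. -/
def zk (S : Set ℝ) (f : ℝ → ℝ) : ℝ → ℝ := S.indicator fun v => p.K v (f v) / v ^ p.ν

/-- Lower bound of `E_i` in the normalised variables. -/
def nE (u i : ℝ) : ℝ := Real.exp (-(p.a * (z.NM / (z.Lm * (p.μ - 1))) * u ^ (2 * p.μ - 2) +
  z.D * z.KM / (z.Lm * (2 * p.μ + p.ν - 1)) * i * u ^ p.μ))

/-- Lipschitz constant of `E_i` in the normalised variables. -/
def nEt (u i τ : ℝ) : ℝ :=
  2 * p.a * (z.Nt / (z.Lm * (p.μ - 2)) * u ^ (p.μ - 2) +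
    z.NM * z.Lt / (z.Lm ^ 2 * (3 * p.μ - 2)) * u ^ (3 * p.μ - 2)) +
  z.D * i * (z.Kt / (z.Lm * (2 * p.μ + p.ν - 1)) * u ^ p.μ +
    z.KM / z.Lm * (τ / (2 * p.μ + p.ν - 1) * u ^ p.μ +
      z.Lt / (z.Lm * (3 * p.μ + p.ν - 1)) * u ^ (2 * p.μ)))

/-- In the normalised quantities `u` stands for `x_i⁻¹`, `i` for `x_i^{-κ} / H_inf`, `τ` for `H̃ /
H_inf` and `σ` for `H_sup / H_inf`. A factor `x_i^{-κ}` is removed from `Φ` and `H_i`, and its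
square from `G`. What remains is monotone in each argument. -/
def nΦt (u i τ : ℝ) : ℝ :=
  p.nEt z u i τ / (z.Lm * p.κ) + z.Lt / (z.Lm ^ 2 * (2 * p.μ + p.ν - 1)) * u ^ p.μ

def nHs (u i : ℝ) : ℝ := z.KM / (p.κ * p.nE z u i)

def nHt (u i τ : ℝ) : ℝ :=
  (z.Kt + z.KM * p.nEt z u i τ / p.nE z u i) / (p.κ * p.nE z u i)

def nGs (u i : ℝ) : ℝ := p.nHs z u i / (z.Lm * p.κ)

def nGt (u i τ : ℝ) : ℝ := p.nHs z u i * p.nΦt z u i τ + p.nHt z u i τ / (z.Lm * p.κ)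

/-- Lipschitz constant of `G_i / H²` in the normalised variables. -/
def nX (u i τ σ : ℝ) : ℝ := i ^ 2 * (p.nGt z u i τ + 2 * p.nGs z u i * σ * τ)

variable {p z}

theorem Coeffs.κ_pos (C : p.Coeffs z) : 0 < p.κ := by
  have := C.two_lt_μ; have := C.ν_pos; simp only [κ]; linarith

section powers

variable {v : ℝ} (hv : 0 < v)
include hv

/-- Expressing the exponents through `v ^ μ` and `v ^ ν` turns the pointwise estimates into rational
inequalities in these two positive numbers. -/
theorem rpow_κ : v ^ (-(p.κ + 1)) = 1 / (v ^ p.μ * v ^ p.ν) := by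
  rw [Real.rpow_neg hv.le, ← Real.rpow_add hv, one_div, κ]; ring_nf

theorem rpow_θ : v ^ (-(2 * p.μ + p.ν - 1 + 1)) = 1 / ((v ^ p.μ) ^ 2 * v ^ p.ν) := by
  rw [Real.rpow_neg hv.le, sq, ← Real.rpow_add hv, ← Real.rpow_add hv, one_div]; ring_nf

theorem rpow_θ' : v ^ (-(3 * p.μ + p.ν - 1 + 1)) = 1 / ((v ^ p.μ) ^ 3 * v ^ p.ν) := by
  rw [Real.rpow_neg hv.le, pow_succ, sq, ← Real.rpow_add hv, ← Real.rpow_add hv,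
    ← Real.rpow_add hv, one_div]
  ring_nf

theorem rpow_two_μ : v ^ (-(2 * p.μ - 2 + 1)) = v / (v ^ p.μ) ^ 2 := by
  rw [show -(2 * p.μ - 2 + 1) = 1 - (p.μ + p.μ) by ring, Real.rpow_sub hv, Real.rpow_one, sq,
    ← Real.rpow_add hv]

theorem rpow_three_μ : v ^ (-(3 * p.μ - 2 + 1)) = v / (v ^ p.μ) ^ 3 := by
  rw [show -(3 * p.μ - 2 + 1) = 1 - (p.μ + p.μ + p.μ) by ring, Real.rpow_sub hv, Real.rpow_one,
    pow_succ, sq, ← Real.rpow_add hv, ← Real.rpow_add hv]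

theorem rpow_one_μ : v ^ (-(p.μ - 2 + 1)) = v / v ^ p.μ := by
  rw [show -(p.μ - 2 + 1) = 1 - p.μ by ring, Real.rpow_sub hv, Real.rpow_one]

end powers

namespace Coeffs

variable (C : p.Coeffs z) {v x y : ℝ} (hv : 0 < v)
include C hv

theorem L_pos : 0 < p.L v x :=
  (mul_pos C.pos.Lm (Real.rpow_pos_of_pos hv _)).trans_le (C.L_lo v x hv)

theorem K_pos : 0 < p.K v x :=
  (mul_pos C.pos.Km (Real.rpow_pos_of_pos hv _)).trans_le (C.K_lo v x hv)

theorem N_le : p.N v x ≤ z.NM / v ^ p.μ := by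
  rw [div_eq_mul_inv, ← Real.rpow_neg hv.le]; exact C.N_hi v x hv

theorem K_le : p.K v x ≤ z.KM / v ^ p.μ := by
  rw [div_eq_mul_inv, ← Real.rpow_neg hv.le]; exact C.K_hi v x hv

theorem le_K : z.Km / v ^ p.μ ≤ p.K v x := by
  rw [div_eq_mul_inv, ← Real.rpow_neg hv.le]; exact C.K_lo v x hv

theorem abs_K_sub_le : |p.K v x - p.K v y| ≤ z.Kt / v ^ p.μ * |x - y| := by
  rw [div_eq_mul_inv, ← Real.rpow_neg hv.le]; exact C.K_lip v x y hv

theorem l_le : 1 / (p.L v x * v ^ p.ν) ≤ 1 / z.Lm * v ^ (-(p.κ + 1)) := by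
  have hX := Real.rpow_pos_of_pos hv p.μ
  have hY := Real.rpow_pos_of_pos hv p.ν
  have := C.pos.Lm
  have hL := C.L_lo v x hv
  rw [rpow_κ hv, div_mul_div_comm, one_mul, ← mul_assoc]
  gcongr

theorem le_l : 1 / z.LM * v ^ (-(p.κ + 1)) ≤ 1 / (p.L v x * v ^ p.ν) := by
  have hX := Real.rpow_pos_of_pos hv p.μ
  have hY := Real.rpow_pos_of_pos hv p.ν
  have hL := C.L_hi v x hv
  have := C.L_pos hv (x := x)
  rw [rpow_κ hv, div_mul_div_comm, one_mul, ← mul_assoc]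
  gcongr

theorem k_le : p.K v x / v ^ p.ν ≤ z.KM * v ^ (-(p.κ + 1)) := by
  have hY := Real.rpow_pos_of_pos hv p.ν
  have hK := C.K_le hv (x := x)
  rw [rpow_κ hv, mul_one_div, ← div_div]
  gcongr

theorem le_k : z.Km * v ^ (-(p.κ + 1)) ≤ p.K v x / v ^ p.ν := by
  have hY := Real.rpow_pos_of_pos hv p.ν
  have hK := C.le_K hv (x := x)
  rw [rpow_κ hv, mul_one_div, ← div_div]
  gcongr

theorem n_le : 2 * p.a * v * (p.N v x / p.L v x) ≤
    2 * p.a * z.NM / z.Lm * v ^ (-(2 * p.μ - 2 + 1)) := by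
  have hX := Real.rpow_pos_of_pos hv p.μ
  have := C.pos.Lm
  have := C.pos.NM
  have := C.a_pos
  have hL := C.L_lo v x hv
  have h : p.N v x / p.L v x ≤ z.NM / v ^ p.μ / (z.Lm * v ^ p.μ) := by
    have := C.N_le hv (x := x)
    gcongr
  calc _ ≤ 2 * p.a * v * (z.NM / v ^ p.μ / (z.Lm * v ^ p.μ)) := by gcongr
    _ = _ := by rw [rpow_two_μ hv]; field_simp

theorem m_le : p.K v x / (p.L v x * v ^ p.ν) ≤
    z.KM / z.Lm * v ^ (-(2 * p.μ + p.ν - 1 + 1)) := by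
  have hX := Real.rpow_pos_of_pos hv p.μ
  have hY := Real.rpow_pos_of_pos hv p.ν
  have := C.pos.Lm
  have := C.pos.KM
  have hL := C.L_lo v x hv
  calc _ ≤ z.KM / v ^ p.μ / (z.Lm * v ^ p.μ * v ^ p.ν) := by
        have := C.K_le hv (x := x)
        gcongr
    _ = _ := by rw [rpow_θ hv]; field_simp

theorem m_nonneg : 0 ≤ p.K v x / (p.L v x * v ^ p.ν) :=
  div_nonneg (C.K_pos hv).le (mul_nonneg (C.L_pos hv).le (Real.rpow_nonneg hv.le _))

theorem n_nonneg : 0 ≤ 2 * p.a * v * (p.N v x / p.L v x) :=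
  mul_nonneg (by have := C.a_pos; positivity) (div_nonneg (C.N_nonneg v x hv) (C.L_pos hv).le)

variable {d : ℝ} (hd : |x - y| ≤ d)
include hd

theorem l_lip : |1 / (p.L v x * v ^ p.ν) - 1 / (p.L v y * v ^ p.ν)| ≤
    d * (z.Lt / z.Lm ^ 2 * v ^ (-(2 * p.μ + p.ν - 1 + 1))) := by
  have hX := Real.rpow_pos_of_pos hv p.μ
  have hY := Real.rpow_pos_of_pos hv p.ν
  have := C.pos.Lm
  have := C.pos.Lt
  have h := abs_div_sub_div_le (x := 1) (mul_pos C.pos.Lm hX) (C.L_lo v x hv) (C.L_lo v y hv)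
    zero_le_one
  have hl := (C.L_lip v x y hv).trans (mul_le_mul_of_nonneg_left hd C.pos.Lt.le)
  rw [← div_div, ← div_div, ← sub_div, abs_div, abs_of_pos hY]
  calc _ ≤ (|(1 : ℝ) - 1| / (z.Lm * v ^ p.μ) + 1 * |p.L v x - p.L v y| / (z.Lm * v ^ p.μ) ^ 2) /
        v ^ p.ν := by gcongr
    _ ≤ (|(1 : ℝ) - 1| / (z.Lm * v ^ p.μ) + 1 * (z.Lt * d) / (z.Lm * v ^ p.μ) ^ 2) /
        v ^ p.ν := by gcongr
    _ = _ := by rw [rpow_θ hv]; simp; field_simp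

theorem k_lip : |p.K v x / v ^ p.ν - p.K v y / v ^ p.ν| ≤
    d * (z.Kt * v ^ (-(p.κ + 1))) := by
  have hX := Real.rpow_pos_of_pos hv p.μ
  have hY := Real.rpow_pos_of_pos hv p.ν
  have := C.pos.Kt
  have hk := C.abs_K_sub_le hv (x := x) (y := y)
  rw [← sub_div, abs_div, abs_of_pos hY]
  calc _ ≤ z.Kt / v ^ p.μ * d / v ^ p.ν := by
        gcongr
        exact hk.trans (by gcongr)
    _ = _ := by rw [rpow_κ hv]; field_simp

/-- The Lipschitz bound of `N` carries no decay, so the first term is only of order `v ^ (1 - μ)`.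
Its integrability at infinity is where `2 < μ` is used. -/
theorem n_lip : |2 * p.a * v * (p.N v x / p.L v x) - 2 * p.a * v * (p.N v y / p.L v y)| ≤
    d * (2 * p.a * (z.Nt / z.Lm * v ^ (-(p.μ - 2 + 1)) +
      z.NM * z.Lt / z.Lm ^ 2 * v ^ (-(3 * p.μ - 2 + 1)))) := by
  have hX := Real.rpow_pos_of_pos hv p.μ
  have := C.pos.Lm
  have := C.pos.Lt
  have := C.pos.NM
  have := C.pos.Nt
  have := C.a_pos
  have hd0 : 0 ≤ d := (abs_nonneg _).trans hd
  have h := abs_div_sub_div_le (x := p.N v x) (mul_pos C.pos.Lm hX) (C.L_lo v x hv)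
    (C.L_lo v y hv) (C.N_nonneg v y hv)
  have hl := (C.L_lip v x y hv).trans (mul_le_mul_of_nonneg_left hd C.pos.Lt.le)
  have hn := (C.N_lip v x y hv).trans (mul_le_mul_of_nonneg_left hd C.pos.Nt.le)
  have hN := C.N_le hv (x := y)
  have hN0 := C.N_nonneg v y hv
  rw [← mul_sub, abs_mul, abs_of_pos (by positivity : 0 < 2 * p.a * v)]
  calc _ ≤ 2 * p.a * v * (|p.N v x - p.N v y| / (z.Lm * v ^ p.μ) +
        p.N v y * |p.L v x - p.L v y| / (z.Lm * v ^ p.μ) ^ 2) := by gcongr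
    _ ≤ 2 * p.a * v * (z.Nt * d / (z.Lm * v ^ p.μ) +
        z.NM / v ^ p.μ * (z.Lt * d) / (z.Lm * v ^ p.μ) ^ 2) := by gcongr
    _ = _ := by rw [rpow_one_μ hv, rpow_three_μ hv]; field_simp

theorem m_lip : |p.K v x / (p.L v x * v ^ p.ν) - p.K v y / (p.L v y * v ^ p.ν)| ≤
    d * (z.Kt / z.Lm * v ^ (-(2 * p.μ + p.ν - 1 + 1)) +
      z.KM * z.Lt / z.Lm ^ 2 * v ^ (-(3 * p.μ + p.ν - 1 + 1))) := by
  have hX := Real.rpow_pos_of_pos hv p.μ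
  have hY := Real.rpow_pos_of_pos hv p.ν
  have := C.pos.Lm
  have := C.pos.Lt
  have := C.pos.KM
  have := C.pos.Kt
  have hd0 : 0 ≤ d := (abs_nonneg _).trans hd
  have h := abs_div_sub_div_le (x := p.K v x) (mul_pos C.pos.Lm hX) (C.L_lo v x hv)
    (C.L_lo v y hv) (C.K_pos hv (x := y)).le
  have hl := (C.L_lip v x y hv).trans (mul_le_mul_of_nonneg_left hd C.pos.Lt.le)
  have hn := (C.abs_K_sub_le hv (x := x) (y := y)).trans
    (mul_le_mul_of_nonneg_left hd (by positivity))
  have hN := C.K_le hv (x := y)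
  have hN0 := (C.K_pos hv (x := y)).le
  rw [← div_div, ← div_div, ← sub_div, abs_div, abs_of_pos hY]
  calc _ ≤ (|p.K v x - p.K v y| / (z.Lm * v ^ p.μ) +
        p.K v y * |p.L v x - p.L v y| / (z.Lm * v ^ p.μ) ^ 2) / v ^ p.ν := by gcongr
    _ ≤ (z.Kt / v ^ p.μ * d / (z.Lm * v ^ p.μ) +
        z.KM / v ^ p.μ * (z.Lt * d) / (z.Lm * v ^ p.μ) ^ 2) / v ^ p.ν := by gcongr
    _ = _ := by rw [rpow_θ hv, rpow_θ' hv]; field_simp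

/-- The exponent depends on the state both directly and through the number `H`. The last term
accounts for exchanging `h` and `h'`, which are bounded below by `hi` and differ by at most `ht *
d`. -/
theorem w_lip {h h' hi ht : ℝ} (hhi : 0 < hi) (h1 : hi ≤ h) (h2 : hi ≤ h')
    (h3 : |h - h'| ≤ ht * d) :
    |(2 * p.a * v * (p.N v x / p.L v x) + z.D / h * (p.K v x / (p.L v x * v ^ p.ν))) -
      (2 * p.a * v * (p.N v y / p.L v y) + z.D / h' * (p.K v y / (p.L v y * v ^ p.ν)))| ≤
    d * (2 * p.a * (z.Nt / z.Lm * v ^ (-(p.μ - 2 + 1)) +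
      z.NM * z.Lt / z.Lm ^ 2 * v ^ (-(3 * p.μ - 2 + 1))) +
      z.D * ((z.Kt / z.Lm * v ^ (-(2 * p.μ + p.ν - 1 + 1)) +
      z.KM * z.Lt / z.Lm ^ 2 * v ^ (-(3 * p.μ + p.ν - 1 + 1))) / hi +
        z.KM / z.Lm * v ^ (-(2 * p.μ + p.ν - 1 + 1)) * ht / hi ^ 2)) := by
  have hD := C.pos.D
  have hn := C.n_lip hv hd
  have hm := C.m_lip hv hd
  have hq := abs_div_sub_div_le (x := p.K v x / (p.L v x * v ^ p.ν)) hhi h1 h2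
    (C.m_nonneg hv (x := y))
  have hm' := C.m_le hv (x := y)
  have hm0 := C.m_nonneg hv (x := y)
  have hht : 0 ≤ ht * d := (abs_nonneg _).trans h3
  have hb0 := hm0.trans hm'
  generalize p.K v x / (p.L v x * v ^ p.ν) = qx at *
  generalize p.K v y / (p.L v y * v ^ p.ν) = qy at *
  generalize 2 * p.a * v * (p.N v x / p.L v x) = nx at *
  generalize 2 * p.a * v * (p.N v y / p.L v y) = ny at *
  have e : nx + z.D / h * qx - (ny + z.D / h' * qy) = (nx - ny) + z.D * (qx / h - qy / h') := by
    ring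
  rw [e, mul_add]
  refine (abs_add_le _ _).trans (add_le_add hn ?_)
  rw [abs_mul, abs_of_pos hD]
  calc _ ≤ z.D * (|qx - qy| / hi + qy * |h - h'| / hi ^ 2) := by gcongr
    _ ≤ z.D * (d * (z.Kt / z.Lm * v ^ (-(2 * p.μ + p.ν - 1 + 1)) +
          z.KM * z.Lt / z.Lm ^ 2 * v ^ (-(3 * p.μ + p.ν - 1 + 1))) / hi +
        z.KM / z.Lm * v ^ (-(2 * p.μ + p.ν - 1 + 1)) * (ht * d) / hi ^ 2) := by gcongr
    _ = _ := by ring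

end Coeffs

end Contact

end

/-! ### Integrated bounds and Lipschitz estimates in one zone. -/

noncomputable section

open MeasureTheory

/-- A measurable set to the right of a positive number. -/
structure RightOf (ℓ : ℝ) (S : Set ℝ) : Prop where
  pos : 0 < ℓ
  meas : MeasurableSet S
  sub : S ⊆ Ioi ℓ

theorem RightOf.pos_of_mem {ℓ : ℝ} {S : Set ℝ} (hS : RightOf ℓ S) {v : ℝ} (hv : v ∈ S) : 0 < v :=
  hS.pos.trans (hS.sub hv)

theorem continuous_of_abs_sub_le {f : ℝ → ℝ} {K : ℝ} (h : ∀ x y, |f x - f y| ≤ K * |x - y|) :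
    Continuous f :=
  (LipschitzWith.of_dist_le_mul (K := K.toNNReal) fun x y => by
    rw [Real.dist_eq, Real.dist_eq]
    exact (h x y).trans (mul_le_mul_of_nonneg_right (Real.le_coe_toNNReal K)
      (abs_nonneg _))).continuous

theorem integral_le_of_forall_le {φ b : ℝ → ℝ} {c : ℝ} (hφ : ∀ v, 0 ≤ φ v) (hb : Integrable b)
    (h : ∀ v, φ v ≤ b v) (hc : ∫ v, b v = c) : ∫ v, φ v ≤ c := by
  rw [← hc]
  exact integral_mono_of_nonneg (Eventually.of_forall hφ) hb (Eventually.of_forall h)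

namespace Contact

variable {p : Contact} {z : Zone}

namespace Coeffs

variable (C : p.Coeffs z) {ℓ : ℝ} {S : Set ℝ} (hS : RightOf ℓ S) {f g : ℝ → ℝ}
  (hf : Measurable f) (hg : Measurable g) {h h' hi ht d : ℝ}
include C

theorem exponents_pos : 0 < p.κ ∧ 0 < p.μ ∧ 0 < p.μ - 1 ∧ 0 < p.μ - 2 ∧ 0 < 2 * p.μ - 2 ∧
    0 < 3 * p.μ - 2 ∧ 0 < 2 * p.μ + p.ν - 1 ∧ 0 < 3 * p.μ + p.ν - 1 := by
  have h1 := C.two_lt_μ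
  have h2 := C.ν_pos
  exact ⟨C.κ_pos, by linarith, by linarith, by linarith, by linarith, by linarith, by linarith,
    by linarith⟩

omit C in
theorem nE_pos (u i : ℝ) : 0 < p.nE z u i := Real.exp_pos _

include hf in
-- Nothing is assumed about the coefficients at `v ≤ 0`, so measurability is obtained for the
-- superpositions cut off there. The zones lie in `v > 0`, so inserting this cut-off does not change
-- the densities.
theorem measurable_guard :
    Measurable ((Ioi 0).indicator fun v => p.L v (f v)) ∧
    Measurable ((Ioi 0).indicator fun v => p.N v (f v)) ∧
    Measurable ((Ioi 0).indicator fun v => p.K v (f v)) :=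
  ⟨measurable_indicator_comp C.L_meas
    (fun v hv => continuous_of_abs_sub_le fun x y => C.L_lip v x y hv) hf,
  measurable_indicator_comp C.N_meas
    (fun v hv => continuous_of_abs_sub_le fun x y => C.N_lip v x y hv) hf,
  measurable_indicator_comp C.K_meas
    (fun v hv => continuous_of_abs_sub_le fun x y => C.K_lip v x y hv) hf⟩

include hS hf

theorem zw_meas (h : ℝ) : Measurable (p.zw z S h f) := by
  obtain ⟨hL, hN, hK⟩ := C.measurable_guard hf
  have e : p.zw z S h f = S.indicator fun v =>
      2 * p.a * v * ((Ioi 0).indicator (fun v => p.N v (f v)) v /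
        (Ioi 0).indicator (fun v => p.L v (f v)) v) +
      z.D / h * ((Ioi 0).indicator (fun v => p.K v (f v)) v /
        ((Ioi 0).indicator (fun v => p.L v (f v)) v * v ^ p.ν)) :=
    indicator_congr fun v hv => by simp [hS.pos_of_mem hv]
  rw [e]
  exact Measurable.indicator (by fun_prop) hS.meas

theorem zl_meas : Measurable (p.zl S f) := by
  obtain ⟨hL, -, -⟩ := C.measurable_guard hf
  have e : p.zl S f = S.indicator fun v =>
      1 / ((Ioi 0).indicator (fun v => p.L v (f v)) v * v ^ p.ν) :=
    indicator_congr fun v hv => by simp [hS.pos_of_mem hv]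
  rw [e]
  exact Measurable.indicator (by fun_prop) hS.meas

theorem zk_meas : Measurable (p.zk S f) := by
  obtain ⟨-, -, hK⟩ := C.measurable_guard hf
  have e : p.zk S f = S.indicator fun v =>
      (Ioi 0).indicator (fun v => p.K v (f v)) v / v ^ p.ν :=
    indicator_congr fun v hv => by simp [hS.pos_of_mem hv]
  rw [e]
  exact Measurable.indicator (by fun_prop) hS.meas

omit hf

theorem zl_nonneg (v : ℝ) : 0 ≤ p.zl S f v := indicator_nonneg (fun v hv => by
  have h0 := hS.pos_of_mem hv
  have := C.L_pos h0 (x := f v)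
  positivity) v

theorem zk_nonneg (v : ℝ) : 0 ≤ p.zk S f v := indicator_nonneg (fun v hv => by
  have h0 := hS.pos_of_mem hv
  have := C.K_pos h0 (x := f v)
  positivity) v

theorem zw_nonneg (hh : 0 < h) (v : ℝ) : 0 ≤ p.zw z S h f v := indicator_nonneg (fun v hv => by
  have h0 := hS.pos_of_mem hv
  exact add_nonneg (C.n_nonneg h0) (mul_nonneg (div_nonneg C.pos.D.le hh.le) (C.m_nonneg h0))) v

theorem zl_le (v : ℝ) : p.zl S f v ≤ 1 / z.Lm * tailPow p.κ ℓ v := by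
  have := C.pos.Lm
  refine indicator_apply_le_of (fun v => mul_nonneg (by positivity) (tailPow_nonneg _ hS.pos v))
    (fun v hv => ?_) v
  rw [tailPow_of_mem _ (hS.sub hv)]
  exact C.l_le (hS.pos_of_mem hv)

theorem zk_le (v : ℝ) : p.zk S f v ≤ z.KM * tailPow p.κ ℓ v := by
  have := C.pos.KM
  refine indicator_apply_le_of (fun v => mul_nonneg (by positivity) (tailPow_nonneg _ hS.pos v))
    (fun v hv => ?_) v
  rw [tailPow_of_mem _ (hS.sub hv)]
  exact C.k_le (hS.pos_of_mem hv)

theorem zw_le (hhi : 0 < hi) (hh : hi ≤ h) (v : ℝ) : p.zw z S h f v ≤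
    2 * p.a * z.NM / z.Lm * tailPow (2 * p.μ - 2) ℓ v +
      z.D / hi * (z.KM / z.Lm) * tailPow (2 * p.μ + p.ν - 1) ℓ v := by
  have := C.pos.Lm
  have := C.pos.KM
  have := C.pos.NM
  have := C.pos.D
  have := C.a_pos
  refine indicator_apply_le_of (fun v => add_nonneg
    (mul_nonneg (by positivity) (tailPow_nonneg _ hS.pos v))
    (mul_nonneg (by positivity) (tailPow_nonneg _ hS.pos v))) (fun v hv => ?_) v
  rw [tailPow_of_mem _ (hS.sub hv), tailPow_of_mem _ (hS.sub hv), mul_assoc (z.D / hi)]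
  refine add_le_add (C.n_le (hS.pos_of_mem hv)) ?_
  refine mul_le_mul ?_ (C.m_le (hS.pos_of_mem hv)) (C.m_nonneg (hS.pos_of_mem hv)) (by positivity)
  gcongr

omit hS in
theorem zw_bound_int (hℓ : 0 < ℓ) (c c' : ℝ) : Integrable fun v =>
    c * tailPow (2 * p.μ - 2) ℓ v + c' * tailPow (2 * p.μ + p.ν - 1) ℓ v := by
  obtain ⟨-, -, -, -, e5, -, e7, -⟩ := C.exponents_pos
  exact ((tailPow_int e5 hℓ).const_mul _).add ((tailPow_int e7 hℓ).const_mul _)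

include hf

theorem goodTriple (hh : 0 < h) : GoodTriple (p.zw z S h f) (p.zl S f) (p.zk S f) where
  w_int := (C.zw_bound_int hS.pos _ _).mono' (C.zw_meas hS hf h).aestronglyMeasurable
    (Eventually.of_forall fun v => by
      rw [Real.norm_eq_abs, abs_of_nonneg (C.zw_nonneg hS hh v)]
      exact C.zw_le hS hh le_rfl v)
  l_int := ((tailPow_int C.κ_pos hS.pos).const_mul _).mono' (C.zl_meas hS hf).aestronglyMeasurable
    (Eventually.of_forall fun v => by
      rw [Real.norm_eq_abs, abs_of_nonneg (C.zl_nonneg hS v)]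
      exact C.zl_le hS v)
  k_int := ((tailPow_int C.κ_pos hS.pos).const_mul _).mono' (C.zk_meas hS hf).aestronglyMeasurable
    (Eventually.of_forall fun v => by
      rw [Real.norm_eq_abs, abs_of_nonneg (C.zk_nonneg hS v)]
      exact C.zk_le hS v)
  w_nonneg := C.zw_nonneg hS hh
  l_nonneg := C.zl_nonneg hS
  k_nonneg := C.zk_nonneg hS

omit hf

theorem integral_zl_le : ∫ v, p.zl S f v ≤ ℓ⁻¹ ^ p.κ / (z.Lm * p.κ) :=
  integral_le_of_forall_le (C.zl_nonneg hS) ((tailPow_int C.κ_pos hS.pos).const_mul _)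
    (C.zl_le hS) (by rw [integral_const_mul, integral_tailPow C.κ_pos hS.pos]; ring)

theorem integral_zk_le : ∫ v, p.zk S f v ≤ z.KM * (ℓ⁻¹ ^ p.κ / p.κ) :=
  integral_le_of_forall_le (C.zk_nonneg hS) ((tailPow_int C.κ_pos hS.pos).const_mul _)
    (C.zk_le hS) (by rw [integral_const_mul, integral_tailPow C.κ_pos hS.pos])

omit C hS in
-- Since `θ = κ + μ`, dividing by `H_inf` absorbs the factor `u ^ κ` and leaves `u ^ μ`.
theorem rpow_θ_eq {u : ℝ} (hu : 0 < u) : u ^ (2 * p.μ + p.ν - 1) = u ^ p.κ * u ^ p.μ := by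
  rw [← Real.rpow_add hu, κ]; ring_nf

omit C hS in
theorem rpow_θ'_eq {u : ℝ} (hu : 0 < u) : u ^ (3 * p.μ + p.ν - 1) = u ^ p.κ * u ^ (2 * p.μ) := by
  rw [← Real.rpow_add hu, κ]; ring_nf

theorem integral_zw_le (hhi : 0 < hi) (hh : hi ≤ h) : ∫ v, p.zw z S h f v ≤
    p.a * (z.NM / (z.Lm * (p.μ - 1))) * ℓ⁻¹ ^ (2 * p.μ - 2) +
      z.D * z.KM / (z.Lm * (2 * p.μ + p.ν - 1)) * (ℓ⁻¹ ^ p.κ / hi) * ℓ⁻¹ ^ p.μ := by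
  obtain ⟨-, -, e3, -, e5, -, e7, -⟩ := C.exponents_pos
  have hu := inv_pos.2 hS.pos
  have := C.pos.Lm
  refine integral_le_of_forall_le (C.zw_nonneg hS (hhi.trans_le hh))
    (C.zw_bound_int hS.pos _ _) (C.zw_le hS hhi hh) ?_
  rw [integral_add ((tailPow_int e5 hS.pos).const_mul _) ((tailPow_int e7 hS.pos).const_mul _),
    integral_const_mul, integral_const_mul, integral_tailPow e5 hS.pos,
    integral_tailPow e7 hS.pos, rpow_θ_eq hu, show 2 * p.μ - 2 = 2 * (p.μ - 1) by ring]
  field_simp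

include hf

/-- Every primitive of a nonnegative exponent is at most its integral over the line, so one bound
serves all `η`. -/
theorem nE_le (hhi : 0 < hi) (hh : hi ≤ h) (η : ℝ) :
    p.nE z ℓ⁻¹ (ℓ⁻¹ ^ p.κ / hi) ≤ expE (p.zw z S h f) η :=
  (Real.exp_le_exp.2 (neg_le_neg (C.integral_zw_le hS hhi hh))).trans
    ((C.goodTriple hS hf (hhi.trans_le hh)).exp_le_expE η)

theorem integral_hF_le (hhi : 0 < hi) (hh : hi ≤ h) :
    ∫ v, hF (p.zw z S h f) (p.zk S f) v ≤ ℓ⁻¹ ^ p.κ * p.nHs z ℓ⁻¹ (ℓ⁻¹ ^ p.κ / hi) := by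
  have hn := nE_pos (p := p) (z := z) ℓ⁻¹ (ℓ⁻¹ ^ p.κ / hi)
  refine ((C.goodTriple hS hf (hhi.trans_le hh)).integral_hF_le hn (C.nE_le hS hf hhi hh)).trans ?_
  refine (div_le_div_of_nonneg_right (C.integral_zk_le hS) hn.le).trans_eq ?_
  rw [nHs]; field_simp

theorem integral_gF_le (hhi : 0 < hi) (hh : hi ≤ h) :
    ∫ v, gF (p.zw z S h f) (p.zl S f) (p.zk S f) v ≤
      (ℓ⁻¹ ^ p.κ) ^ 2 * p.nGs z ℓ⁻¹ (ℓ⁻¹ ^ p.κ / hi) := by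
  have T := C.goodTriple hS hf (hhi.trans_le hh)
  have h1 := C.integral_hF_le hS hf hhi hh
  refine T.integral_gF_le.trans ((mul_le_mul h1 (C.integral_zl_le hS)
    (integral_nonneg (C.zl_nonneg hS))
    ((integral_nonneg T.hF_nonneg).trans h1)).trans_eq ?_)
  rw [nGs]; field_simp

variable (hd : ∀ v ∈ S, |f v - g v| ≤ d) (hd0 : 0 ≤ d)
include hg hd hd0

omit hf hg

theorem integral_abs_zl_sub_le : ∫ v, |p.zl S f v - p.zl S g v| ≤
    d * (ℓ⁻¹ ^ p.κ * (z.Lt / (z.Lm ^ 2 * (2 * p.μ + p.ν - 1)) * ℓ⁻¹ ^ p.μ)) := by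
  obtain ⟨-, -, -, -, -, -, e7, -⟩ := C.exponents_pos
  have := C.pos.Lm
  have := C.pos.Lt
  refine integral_le_of_forall_le (fun _ => abs_nonneg _)
    (((tailPow_int e7 hS.pos).const_mul (z.Lt / z.Lm ^ 2)).const_mul d)
    (abs_indicator_sub_le (fun v => mul_nonneg hd0 (mul_nonneg (by positivity)
      (tailPow_nonneg _ hS.pos v))) fun v hv => ?_) ?_
  · rw [tailPow_of_mem _ (hS.sub hv)]
    exact C.l_lip (hS.pos_of_mem hv) (hd v hv)
  · rw [integral_const_mul, integral_const_mul, integral_tailPow e7 hS.pos,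
      rpow_θ_eq (inv_pos.2 hS.pos)]
    field_simp

theorem integral_abs_zk_sub_le : ∫ v, |p.zk S f v - p.zk S g v| ≤
    d * (z.Kt * (ℓ⁻¹ ^ p.κ / p.κ)) := by
  have := C.pos.Kt
  refine integral_le_of_forall_le (fun _ => abs_nonneg _)
    (((tailPow_int C.κ_pos hS.pos).const_mul z.Kt).const_mul d)
    (abs_indicator_sub_le (fun v => mul_nonneg hd0 (mul_nonneg (by positivity)
      (tailPow_nonneg _ hS.pos v))) fun v hv => ?_) ?_
  · rw [tailPow_of_mem _ (hS.sub hv)]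
    exact C.k_lip (hS.pos_of_mem hv) (hd v hv)
  · rw [integral_const_mul, integral_const_mul, integral_tailPow C.κ_pos hS.pos]

variable (hhi : 0 < hi) (h1 : hi ≤ h) (h2 : hi ≤ h') (h3 : |h - h'| ≤ ht * d) (hht : 0 ≤ ht)
include hhi h1 h2 h3 hht

/-- The pointwise bound `w_lip` is integrated termwise; each tail power contributes `ℓ⁻¹ ^ q / q`.
All four exponents `q` are positive because `2 < μ` and `0 < ν`. -/
theorem integral_abs_zw_sub_le : ∫ v, |p.zw z S h f v - p.zw z S h' g v| ≤
    d * p.nEt z ℓ⁻¹ (ℓ⁻¹ ^ p.κ / hi) (ht / hi) := by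
  obtain ⟨-, -, -, e4, -, e6, e7, e8⟩ := C.exponents_pos
  have hu := inv_pos.2 hS.pos
  have := C.pos.Lm
  have := C.pos.Lt
  have := C.pos.KM
  have := C.pos.Kt
  have := C.pos.NM
  have := C.pos.Nt
  have := C.pos.D
  have := C.a_pos
  have i4 := tailPow_int e4 hS.pos
  have i6 := tailPow_int e6 hS.pos
  have i7 := tailPow_int e7 hS.pos
  have i8 := tailPow_int e8 hS.pos
  have j1 := ((i4.const_mul (z.Nt / z.Lm)).add
    (i6.const_mul (z.NM * z.Lt / z.Lm ^ 2))).const_mul (2 * p.a)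
  have j2 := ((i7.const_mul (z.Kt / z.Lm)).add
    (i8.const_mul (z.KM * z.Lt / z.Lm ^ 2))).div_const hi
  have j3 := ((i7.const_mul (z.KM / z.Lm)).mul_const ht).div_const (hi ^ 2)
  refine integral_le_of_forall_le (fun _ => abs_nonneg _)
    ((j1.add ((j2.add j3).const_mul z.D)).const_mul d)
    (abs_indicator_sub_le (fun v => ?_) fun v hv => ?_) ?_
  · have k4 := tailPow_nonneg (p.μ - 2) hS.pos v
    have k6 := tailPow_nonneg (3 * p.μ - 2) hS.pos v
    have k7 := tailPow_nonneg (2 * p.μ + p.ν - 1) hS.pos v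
    have k8 := tailPow_nonneg (3 * p.μ + p.ν - 1) hS.pos v
    simp only [Pi.add_apply]
    positivity
  · simp only [Pi.add_apply, tailPow_of_mem _ (hS.sub hv)]
    exact C.w_lip (hS.pos_of_mem hv) (hd v hv) hhi h1 h2 h3
  · rw [integral_const_mul, integral_add' j1 ((j2.add j3).const_mul z.D), integral_const_mul,
      integral_const_mul, integral_add' j2 j3, integral_div, integral_div, integral_mul_const,
      integral_add' (i4.const_mul _) (i6.const_mul _),
      integral_add' (i7.const_mul _) (i8.const_mul _), integral_const_mul,
      integral_const_mul, integral_const_mul, integral_const_mul, integral_const_mul,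
      integral_tailPow e4 hS.pos, integral_tailPow e6 hS.pos, integral_tailPow e7 hS.pos,
      integral_tailPow e8 hS.pos, rpow_θ_eq hu, rpow_θ'_eq hu, nEt]
    field_simp
    ring

omit hd hd0 hhi h1 h2 h3 hht
variable (hd : ∀ v ∈ S, |f v - g v| ≤ d) (hd0 : 0 ≤ d)
  (hhi : 0 < hi) (h1 : hi ≤ h) (h2 : hi ≤ h') (h3 : |h - h'| ≤ ht * d) (hht : 0 ≤ ht)
include hf hg hd hd0 hhi h1 h2 h3 hht

theorem integral_abs_phiF_sub_le :
    ∫ v, |phiF (p.zw z S h f) (p.zl S f) v - phiF (p.zw z S h' g) (p.zl S g) v| ≤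
      d * (ℓ⁻¹ ^ p.κ * p.nΦt z ℓ⁻¹ (ℓ⁻¹ ^ p.κ / hi) (ht / hi)) := by
  have T := C.goodTriple hS hf (hhi.trans_le h1)
  have T' := C.goodTriple hS hg (hhi.trans_le h2)
  have a1 := C.integral_abs_zw_sub_le hS hd hd0 hhi h1 h2 h3 hht
  have a2 := C.integral_abs_zl_sub_le hS hd hd0
  refine (T.integral_abs_phiF_sub_le T').trans ((add_le_add (mul_le_mul a1 (C.integral_zl_le hS)
    (integral_nonneg (C.zl_nonneg hS))
    ((integral_nonneg fun _ => abs_nonneg _).trans a1)) a2).trans_eq ?_)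
  rw [nΦt]; ring

theorem integral_abs_hF_sub_le :
    ∫ v, |hF (p.zw z S h f) (p.zk S f) v - hF (p.zw z S h' g) (p.zk S g) v| ≤
      d * (ℓ⁻¹ ^ p.κ * p.nHt z ℓ⁻¹ (ℓ⁻¹ ^ p.κ / hi) (ht / hi)) := by
  have T := C.goodTriple hS hf (hhi.trans_le h1)
  have T' := C.goodTriple hS hg (hhi.trans_le h2)
  have a1 := C.integral_abs_zw_sub_le hS hd hd0 hhi h1 h2 h3 hht
  have a2 := C.integral_abs_zk_sub_le hS hd hd0
  have hn := nE_pos (p := p) (z := z) ℓ⁻¹ (ℓ⁻¹ ^ p.κ / hi)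
  have hκ := C.κ_pos
  refine (T.integral_abs_hF_sub_le T' hn (C.nE_le hS hf hhi h1) (C.nE_le hS hg hhi h2)).trans
    ((add_le_add (div_le_div_of_nonneg_right a2 hn.le)
    (mul_le_mul (div_le_div_of_nonneg_right a1 (by positivity)) (C.integral_zk_le hS)
    (integral_nonneg (C.zk_nonneg hS)) ?_)).trans_eq ?_)
  · exact div_nonneg ((integral_nonneg fun _ => abs_nonneg _).trans a1) (by positivity)
  · rw [nHt]
    generalize p.nE z ℓ⁻¹ (ℓ⁻¹ ^ p.κ / hi) = e at *
    field_simp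

theorem integral_abs_gF_sub_le :
    ∫ v, |gF (p.zw z S h f) (p.zl S f) (p.zk S f) v -
        gF (p.zw z S h' g) (p.zl S g) (p.zk S g) v| ≤
      d * ((ℓ⁻¹ ^ p.κ) ^ 2 * p.nGt z ℓ⁻¹ (ℓ⁻¹ ^ p.κ / hi) (ht / hi)) := by
  have T := C.goodTriple hS hf (hhi.trans_le h1)
  have T' := C.goodTriple hS hg (hhi.trans_le h2)
  have a1 := C.integral_abs_phiF_sub_le hS hf hg hd hd0 hhi h1 h2 h3 hht
  have a2 := C.integral_abs_hF_sub_le hS hf hg hd hd0 hhi h1 h2 h3 hht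
  have a3 := C.integral_hF_le hS hf hhi h1
  refine (T.integral_abs_gF_sub_le T').trans ((add_le_add
    (mul_le_mul a3 a1 (integral_nonneg fun _ => abs_nonneg _)
      ((integral_nonneg T.hF_nonneg).trans a3))
    (mul_le_mul a2 (C.integral_zl_le hS) (integral_nonneg (C.zl_nonneg hS))
      ((integral_nonneg fun _ => abs_nonneg _).trans a2))).trans_eq ?_)
  rw [nGt]; field_simp

end Coeffs

end Contact

end

/-! ### The operators as integrals over the whole line. -/

noncomputable section

open MeasureTheory

theorem prim_indicator_Ioc {ℓ r η : ℝ} (h1 : ℓ ≤ η) (h2 : η ≤ r) (φ : ℝ → ℝ) :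
    prim ((Ioc ℓ r).indicator φ) η = ∫ v in ℓ..η, φ v := by
  rw [prim, setIntegral_indicator measurableSet_Ioc, intervalIntegral.integral_of_le h1]
  congr 2
  ext v
  simp only [mem_inter_iff, mem_Iic, mem_Ioc]
  exact ⟨fun h => ⟨h.2.1, h.1⟩, fun h => ⟨h.2, h.1, h.2.trans h2⟩⟩

theorem prim_indicator_Ioi {ℓ η : ℝ} (h1 : ℓ ≤ η) (φ : ℝ → ℝ) :
    prim ((Ioi ℓ).indicator φ) η = ∫ v in ℓ..η, φ v := by
  rw [prim, setIntegral_indicator measurableSet_Ioi, intervalIntegral.integral_of_le h1]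
  congr 2
  ext v
  simp only [mem_inter_iff, mem_Iic, mem_Ioc, mem_Ioi]
  exact and_comm

namespace Contact

variable (p : Contact)

section operators

variable (r s : ℝ) (f₁ f₂ : ℝ → ℝ)

/-- The number `H` as a sum of integrals over the whole line. -/
def tH : ℝ := (∫ v, p.zk (Ioc s r) f₁ v) + ∫ v, p.zk (Ioi r) f₂ v

/-- The prefix `t` marks quantities carried by densities on the line, cut off to `Ioc s r` or `Ioi
r`. They lie in one `L¹` space for all `(r, s)`. The letters `φ`, `h`, `g` denote the densities of
`Φ_i`, `H_i`, `G_i`. -/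
def tw₁ : ℝ → ℝ := p.zw p.zone₁ (Ioc s r) (p.tH r s f₁ f₂) f₁
def tw₂ : ℝ → ℝ := p.zw p.zone₂ (Ioi r) (p.tH r s f₁ f₂) f₂
def tφ₁ : ℝ → ℝ := phiF (p.tw₁ r s f₁ f₂) (p.zl (Ioc s r) f₁)
def tφ₂ : ℝ → ℝ := phiF (p.tw₂ r s f₁ f₂) (p.zl (Ioi r) f₂)
def th₁ : ℝ → ℝ := hF (p.tw₁ r s f₁ f₂) (p.zk (Ioc s r) f₁)
def th₂ : ℝ → ℝ := hF (p.tw₂ r s f₁ f₂) (p.zk (Ioi r) f₂)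
def tg₁ : ℝ → ℝ := gF (p.tw₁ r s f₁ f₂) (p.zl (Ioc s r) f₁) (p.zk (Ioc s r) f₁)
def tg₂ : ℝ → ℝ := gF (p.tw₂ r s f₁ f₂) (p.zl (Ioi r) f₂) (p.zk (Ioi r) f₂)

/-- `V₁`, extended to the whole line by constants. -/
def tV₁ (η : ℝ) : ℝ :=
  s ^ p.ν * p.Q * Real.exp (-s ^ 2) *
      ((∫ v, p.tφ₁ r s f₁ f₂ v) - prim (p.tφ₁ r s f₁ f₂) η) +
    p.D₁s / p.tH r s f₁ f₂ ^ 2 * ((∫ v, p.tg₁ r s f₁ f₂ v) - prim (p.tg₁ r s f₁ f₂) η)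

/-- `V₂`, extended to the whole line by zero. -/
def tV₂ (η : ℝ) : ℝ :=
  (p.D₂s / p.tH r s f₁ f₂ ^ 2 * (∫ v, p.tg₂ r s f₁ f₂ v) - 1) *
      (prim (p.tφ₂ r s f₁ f₂) η / ∫ v, p.tφ₂ r s f₁ f₂ v) -
    p.D₂s / p.tH r s f₁ f₂ ^ 2 * prim (p.tg₂ r s f₁ f₂) η

/-- The left-hand side of the second free-boundary equation, divided by `r ^ (ν + 1)`. -/
def tW : ℝ :=
  (expE (p.tw₁ r s f₁ f₂) r * (p.Q * Real.exp (-s ^ 2) * s ^ p.ν +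
      p.D₁s / p.tH r s f₁ f₂ ^ 2 * ∫ v, p.th₁ r s f₁ f₂ v) -
    1 / (∫ v, p.tφ₂ r s f₁ f₂ v) *
      (1 - p.D₂s / p.tH r s f₁ f₂ ^ 2 * ∫ v, p.tg₂ r s f₁ f₂ v)) / r ^ (p.ν + 1)

end operators

variable {p} {r s : ℝ} (f₁ f₂ : ℝ → ℝ)

theorem zl_congr {S : Set ℝ} {f g : ℝ → ℝ} (h : ∀ v ∈ S, f v = g v) : p.zl S f = p.zl S g :=
  indicator_congr fun v hv => by rw [h v hv]

theorem zk_congr {S : Set ℝ} {f g : ℝ → ℝ} (h : ∀ v ∈ S, f v = g v) : p.zk S f = p.zk S g :=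
  indicator_congr fun v hv => by rw [h v hv]

theorem zw_congr {z : Zone} {S : Set ℝ} {f g : ℝ → ℝ} (h : ∀ v ∈ S, f v = g v) (c : ℝ) :
    p.zw z S c f = p.zw z S c g :=
  indicator_congr fun v hv => by rw [h v hv]

section congr

variable {f₁ f₂} {g₁ g₂ : ℝ → ℝ} (h₁ : ∀ v ∈ Ioc s r, f₁ v = g₁ v) (h₂ : ∀ v ∈ Ioi r, f₂ v = g₂ v)
include h₁ h₂

/-- The densities see the states only inside the zones. This lets zero extensions of functions on
`[s, r]` and `[r, ∞)` be exchanged for functions on the line. -/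
theorem tH_congr : p.tH r s f₁ f₂ = p.tH r s g₁ g₂ := by
  rw [tH, tH, zk_congr h₁, zk_congr h₂]

theorem tw₁_congr : p.tw₁ r s f₁ f₂ = p.tw₁ r s g₁ g₂ := by
  rw [tw₁, tw₁, tH_congr h₁ h₂, zw_congr h₁]

theorem tw₂_congr : p.tw₂ r s f₁ f₂ = p.tw₂ r s g₁ g₂ := by
  rw [tw₂, tw₂, tH_congr h₁ h₂, zw_congr h₂]

theorem tV₁_congr : p.tV₁ r s f₁ f₂ = p.tV₁ r s g₁ g₂ := by
  funext η
  simp only [tV₁, tφ₁, tg₁, tw₁_congr h₁ h₂, tH_congr h₁ h₂, zl_congr h₁, zk_congr h₁]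

theorem tV₂_congr : p.tV₂ r s f₁ f₂ = p.tV₂ r s g₁ g₂ := by
  funext η
  simp only [tV₂, tφ₂, tg₂, tw₂_congr h₁ h₂, tH_congr h₁ h₂, zl_congr h₂, zk_congr h₂]

theorem tW_congr : p.tW r s f₁ f₂ = p.tW r s g₁ g₂ := by
  simp only [tW, tφ₂, tg₂, th₁, tw₁_congr h₁ h₂, tw₂_congr h₁ h₂, tH_congr h₁ h₂, zl_congr h₂,
    zk_congr h₂, zk_congr h₁]

end congr

section links

variable (hsr : s ≤ r)
include hsr

theorem H_eq : p.H r s f₁ f₂ = p.tH r s f₁ f₂ := by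
  rw [H, F₁, F₂Top, tH, zk, zk, integral_indicator measurableSet_Ioc,
    integral_indicator measurableSet_Ioi, intervalIntegral.integral_of_le hsr]

variable {η : ℝ}

theorem E₁_eq (h1 : s ≤ η) (h2 : η ≤ r) : p.E₁ r s f₁ f₂ η = expE (p.tw₁ r s f₁ f₂) η := by
  rw [E₁, expE, tw₁, zw, prim_indicator_Ioc h1 h2, H_eq f₁ f₂ hsr]; rfl

theorem E₂_eq (h1 : r ≤ η) : p.E₂ r s f₁ f₂ η = expE (p.tw₂ r s f₁ f₂) η := by
  rw [E₂, expE, tw₂, zw, prim_indicator_Ioi h1, H_eq f₁ f₂ hsr]; rfl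

theorem tφ₁_eq : p.tφ₁ r s f₁ f₂ = (Ioc s r).indicator fun v =>
    p.E₁ r s f₁ f₂ v / (p.L v (f₁ v) * v ^ p.ν) := by
  funext v
  by_cases hv : v ∈ Ioc s r
  · simp [tφ₁, phiF, zl, hv, E₁_eq f₁ f₂ hsr hv.1.le hv.2, div_eq_mul_inv]
  · simp [tφ₁, phiF, zl, hv]

theorem tφ₂_eq : p.tφ₂ r s f₁ f₂ = (Ioi r).indicator fun v =>
    p.E₂ r s f₁ f₂ v / (p.L v (f₂ v) * v ^ p.ν) := by
  funext v
  by_cases hv : v ∈ Ioi r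
  · simp only [tφ₂, phiF, zl, indicator_of_mem hv, E₂_eq f₁ f₂ hsr (mem_Ioi.1 hv).le]
    rw [mul_one_div]
  · simp [tφ₂, phiF, zl, indicator_of_notMem hv]

theorem th₁_eq : p.th₁ r s f₁ f₂ = (Ioc s r).indicator fun v =>
    p.K v (f₁ v) / (v ^ p.ν * p.E₁ r s f₁ f₂ v) := by
  funext v
  by_cases hv : v ∈ Ioc s r
  · simp only [th₁, hF, zk, indicator_of_mem hv, E₁_eq f₁ f₂ hsr hv.1.le hv.2]
    rw [div_div]
  · simp [th₁, hF, zk, indicator_of_notMem hv]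

theorem th₂_eq : p.th₂ r s f₁ f₂ = (Ioi r).indicator fun v =>
    p.K v (f₂ v) / (v ^ p.ν * p.E₂ r s f₁ f₂ v) := by
  funext v
  by_cases hv : v ∈ Ioi r
  · simp only [th₂, hF, zk, indicator_of_mem hv, E₂_eq f₁ f₂ hsr (mem_Ioi.1 hv).le]
    rw [div_div]
  · simp [th₂, hF, zk, indicator_of_notMem hv]

theorem H₁_eq (h1 : s ≤ η) (h2 : η ≤ r) : p.H₁ r s f₁ f₂ η = prim (p.th₁ r s f₁ f₂) η := by
  rw [H₁, th₁_eq f₁ f₂ hsr, prim_indicator_Ioc h1 h2]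

theorem H₂_eq (h1 : r ≤ η) : p.H₂ r s f₁ f₂ η = prim (p.th₂ r s f₁ f₂) η := by
  rw [H₂, th₂_eq f₁ f₂ hsr, prim_indicator_Ioi h1]

theorem tg₁_eq : p.tg₁ r s f₁ f₂ = (Ioc s r).indicator fun v =>
    p.E₁ r s f₁ f₂ v / (p.L v (f₁ v) * v ^ p.ν) * p.H₁ r s f₁ f₂ v := by
  funext v
  have h := congrFun (tφ₁_eq (p := p) f₁ f₂ hsr) v
  have e : p.tg₁ r s f₁ f₂ v = p.tφ₁ r s f₁ f₂ v * prim (p.th₁ r s f₁ f₂) v := rfl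
  rw [e, h]
  by_cases hv : v ∈ Ioc s r
  · rw [indicator_of_mem hv, indicator_of_mem hv, H₁_eq f₁ f₂ hsr hv.1.le hv.2]
  · rw [indicator_of_notMem hv, indicator_of_notMem hv, zero_mul]

theorem tg₂_eq : p.tg₂ r s f₁ f₂ = (Ioi r).indicator fun v =>
    p.E₂ r s f₁ f₂ v / (p.L v (f₂ v) * v ^ p.ν) * p.H₂ r s f₁ f₂ v := by
  funext v
  have h := congrFun (tφ₂_eq (p := p) f₁ f₂ hsr) v
  have e : p.tg₂ r s f₁ f₂ v = p.tφ₂ r s f₁ f₂ v * prim (p.th₂ r s f₁ f₂) v := rfl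
  rw [e, h]
  by_cases hv : v ∈ Ioi r
  · rw [indicator_of_mem hv, indicator_of_mem hv, H₂_eq f₁ f₂ hsr (mem_Ioi.1 hv).le]
  · rw [indicator_of_notMem hv, indicator_of_notMem hv, zero_mul]

theorem Φ₁_eq (h1 : s ≤ η) (h2 : η ≤ r) : p.Φ₁ r s f₁ f₂ η = prim (p.tφ₁ r s f₁ f₂) η := by
  rw [Φ₁, tφ₁_eq f₁ f₂ hsr, prim_indicator_Ioc h1 h2]

theorem Φ₁_right_eq : p.Φ₁ r s f₁ f₂ r = ∫ v, p.tφ₁ r s f₁ f₂ v := by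
  rw [Φ₁, tφ₁_eq f₁ f₂ hsr, integral_indicator measurableSet_Ioc,
    intervalIntegral.integral_of_le hsr]

theorem Φ₂_eq (h1 : r ≤ η) : p.Φ₂ r s f₁ f₂ η = prim (p.tφ₂ r s f₁ f₂) η := by
  rw [Φ₂, tφ₂_eq f₁ f₂ hsr, prim_indicator_Ioi h1]

theorem Φ₂Top_eq : p.Φ₂Top r s f₁ f₂ = ∫ v, p.tφ₂ r s f₁ f₂ v := by
  rw [Φ₂Top, tφ₂_eq f₁ f₂ hsr, integral_indicator measurableSet_Ioi]

theorem H₁_right_eq : p.H₁ r s f₁ f₂ r = ∫ v, p.th₁ r s f₁ f₂ v := by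
  rw [H₁, th₁_eq f₁ f₂ hsr, integral_indicator measurableSet_Ioc,
    intervalIntegral.integral_of_le hsr]

theorem G₁_eq (h1 : s ≤ η) (h2 : η ≤ r) : p.G₁ r s f₁ f₂ η = prim (p.tg₁ r s f₁ f₂) η := by
  rw [G₁, tg₁_eq f₁ f₂ hsr, prim_indicator_Ioc h1 h2]

theorem G₁_right_eq : p.G₁ r s f₁ f₂ r = ∫ v, p.tg₁ r s f₁ f₂ v := by
  rw [G₁, tg₁_eq f₁ f₂ hsr, integral_indicator measurableSet_Ioc,
    intervalIntegral.integral_of_le hsr]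

theorem G₂_eq (h1 : r ≤ η) : p.G₂ r s f₁ f₂ η = prim (p.tg₂ r s f₁ f₂) η := by
  rw [G₂, tg₂_eq f₁ f₂ hsr, prim_indicator_Ioi h1]

theorem G₂Top_eq : p.G₂Top r s f₁ f₂ = ∫ v, p.tg₂ r s f₁ f₂ v := by
  rw [G₂Top, tg₂_eq f₁ f₂ hsr, integral_indicator measurableSet_Ioi]

theorem V₁_eq (h1 : s ≤ η) (h2 : η ≤ r) : p.V₁ r s f₁ f₂ η = p.tV₁ r s f₁ f₂ η := by
  rw [V₁, tV₁, Φ₁_right_eq f₁ f₂ hsr, G₁_right_eq f₁ f₂ hsr, Φ₁_eq f₁ f₂ hsr h1 h2,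
    G₁_eq f₁ f₂ hsr h1 h2, H_eq f₁ f₂ hsr]

theorem V₂_eq (h1 : r ≤ η) : p.V₂ r s f₁ f₂ η = p.tV₂ r s f₁ f₂ η := by
  rw [V₂, tV₂, Φ₂Top_eq f₁ f₂ hsr, G₂Top_eq f₁ f₂ hsr, Φ₂_eq f₁ f₂ hsr h1,
    G₂_eq f₁ f₂ hsr h1, H_eq f₁ f₂ hsr]

/-- At `η = s` the integrals `Φ₁` and `G₁` vanish, so the left-hand side of the equation is the
value of `V₁` there. -/
theorem freeBdry₁_iff : p.FreeBdry₁ r s f₁ f₂ ↔ p.tV₁ r s f₁ f₂ s = p.B := by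
  rw [← V₁_eq f₁ f₂ hsr le_rfl hsr, V₁]
  simp [FreeBdry₁, Φ₁, G₁]

theorem freeBdry₂_iff (hr : 0 < r) : p.FreeBdry₂ r s f₁ f₂ ↔ p.tW r s f₁ f₂ = p.M := by
  rw [tW, div_eq_iff (Real.rpow_pos_of_pos hr _).ne', FreeBdry₂, E₁_eq f₁ f₂ hsr hsr le_rfl,
    H₁_right_eq f₁ f₂ hsr, Φ₂Top_eq f₁ f₂ hsr, G₂Top_eq f₁ f₂ hsr, H_eq f₁ f₂ hsr]

/-- By the same evaluation at `η = s`, `HipXY` compares the contact-face temperature with `B`. -/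
theorem X_lt_Y_iff : p.X r s f₁ f₂ < p.Y r s f₁ f₂ ↔ p.tV₁ r s f₁ f₂ s < p.B := by
  rw [← V₁_eq f₁ f₂ hsr le_rfl hsr, V₁, X, Y]
  simp only [Φ₁, G₁, intervalIntegral.integral_same, sub_zero]
  constructor <;> intro h <;> ring_nf at h ⊢ <;> linarith

end links

end Contact

end

/-! ### Lipschitz constants of `V₁` and `V₂`. -/

noncomputable section

open MeasureTheory

theorem indicator_Ioc_rpow (q : ℝ) {s r : ℝ} (hsr : s ≤ r) :
    (Ioc s r).indicator (fun v => v ^ (-(q + 1))) = fun v => tailPow q s v - tailPow q r v := by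
  funext v
  simp only [tailPow, indicator, mem_Ioc, mem_Ioi]
  by_cases h1 : s < v <;> by_cases h2 : v ≤ r
  · simp [h1, h2, not_lt.2 h2]
  · simp [h1, h2, lt_of_not_ge h2]
  · simp [h1, not_lt.2 h2]
  · exact absurd (hsr.trans_lt (lt_of_not_ge h2)) h1

theorem integral_indicator_Ioc_rpow {q s r : ℝ} (hq : 0 < q) (hs : 0 < s) (hsr : s ≤ r) :
    ∫ v, (Ioc s r).indicator (fun v => v ^ (-(q + 1))) v = (s⁻¹ ^ q - r⁻¹ ^ q) / q := by
  have hr := hs.trans_le hsr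
  rw [indicator_Ioc_rpow q hsr, integral_sub (tailPow_int hq hs) (tailPow_int hq hr),
    integral_tailPow hq hs, integral_tailPow hq hr, sub_div]

/-- The denominators are compared through `h² - h'² = (h + h') (h - h')` with `h + h' ≤ 2 hs`. -/
theorem abs_div_sq_sub_le {X X' h h' hi hs ht G δ d : ℝ} (hhi : 0 < hi) (h1 : hi ≤ h)
    (h2 : hi ≤ h') (h3 : h ≤ hs) (h4 : h' ≤ hs) (h5 : |h - h'| ≤ ht * d) (hX' : 0 ≤ X')
    (hXG : X' ≤ G) (hX : |X - X'| ≤ d * δ) :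
    |X / h ^ 2 - X' / h' ^ 2| ≤ d * (δ / hi ^ 2 + 2 * G * hs * ht / hi ^ 4) := by
  have p1 : hi ^ 2 ≤ h ^ 2 := by gcongr
  have p2 : hi ^ 2 ≤ h' ^ 2 := by gcongr
  have hs0 : 0 ≤ hs := (hhi.le.trans h1).trans h3
  have hsum : 0 ≤ h + h' := by linarith
  have p3 : |h ^ 2 - h' ^ 2| ≤ 2 * hs * (ht * d) := by
    rw [show h ^ 2 - h' ^ 2 = (h + h') * (h - h') by ring, abs_mul, abs_of_nonneg hsum]
    exact mul_le_mul (by linarith) h5 (abs_nonneg _) (by linarith)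
  have hg : 0 ≤ G := hX'.trans hXG
  refine (abs_div_sub_div_le (by positivity) p1 p2 hX').trans ?_
  calc _ ≤ d * δ / hi ^ 2 + G * (2 * hs * (ht * d)) / (hi ^ 2) ^ 2 := by gcongr
    _ = _ := by field_simp

theorem abs_mul_sub_mul_le {x y x' y' : ℝ} (hx : 0 ≤ x) (hx1 : x ≤ 1) {c : ℝ} (hy : 0 ≤ y')
    (hyc : y' ≤ c) : |x * y - x' * y'| ≤ |y - y'| + c * |x - x'| := by
  rw [show x * y - x' * y' = x * (y - y') + y' * (x - x') by ring]
  refine (abs_add_le _ _).trans (add_le_add ?_ ?_)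
  · rw [abs_mul, abs_of_nonneg hx]
    exact mul_le_of_le_one_left (abs_nonneg _) hx1
  · rw [abs_mul, abs_of_nonneg hy]
    gcongr

namespace Contact

variable (p : Contact)

/-- The standing assumptions and both sets of structural assumptions. -/
structure Model : Prop where
  standing : p.Standing
  C₁ : p.Coeffs p.zone₁
  C₂ : p.Coeffs p.zone₂

variable {p}

namespace Coeffs

variable {z : Zone} (C : p.Coeffs z)
include C

theorem integral_zk_Ioc_ge {s r : ℝ} (hs : 0 < s) (hsr : s ≤ r) {f : ℝ → ℝ} (hf : Measurable f) :
    z.Km / p.κ * (s⁻¹ ^ p.κ - r⁻¹ ^ p.κ) ≤ ∫ v, p.zk (Ioc s r) f v := by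
  have hS : RightOf s (Ioc s r) := ⟨hs, measurableSet_Ioc, fun v hv => hv.1⟩
  have hi := (tailPow_int C.κ_pos hs).sub (tailPow_int C.κ_pos (hs.trans_le hsr))
  have h : ∫ v, z.Km * (Ioc s r).indicator (fun v => v ^ (-(p.κ + 1))) v ≤
      ∫ v, p.zk (Ioc s r) f v := by
    refine integral_mono ?_ (C.goodTriple hS hf one_pos).k_int fun v => ?_
    · rw [indicator_Ioc_rpow _ hsr]; exact hi.const_mul _
    · by_cases hv : v ∈ Ioc s r
      · simp only [zk, indicator_of_mem hv]
        exact C.le_k (hS.pos_of_mem hv)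
      · simp [zk, indicator_of_notMem hv]
  rw [integral_const_mul, integral_indicator_Ioc_rpow C.κ_pos hs hsr] at h
  refine le_trans (le_of_eq ?_) h
  ring

theorem integral_zl_Ioi_ge {r : ℝ} (hr : 0 < r) {f : ℝ → ℝ} (hf : Measurable f) :
    1 / z.LM * (r⁻¹ ^ p.κ / p.κ) ≤ ∫ v, p.zl (Ioi r) f v := by
  have hS : RightOf r (Ioi r) := ⟨hr, measurableSet_Ioi, subset_rfl⟩
  rw [← integral_tailPow C.κ_pos hr, ← integral_const_mul]
  refine integral_mono ((tailPow_int C.κ_pos hr).const_mul _) (C.goodTriple hS hf one_pos).l_int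
    fun v => ?_
  by_cases hv : v ∈ Ioi r
  · simp only [zl, indicator_of_mem hv, tailPow_of_mem _ (mem_Ioi.1 hv)]
    exact C.le_l (hS.pos_of_mem hv)
  · simp [zl, tailPow, indicator_of_notMem hv]

end Coeffs

section matching

variable {r s : ℝ} (hs : 0 < s) (hr : 0 < r)

include hs in
theorem inv_rpow_eq (q : ℝ) : 1 / s ^ q = s⁻¹ ^ q := by
  rw [Real.inv_rpow hs.le, one_div]

section liquid
include hs

/-- This and the next identities match the constants of the statement with the integral estimates.
Both are the same expressions, up to the splitting of powers and division by `H_inf`. -/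
theorem E1inf_eq : p.E1inf r s = p.nE p.zone₁ s⁻¹ (s⁻¹ ^ p.κ / p.Hinf r s) := by
  have hu := inv_pos.2 hs
  simp only [E1inf, nE, zone₁, inv_rpow_eq hs, Coeffs.rpow_θ_eq hu]
  congr 1
  -- The common denominator is made opaque, so that it is treated as one atom and not expanded.
  generalize 2 * p.μ + p.ν - 1 = θ
  ring

theorem E1t_eq : p.E1t r s = p.nEt p.zone₁ s⁻¹ (s⁻¹ ^ p.κ / p.Hinf r s)
    (p.Ht r s / p.Hinf r s) := by
  have hu := inv_pos.2 hs
  simp only [E1t, nEt, zone₁, inv_rpow_eq hs, Coeffs.rpow_θ_eq hu, Coeffs.rpow_θ'_eq hu]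
  generalize 2 * p.μ + p.ν - 1 = θ
  ring

theorem Φ1t_eq : p.Φ1t r s = s⁻¹ ^ p.κ * p.nΦt p.zone₁ s⁻¹ (s⁻¹ ^ p.κ / p.Hinf r s)
    (p.Ht r s / p.Hinf r s) := by
  have hu := inv_pos.2 hs
  simp only [Φ1t, nΦt, E1t_eq hs, inv_rpow_eq hs, Coeffs.rpow_θ_eq hu]
  simp only [zone₁]
  ring

theorem H1sup_eq : p.H1sup r s = s⁻¹ ^ p.κ * p.nHs p.zone₁ s⁻¹ (s⁻¹ ^ p.κ / p.Hinf r s) := by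
  simp only [H1sup, nHs, E1inf_eq hs, inv_rpow_eq hs]
  simp only [zone₁]
  ring

theorem H1t_eq : p.H1t r s = s⁻¹ ^ p.κ * p.nHt p.zone₁ s⁻¹ (s⁻¹ ^ p.κ / p.Hinf r s)
    (p.Ht r s / p.Hinf r s) := by
  simp only [H1t, nHt, E1inf_eq hs, E1t_eq hs, inv_rpow_eq hs]
  simp only [zone₁]
  ring

theorem G1sup_eq : p.G1sup r s = (s⁻¹ ^ p.κ) ^ 2 *
    p.nGs p.zone₁ s⁻¹ (s⁻¹ ^ p.κ / p.Hinf r s) := by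
  simp only [G1sup, nGs, H1sup_eq hs, inv_rpow_eq hs]
  simp only [zone₁]
  ring

theorem G1t_eq : p.G1t r s = (s⁻¹ ^ p.κ) ^ 2 * p.nGt p.zone₁ s⁻¹ (s⁻¹ ^ p.κ / p.Hinf r s)
    (p.Ht r s / p.Hinf r s) := by
  simp only [G1t, nGt, H1sup_eq hs, H1t_eq hs, Φ1t_eq hs, inv_rpow_eq hs]
  simp only [zone₁]
  ring

theorem ε₁_eq : p.ε₁ r s = 2 * (s ^ p.ν * p.Q * Real.exp (-s ^ 2) *
    (s⁻¹ ^ p.κ * p.nΦt p.zone₁ s⁻¹ (s⁻¹ ^ p.κ / p.Hinf r s) (p.Ht r s / p.Hinf r s)) +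
    p.D₁s * p.nX p.zone₁ s⁻¹ (s⁻¹ ^ p.κ / p.Hinf r s) (p.Ht r s / p.Hinf r s)
      (p.Hsup r s / p.Hinf r s)) := by
  simp only [ε₁, nX, G1sup_eq hs, G1t_eq hs, Φ1t_eq hs]
  ring

end liquid

section solid
include hr

theorem E2inf_eq : p.E2inf r s = p.nE p.zone₂ r⁻¹ (r⁻¹ ^ p.κ / p.Hinf r s) := by
  have hu := inv_pos.2 hr
  simp only [E2inf, nE, zone₂, inv_rpow_eq hr, Coeffs.rpow_θ_eq hu]
  congr 1
  generalize 2 * p.μ + p.ν - 1 = θ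
  ring

theorem E2t_eq : p.E2t r s = p.nEt p.zone₂ r⁻¹ (r⁻¹ ^ p.κ / p.Hinf r s)
    (p.Ht r s / p.Hinf r s) := by
  have hu := inv_pos.2 hr
  simp only [E2t, nEt, zone₂, inv_rpow_eq hr, Coeffs.rpow_θ_eq hu, Coeffs.rpow_θ'_eq hu]
  generalize 2 * p.μ + p.ν - 1 = θ
  ring

theorem Φ2t_eq : p.Φ2t r s = r⁻¹ ^ p.κ * p.nΦt p.zone₂ r⁻¹ (r⁻¹ ^ p.κ / p.Hinf r s)
    (p.Ht r s / p.Hinf r s) := by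
  have hu := inv_pos.2 hr
  simp only [Φ2t, nΦt, E2t_eq hr, inv_rpow_eq hr, Coeffs.rpow_θ_eq hu]
  simp only [zone₂]
  generalize 2 * p.μ + p.ν - 1 = θ
  ring

theorem H2sup_eq : p.H2sup r s = r⁻¹ ^ p.κ * p.nHs p.zone₂ r⁻¹ (r⁻¹ ^ p.κ / p.Hinf r s) := by
  simp only [H2sup, nHs, E2inf_eq hr, inv_rpow_eq hr]
  simp only [zone₂]
  ring

theorem H2t_eq : p.H2t r s = r⁻¹ ^ p.κ * p.nHt p.zone₂ r⁻¹ (r⁻¹ ^ p.κ / p.Hinf r s)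
    (p.Ht r s / p.Hinf r s) := by
  simp only [H2t, nHt, E2inf_eq hr, E2t_eq hr, inv_rpow_eq hr]
  simp only [zone₂]
  ring

theorem G2sup_eq : p.G2sup r s = (r⁻¹ ^ p.κ) ^ 2 *
    p.nGs p.zone₂ r⁻¹ (r⁻¹ ^ p.κ / p.Hinf r s) := by
  simp only [G2sup, nGs, H2sup_eq hr, inv_rpow_eq hr]
  simp only [zone₂]
  ring

theorem G2t_eq : p.G2t r s = (r⁻¹ ^ p.κ) ^ 2 * p.nGt p.zone₂ r⁻¹ (r⁻¹ ^ p.κ / p.Hinf r s)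
    (p.Ht r s / p.Hinf r s) := by
  simp only [G2t, nGt, H2sup_eq hr, H2t_eq hr, Φ2t_eq hr, inv_rpow_eq hr]
  simp only [zone₂]
  ring

theorem Φ2infTop_eq : p.Φ2infTop r s = p.nE p.zone₂ r⁻¹ (r⁻¹ ^ p.κ / p.Hinf r s) *
    (1 / p.L2M * (r⁻¹ ^ p.κ / p.κ)) := by
  simp only [Φ2infTop, E2inf_eq hr, inv_rpow_eq hr]
  ring

theorem ε22_eq : p.ε22 r s = p.nX p.zone₂ r⁻¹ (r⁻¹ ^ p.κ / p.Hinf r s)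
    (p.Ht r s / p.Hinf r s) (p.Hsup r s / p.Hinf r s) := by
  simp only [ε22, nX, G2sup_eq hr, G2t_eq hr]
  ring

end solid

end matching

/-- The Lipschitz constant of `V₂`, a little less than `ε₂`. -/
def q₂ (p : Contact) (r s : ℝ) : ℝ :=
  p.ε21 r s + p.D₂s * (2 * p.ε22 r s + p.G2sup r s / p.Hinf r s ^ 2 * p.ε21 r s)

section system

theorem D₁s_pos (hM : p.Model) : 0 < p.D₁s := by
  have := hM.standing.Uc_pos
  have h : 0 < p.D₁ := hM.C₁.pos.D
  simp only [D₁s]; positivity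

theorem D₂s_pos (hM : p.Model) : 0 < p.D₂s := by
  have := hM.standing.Uc_pos
  have h : 0 < p.D₂ := hM.C₂.pos.D
  simp only [D₂s]; positivity

variable (hM : p.Model) {r s : ℝ} (hs : 0 < s) (hsr : s < r)

include hs

theorem rightOf_Ioc : RightOf s (Ioc s r) := ⟨hs, measurableSet_Ioc, fun _ hv => hv.1⟩

include hsr

theorem rightOf_Ioi : RightOf r (Ioi r) := ⟨hs.trans hsr, measurableSet_Ioi, subset_rfl⟩

theorem Hinf_eq : p.Hinf r s = p.K1m / p.κ * (s⁻¹ ^ p.κ - r⁻¹ ^ p.κ) := by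
  rw [Hinf, inv_rpow_eq hs, inv_rpow_eq (hs.trans hsr)]

theorem Hsup_eq : p.Hsup r s = p.K1M * (s⁻¹ ^ p.κ / p.κ) + p.K2M * (r⁻¹ ^ p.κ / p.κ) := by
  rw [Hsup, Real.inv_rpow hs.le, Real.inv_rpow (hs.trans hsr).le]; ring

theorem Ht_eq : p.Ht r s = p.K1t * (s⁻¹ ^ p.κ / p.κ) + p.K2t * (r⁻¹ ^ p.κ / p.κ) := by
  rw [Ht, Real.inv_rpow hs.le, Real.inv_rpow (hs.trans hsr).le]; ring

include hM

theorem Hinf_pos : 0 < p.Hinf r s := by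
  rw [Hinf_eq hs hsr]
  have h : r⁻¹ ^ p.κ < s⁻¹ ^ p.κ :=
    Real.rpow_lt_rpow (inv_nonneg.2 (hs.trans hsr).le) ((inv_lt_inv₀ (hs.trans hsr) hs).2 hsr)
      hM.C₁.κ_pos
  exact mul_pos (div_pos hM.C₁.pos.Km hM.C₁.κ_pos) (sub_pos.2 h)

theorem Ht_pos : 0 < p.Ht r s := by
  rw [Ht_eq hs hsr]
  have h1 : 0 < p.K1t := hM.C₁.pos.Kt
  have h2 : 0 < p.K2t := hM.C₂.pos.Kt
  have h3 := hM.C₁.κ_pos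
  have h4 := inv_pos.2 (hs.trans hsr)
  have h5 := inv_pos.2 hs
  positivity

variable {f₁ f₂ g₁ g₂ : ℝ → ℝ} (hf₁ : Measurable f₁) (hf₂ : Measurable f₂)
  (hg₁ : Measurable g₁) (hg₂ : Measurable g₂)

include hf₁ in
-- Only the liquid part of `H` is bounded from below; the solid part is dropped as nonnegative.
theorem Hinf_le_tH : p.Hinf r s ≤ p.tH r s f₁ f₂ := by
  rw [Hinf_eq hs hsr, tH]
  have h1 := hM.C₁.integral_zk_Ioc_ge hs hsr.le hf₁
  have h2 : 0 ≤ ∫ v, p.zk (Ioi r) f₂ v :=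
    integral_nonneg (hM.C₂.zk_nonneg (rightOf_Ioi hs hsr))
  have h3 : p.zone₁.Km = p.K1m := rfl
  rw [h3] at h1
  linarith

theorem tH_le_Hsup : p.tH r s f₁ f₂ ≤ p.Hsup r s := by
  rw [Hsup_eq hs hsr, tH]
  exact add_le_add (hM.C₁.integral_zk_le (rightOf_Ioc hs))
    (hM.C₂.integral_zk_le (rightOf_Ioi hs hsr))

include hf₁ in
theorem good₁ : GoodTriple (p.tw₁ r s f₁ f₂) (p.zl (Ioc s r) f₁) (p.zk (Ioc s r) f₁) :=
  hM.C₁.goodTriple (rightOf_Ioc hs) hf₁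
    ((Hinf_pos hM hs hsr).trans_le (Hinf_le_tH hM hs hsr hf₁))

include hf₁ hf₂ in
theorem good₂ : GoodTriple (p.tw₂ r s f₁ f₂) (p.zl (Ioi r) f₂) (p.zk (Ioi r) f₂) :=
  hM.C₂.goodTriple (rightOf_Ioi hs hsr) hf₂
    ((Hinf_pos hM hs hsr).trans_le (Hinf_le_tH hM hs hsr hf₁))

include hf₁ in
theorem E1inf_le (η : ℝ) : p.E1inf r s ≤ expE (p.tw₁ r s f₁ f₂) η := by
  rw [E1inf_eq hs]
  exact hM.C₁.nE_le (rightOf_Ioc hs) hf₁ (Hinf_pos hM hs hsr) (Hinf_le_tH hM hs hsr hf₁) η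

include hf₁ hf₂ in
theorem E2inf_le (η : ℝ) : p.E2inf r s ≤ expE (p.tw₂ r s f₁ f₂) η := by
  rw [E2inf_eq (hs.trans hsr)]
  exact hM.C₂.nE_le (rightOf_Ioi hs hsr) hf₂ (Hinf_pos hM hs hsr) (Hinf_le_tH hM hs hsr hf₁) η

include hf₁ hf₂ in
theorem Φ2infTop_le : p.Φ2infTop r s ≤ ∫ v, p.tφ₂ r s f₁ f₂ v := by
  have h := hM.C₂.integral_zl_Ioi_ge (hs.trans hsr) hf₂
  have h3 : p.zone₂.LM = p.L2M := rfl
  rw [Φ2infTop_eq (hs.trans hsr), ← E2inf_eq (hs.trans hsr)]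
  refine le_trans ?_ ((good₂ hM hs hsr hf₁ hf₂).le_integral_phiF (E2inf_le hM hs hsr hf₁ hf₂))
  rw [h3] at h
  exact mul_le_mul_of_nonneg_left h (Real.exp_pos _).le

theorem Φ2infTop_pos : 0 < p.Φ2infTop r s := by
  rw [Φ2infTop_eq (hs.trans hsr)]
  have h2 : 0 < p.L2M := hM.C₂.pos.LM
  have h3 := hM.C₁.κ_pos
  have h4 := inv_pos.2 (hs.trans hsr)
  exact mul_pos (Coeffs.nE_pos _ _) (by positivity)

variable {d : ℝ} (hd0 : 0 ≤ d) (hd₁ : ∀ v ∈ Ioc s r, |f₁ v - g₁ v| ≤ d)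
  (hd₂ : ∀ v ∈ Ioi r, |f₂ v - g₂ v| ≤ d)
include hd0 hd₁ hd₂ hf₁ hf₂ hg₁ hg₂

theorem abs_tH_sub_le : |p.tH r s f₁ f₂ - p.tH r s g₁ g₂| ≤ p.Ht r s * d := by
  have T₁ := good₁ hM hs hsr hf₁ (f₂ := f₂)
  have T₂ := good₂ hM hs hsr hf₁ hf₂
  have T₁' := good₁ hM hs hsr hg₁ (f₂ := g₂)
  have T₂' := good₂ hM hs hsr hg₁ hg₂
  have a1 := (abs_integral_sub_le T₁.k_int T₁'.k_int).trans
    (hM.C₁.integral_abs_zk_sub_le (rightOf_Ioc hs) hd₁ hd0)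
  have a2 := (abs_integral_sub_le T₂.k_int T₂'.k_int).trans
    (hM.C₂.integral_abs_zk_sub_le (rightOf_Ioi hs hsr) hd₂ hd0)
  rw [tH, tH, add_sub_add_comm, Ht_eq hs hsr]
  refine (abs_add_le _ _).trans ((add_le_add a1 a2).trans_eq ?_)
  simp only [zone₁, zone₂]
  ring

/-- `V₁` is Lipschitz with constant `ε₁ / 2`. -/
theorem abs_tV₁_sub_le (η : ℝ) :
    |p.tV₁ r s f₁ f₂ η - p.tV₁ r s g₁ g₂ η| ≤ d * (p.ε₁ r s / 2) := by
  have T := good₁ hM hs hsr hf₁ (f₂ := f₂)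
  have T' := good₁ hM hs hsr hg₁ (f₂ := g₂)
  have hS := rightOf_Ioc (r := r) hs
  have hi := Hinf_pos hM hs hsr
  have h1 := Hinf_le_tH hM hs hsr hf₁ (f₂ := f₂)
  have h2 := Hinf_le_tH hM hs hsr hg₁ (f₂ := g₂)
  have h3 := abs_tH_sub_le hM hs hsr hf₁ hf₂ hg₁ hg₂ hd0 hd₁ hd₂
  have hht := (Ht_pos hM hs hsr).le
  -- `Φ₁(r) - Φ₁(η)` is one tail integral, and so is the difference for `G₁`. Estimating each tail
  -- at once gives half of `ε₁`.
  have b1 := (abs_tail_sub_le T.phiF_int T'.phiF_int η).trans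
    (hM.C₁.integral_abs_phiF_sub_le hS hf₁ hg₁ hd₁ hd0 hi h1 h2 h3 hht)
  have b2 := (abs_tail_sub_le T.gF_int T'.gF_int η).trans
    (hM.C₁.integral_abs_gF_sub_le hS hf₁ hg₁ hd₁ hd0 hi h1 h2 h3 hht)
  have b3 : 0 ≤ (∫ v, p.tg₁ r s g₁ g₂ v) - prim (p.tg₁ r s g₁ g₂) η :=
    sub_nonneg.2 (prim_le_integral T'.gF_int T'.gF_nonneg η)
  have b4 : (∫ v, p.tg₁ r s g₁ g₂ v) - prim (p.tg₁ r s g₁ g₂) η ≤ _ :=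
    (sub_le_self _ (prim_nonneg T'.gF_nonneg η)).trans (hM.C₁.integral_gF_le hS hg₁ hi h2)
  have b5 := abs_div_sq_sub_le hi h1 h2 (tH_le_Hsup hM hs hsr) (tH_le_Hsup hM hs hsr) h3 b3 b4 b2
  have hc : 0 ≤ s ^ p.ν * p.Q * Real.exp (-s ^ 2) := by
    have := hM.standing.Q_pos
    positivity
  have hD := D₁s_pos hM
  have e : p.tV₁ r s f₁ f₂ η - p.tV₁ r s g₁ g₂ η =
      s ^ p.ν * p.Q * Real.exp (-s ^ 2) *
        (((∫ v, p.tφ₁ r s f₁ f₂ v) - prim (p.tφ₁ r s f₁ f₂) η) -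
          ((∫ v, p.tφ₁ r s g₁ g₂ v) - prim (p.tφ₁ r s g₁ g₂) η)) +
      p.D₁s * (((∫ v, p.tg₁ r s f₁ f₂ v) - prim (p.tg₁ r s f₁ f₂) η) / p.tH r s f₁ f₂ ^ 2 -
        ((∫ v, p.tg₁ r s g₁ g₂ v) - prim (p.tg₁ r s g₁ g₂) η) / p.tH r s g₁ g₂ ^ 2) := by
    simp only [tV₁]; ring
  rw [e]
  refine (abs_add_le _ _).trans ?_
  rw [abs_mul (s ^ p.ν * p.Q * _), abs_mul p.D₁s, abs_of_nonneg hc, abs_of_pos hD]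
  refine (add_le_add (mul_le_mul_of_nonneg_left b1 hc)
    (mul_le_mul_of_nonneg_left b5 hD.le)).trans_eq ?_
  rw [ε₁_eq hs, nX]
  field_simp

/-- With `x = Φ₂ / Φ₂(∞)`, `y = G₂(∞) / H²` and `z = G₂ / H²`, the operator is `D₂* (x y - z) - x`.
Using `0 ≤ x ≤ 1` in the product gives `q₂`, with the factor `1` where `ε₂` has `Φ_2sup / Φ_2inf`.
-/
theorem abs_tV₂_sub_le (η : ℝ) :
    |p.tV₂ r s f₁ f₂ η - p.tV₂ r s g₁ g₂ η| ≤ d * p.q₂ r s := by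
  have hr := hs.trans hsr
  have T := good₂ hM hs hsr hf₁ hf₂
  have T' := good₂ hM hs hsr hg₁ hg₂
  have hS := rightOf_Ioi hs hsr
  have hi := Hinf_pos hM hs hsr
  have h1 := Hinf_le_tH hM hs hsr hf₁ (f₂ := f₂)
  have h2 := Hinf_le_tH hM hs hsr hg₁ (f₂ := g₂)
  have h3 := abs_tH_sub_le hM hs hsr hf₁ hf₂ hg₁ hg₂ hd0 hd₁ hd₂
  have hht := (Ht_pos hM hs hsr).le
  have a1 : ∫ v, |p.tφ₂ r s f₁ f₂ v - p.tφ₂ r s g₁ g₂ v| ≤ d * p.Φ2t r s := by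
    rw [Φ2t_eq hr]
    exact hM.C₂.integral_abs_phiF_sub_le hS hf₂ hg₂ hd₂ hd0 hi h1 h2 h3 hht
  have a2 : ∫ v, |p.tg₂ r s f₁ f₂ v - p.tg₂ r s g₁ g₂ v| ≤ d * p.G2t r s := by
    rw [G2t_eq hr]
    exact hM.C₂.integral_abs_gF_sub_le hS hf₂ hg₂ hd₂ hd0 hi h1 h2 h3 hht
  have a3 : ∫ v, p.tg₂ r s g₁ g₂ v ≤ p.G2sup r s := by
    rw [G2sup_eq hr]
    exact hM.C₂.integral_gF_le hS hg₂ hi h2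
  have hΦ := Φ2infTop_pos hM hs hsr
  have c1 := Φ2infTop_le hM hs hsr hf₁ hf₂
  have c2 := Φ2infTop_le hM hs hsr hg₁ hg₂
  have hq : ∀ η, |prim (p.tg₂ r s f₁ f₂) η / p.tH r s f₁ f₂ ^ 2 -
      prim (p.tg₂ r s g₁ g₂) η / p.tH r s g₁ g₂ ^ 2| ≤ d * p.ε22 r s := fun η => by
    refine (abs_div_sq_sub_le hi h1 h2 (tH_le_Hsup hM hs hsr) (tH_le_Hsup hM hs hsr) h3
      (prim_nonneg T'.gF_nonneg η) ((prim_le_integral T'.gF_int T'.gF_nonneg η).trans a3)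
      ((abs_prim_sub_le T.gF_int T'.gF_int η).trans a2))
  have hqT : |(∫ v, p.tg₂ r s f₁ f₂ v) / p.tH r s f₁ f₂ ^ 2 -
      (∫ v, p.tg₂ r s g₁ g₂ v) / p.tH r s g₁ g₂ ^ 2| ≤ d * p.ε22 r s :=
    abs_div_sq_sub_le hi h1 h2 (tH_le_Hsup hM hs hsr) (tH_le_Hsup hM hs hsr) h3
      (integral_nonneg T'.gF_nonneg) a3 ((abs_integral_sub_le T.gF_int T'.gF_int).trans a2)
  have hx : |prim (p.tφ₂ r s f₁ f₂) η / (∫ v, p.tφ₂ r s f₁ f₂ v) -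
      prim (p.tφ₂ r s g₁ g₂) η / ∫ v, p.tφ₂ r s g₁ g₂ v| ≤ d * p.ε21 r s := by
    have b1 := (abs_prim_sub_le T.phiF_int T'.phiF_int η).trans a1
    have b2 := (abs_integral_sub_le T.phiF_int T'.phiF_int).trans a1
    have b3 := prim_le_integral T'.phiF_int T'.phiF_nonneg η
    have b4 := prim_nonneg T'.phiF_nonneg η
    change |prim (p.tφ₂ r s f₁ f₂) η - prim (p.tφ₂ r s g₁ g₂) η| ≤ _ at b1
    change |(∫ v, p.tφ₂ r s f₁ f₂ v) - ∫ v, p.tφ₂ r s g₁ g₂ v| ≤ _ at b2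
    change prim (p.tφ₂ r s g₁ g₂) η ≤ ∫ v, p.tφ₂ r s g₁ g₂ v at b3
    change 0 ≤ prim (p.tφ₂ r s g₁ g₂) η at b4
    generalize prim (p.tφ₂ r s f₁ f₂) η = x at *
    generalize prim (p.tφ₂ r s g₁ g₂) η = x' at *
    generalize (∫ v, p.tφ₂ r s f₁ f₂ v) = y at *
    generalize (∫ v, p.tφ₂ r s g₁ g₂ v) = y' at *
    have hy := hΦ.trans_le c1
    have hy' := hΦ.trans_le c2
    -- The ratio `x' / y'` is at most `1`. Numerator and denominator therefore contribute equally,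
    -- which is the factor `2` in `ε21`.
    have e : x / y - x' / y' = (x - x') / y + x' / y' * ((y' - y) / y) := by
      field_simp; ring
    have k : 0 ≤ x' / y' ∧ x' / y' ≤ 1 := ⟨div_nonneg b4 hy'.le, (div_le_one hy').2 b3⟩
    rw [e]
    refine (abs_add_le _ _).trans ?_
    rw [abs_mul, abs_div (x - x'), abs_div (y' - y), abs_of_pos hy, abs_of_nonneg k.1,
      abs_sub_comm y']
    calc _ ≤ |x - x'| / y + 1 * (|y - y'| / y) := by
          gcongr
          exact k.2
      _ ≤ d * p.Φ2t r s / p.Φ2infTop r s + 1 * (d * p.Φ2t r s / p.Φ2infTop r s) := by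
          have := (abs_nonneg _).trans b1
          gcongr
      _ = _ := by rw [ε21]; ring
  have hX01 : 0 ≤ prim (p.tφ₂ r s f₁ f₂) η / (∫ v, p.tφ₂ r s f₁ f₂ v) ∧
      prim (p.tφ₂ r s f₁ f₂) η / (∫ v, p.tφ₂ r s f₁ f₂ v) ≤ 1 :=
    ⟨div_nonneg (prim_nonneg T.phiF_nonneg η) (hΦ.le.trans c1),
      (div_le_one (hΦ.trans_le c1)).2 (prim_le_integral T.phiF_int T.phiF_nonneg η)⟩
  have hY : 0 ≤ (∫ v, p.tg₂ r s g₁ g₂ v) / p.tH r s g₁ g₂ ^ 2 ∧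
      (∫ v, p.tg₂ r s g₁ g₂ v) / p.tH r s g₁ g₂ ^ 2 ≤ p.G2sup r s / p.Hinf r s ^ 2 := by
    have n : 0 ≤ ∫ v, p.tg₂ r s g₁ g₂ v := integral_nonneg T'.gF_nonneg
    exact ⟨by positivity, by gcongr; exact n.trans a3⟩
  have hxy := abs_mul_sub_mul_le (y := (∫ v, p.tg₂ r s f₁ f₂ v) / p.tH r s f₁ f₂ ^ 2)
    (x' := prim (p.tφ₂ r s g₁ g₂) η / ∫ v, p.tφ₂ r s g₁ g₂ v) hX01.1 hX01.2 hY.1 hY.2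
  have hD := D₂s_pos hM
  have hGs : 0 ≤ p.G2sup r s / p.Hinf r s ^ 2 := hY.1.trans hY.2
  have hqη := hq η
  generalize hx1 : prim (p.tφ₂ r s f₁ f₂) η / (∫ v, p.tφ₂ r s f₁ f₂ v) = x1 at *
  generalize hx2 : prim (p.tφ₂ r s g₁ g₂) η / (∫ v, p.tφ₂ r s g₁ g₂ v) = x2 at *
  generalize hy1 : (∫ v, p.tg₂ r s f₁ f₂ v) / p.tH r s f₁ f₂ ^ 2 = y1 at *
  generalize hy2 : (∫ v, p.tg₂ r s g₁ g₂ v) / p.tH r s g₁ g₂ ^ 2 = y2 at *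
  generalize hz1 : prim (p.tg₂ r s f₁ f₂) η / p.tH r s f₁ f₂ ^ 2 = z1 at *
  generalize hz2 : prim (p.tg₂ r s g₁ g₂) η / p.tH r s g₁ g₂ ^ 2 = z2 at *
  have e : p.tV₂ r s f₁ f₂ η - p.tV₂ r s g₁ g₂ η =
      p.D₂s * (x1 * y1 - x2 * y2) - (x1 - x2) - p.D₂s * (z1 - z2) := by
    rw [tV₂, tV₂, hx1, hx2, ← hy1, ← hy2, ← hz1, ← hz2]; ring
  rw [e]
  have t1 := abs_sub (p.D₂s * (x1 * y1 - x2 * y2) - (x1 - x2)) (p.D₂s * (z1 - z2))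
  have t2 := abs_sub (p.D₂s * (x1 * y1 - x2 * y2)) (x1 - x2)
  rw [abs_mul, abs_of_pos hD] at t1 t2
  calc _ ≤ p.D₂s * (d * p.ε22 r s + p.G2sup r s / p.Hinf r s ^ 2 * (d * p.ε21 r s)) +
        d * p.ε21 r s + p.D₂s * (d * p.ε22 r s) := by
        have u1 : p.D₂s * |x1 * y1 - x2 * y2| ≤ p.D₂s * (d * p.ε22 r s +
            p.G2sup r s / p.Hinf r s ^ 2 * (d * p.ε21 r s)) := by
          gcongr
          exact hxy.trans (add_le_add hqT (by gcongr))
        have u2 : p.D₂s * |z1 - z2| ≤ p.D₂s * (d * p.ε22 r s) := by gcongr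
        linarith
    _ = _ := by rw [q₂]; ring

end system

end Contact

end

/-! ### Positivity, continuity and monotonicity of the normalised bounds. -/

noncomputable section

namespace Contact

variable {p : Contact} {z : Zone}

namespace Coeffs

variable (C : p.Coeffs z) {u u' i i' τ τ' σ σ' : ℝ}
include C

section positivity

theorem nEt_nonneg (hu : 0 ≤ u) (hi : 0 ≤ i) (hτ : 0 ≤ τ) : 0 ≤ p.nEt z u i τ := by
  obtain ⟨e1, e2, e3, e4, e5, e6, e7, e8⟩ := C.exponents_pos
  obtain ⟨_, _, _, _, _, _, _, _, _⟩ := C.pos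
  have := C.a_pos
  unfold nEt; positivity

theorem nΦt_nonneg (hu : 0 ≤ u) (hi : 0 ≤ i) (hτ : 0 ≤ τ) : 0 ≤ p.nΦt z u i τ := by
  obtain ⟨e1, e2, e3, e4, e5, e6, e7, e8⟩ := C.exponents_pos
  obtain ⟨_, _, _, _, _, _, _, _, _⟩ := C.pos
  have := C.nEt_nonneg hu hi hτ
  unfold nΦt; positivity

theorem nHs_pos : 0 < p.nHs z u i := by
  have := C.κ_pos
  have := C.pos.KM
  have := nE_pos (p := p) (z := z) u i
  unfold nHs; positivity

theorem nHt_pos (hu : 0 ≤ u) (hi : 0 ≤ i) (hτ : 0 ≤ τ) : 0 < p.nHt z u i τ := by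
  have := C.κ_pos
  have := C.pos.KM
  have := C.pos.Kt
  have := nE_pos (p := p) (z := z) u i
  have := C.nEt_nonneg hu hi hτ
  unfold nHt; positivity

theorem nGs_pos : 0 < p.nGs z u i := by
  have := C.κ_pos
  have := C.pos.Lm
  have := C.nHs_pos (u := u) (i := i)
  unfold nGs; positivity

theorem nGt_pos (hu : 0 ≤ u) (hi : 0 ≤ i) (hτ : 0 ≤ τ) : 0 < p.nGt z u i τ := by
  have := C.κ_pos
  have := C.pos.Lm
  have := C.nHs_pos (u := u) (i := i)
  have := C.nHt_pos hu hi hτ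
  have := C.nΦt_nonneg hu hi hτ
  unfold nGt; positivity

theorem nX_pos (hu : 0 ≤ u) (hi : 0 < i) (hτ : 0 ≤ τ) (hσ : 0 ≤ σ) : 0 < p.nX z u i τ σ := by
  have := C.nGs_pos (u := u) (i := i)
  have := C.nGt_pos hu hi.le hτ
  unfold nX; positivity

end positivity

section continuity

variable {ι : Type*} {F : Filter ι} {U I T R : ι → ℝ} (hU : Tendsto U F (𝓝 u))
  (hI : Tendsto I F (𝓝 i)) (hT : Tendsto T F (𝓝 τ)) (hS : Tendsto R F (𝓝 σ))
include hU hI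

theorem tendsto_nE : Tendsto (fun x => p.nE z (U x) (I x)) F (𝓝 (p.nE z u i)) := by
  obtain ⟨e1, e2, e3, e4, e5, e6, e7, e8⟩ := C.exponents_pos
  have h1 := hU.rpow_const (p := 2 * p.μ - 2) (Or.inr e5.le)
  have h2 := hU.rpow_const (p := p.μ) (Or.inr e2.le)
  exact (Real.continuous_exp.tendsto _).comp
    (((h1.const_mul _).add ((hI.const_mul _).mul h2)).neg)

theorem tendsto_nHs : Tendsto (fun x => p.nHs z (U x) (I x)) F (𝓝 (p.nHs z u i)) :=
  tendsto_const_nhds.div ((C.tendsto_nE hU hI).const_mul _)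
    (mul_pos C.κ_pos (nE_pos _ _)).ne'

theorem tendsto_nGs : Tendsto (fun x => p.nGs z (U x) (I x)) F (𝓝 (p.nGs z u i)) :=
  (C.tendsto_nHs hU hI).div_const _

include hT

theorem tendsto_nEt : Tendsto (fun x => p.nEt z (U x) (I x) (T x)) F (𝓝 (p.nEt z u i τ)) := by
  obtain ⟨e1, e2, e3, e4, e5, e6, e7, e8⟩ := C.exponents_pos
  have h1 := hU.rpow_const (p := p.μ - 2) (Or.inr e4.le)
  have h2 := hU.rpow_const (p := 3 * p.μ - 2) (Or.inr e6.le)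
  have h3 := hU.rpow_const (p := p.μ) (Or.inr e2.le)
  have h4 := hU.rpow_const (p := 2 * p.μ) (Or.inr (by positivity))
  exact (((h1.const_mul _).add (h2.const_mul _)).const_mul _).add ((hI.const_mul _).mul
    ((h3.const_mul _).add ((((hT.div_const _).mul h3).add (h4.const_mul _)).const_mul _)))

theorem tendsto_nΦt : Tendsto (fun x => p.nΦt z (U x) (I x) (T x)) F (𝓝 (p.nΦt z u i τ)) := by
  obtain ⟨e1, e2, e3, e4, e5, e6, e7, e8⟩ := C.exponents_pos
  exact ((C.tendsto_nEt hU hI hT).div_const _).add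
    ((hU.rpow_const (p := p.μ) (Or.inr e2.le)).const_mul _)

theorem tendsto_nGt : Tendsto (fun x => p.nGt z (U x) (I x) (T x)) F (𝓝 (p.nGt z u i τ)) := by
  have hE := C.tendsto_nE hU hI
  have hne := (nE_pos (p := p) (z := z) u i).ne'
  have hH : Tendsto (fun x => p.nHt z (U x) (I x) (T x)) F (𝓝 (p.nHt z u i τ)) :=
    (tendsto_const_nhds.add (((C.tendsto_nEt hU hI hT).const_mul _).div hE hne)).div
      (hE.const_mul _) (mul_pos C.κ_pos (nE_pos _ _)).ne'
  exact ((C.tendsto_nHs hU hI).mul (C.tendsto_nΦt hU hI hT)).add (hH.div_const _)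

include hS in
theorem tendsto_nX :
    Tendsto (fun x => p.nX z (U x) (I x) (T x) (R x)) F (𝓝 (p.nX z u i τ σ)) :=
  (hI.pow 2).mul ((C.tendsto_nGt hU hI hT).add
    ((((C.tendsto_nGs hU hI).const_mul 2).mul hS).mul hT))

end continuity

section monotonicity

variable (hu : 0 ≤ u) (huu : u ≤ u') (hi : 0 ≤ i) (hii : i ≤ i')
include hu huu hi hii

theorem nE_anti : p.nE z u' i' ≤ p.nE z u i := by
  obtain ⟨e1, e2, e3, e4, e5, e6, e7, e8⟩ := C.exponents_pos
  obtain ⟨_, _, _, _, _, _, _, _, _⟩ := C.pos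
  have := C.a_pos
  have := hi.trans hii
  unfold nE; gcongr

theorem nHs_mono : p.nHs z u i ≤ p.nHs z u' i' := by
  have := C.κ_pos
  have := C.pos.KM
  have := nE_pos (p := p) (z := z) u' i'
  have h := C.nE_anti hu huu hi hii
  unfold nHs; gcongr

theorem nGs_mono : p.nGs z u i ≤ p.nGs z u' i' := by
  have := C.κ_pos
  have := C.pos.Lm
  have := C.nHs_mono hu huu hi hii
  unfold nGs; gcongr

variable (hτ : 0 ≤ τ) (hττ : τ ≤ τ')
include hτ hττ

theorem nEt_mono : p.nEt z u i τ ≤ p.nEt z u' i' τ' := by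
  obtain ⟨e1, e2, e3, e4, e5, e6, e7, e8⟩ := C.exponents_pos
  obtain ⟨_, _, _, _, _, _, _, _, _⟩ := C.pos
  have := C.a_pos
  have := hi.trans hii
  have := hτ.trans hττ
  unfold nEt
  gcongr

theorem nΦt_mono : p.nΦt z u i τ ≤ p.nΦt z u' i' τ' := by
  obtain ⟨e1, e2, e3, e4, e5, e6, e7, e8⟩ := C.exponents_pos
  obtain ⟨_, _, _, _, _, _, _, _, _⟩ := C.pos
  have := C.nEt_mono hu huu hi hii hτ hττ
  unfold nΦt
  gcongr

theorem nGt_mono : p.nGt z u i τ ≤ p.nGt z u' i' τ' := by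
  obtain ⟨_, _, _, _, _, _, _, _, _⟩ := C.pos
  have := C.κ_pos
  have hE := C.nE_anti hu huu hi hii
  have := nE_pos (p := p) (z := z) u i
  have := nE_pos (p := p) (z := z) u' i'
  have h1 := C.nEt_mono hu huu hi hii hτ hττ
  have := C.nEt_nonneg hu hi hτ
  have h3 := h1.trans' this
  have := C.nΦt_nonneg hu hi hτ
  have := (C.nHs_pos (u := u) (i := i)).le
  have hH : p.nHt z u i τ ≤ p.nHt z u' i' τ' := by
    unfold nHt; gcongr
  have h4 := C.nΦt_mono hu huu hi hii hτ hττ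
  have h5 := C.nHs_mono hu huu hi hii
  have := h5.trans' this
  unfold nGt
  gcongr

variable (hσ : 0 ≤ σ) (hσσ : σ ≤ σ')
include hσ hσσ

theorem nX_inner_mono : p.nGt z u i τ + 2 * p.nGs z u i * σ * τ ≤
    p.nGt z u' i' τ' + 2 * p.nGs z u' i' * σ' * τ' := by
  have h1 := C.nGt_mono hu huu hi hii hτ hττ
  have h2 := C.nGs_mono hu huu hi hii
  have h3 := C.nGs_pos (u := u) (i := i)
  have h4 := C.nGs_pos (u := u') (i := i')
  have := hσ.trans hσσ
  gcongr

theorem nX_mono : p.nX z u i τ σ ≤ p.nX z u' i' τ' σ' := by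
  have h1 := C.nX_inner_mono hu huu hi hii hτ hττ hσ hσσ
  have h2 := C.nGt_pos hu hi hτ
  have h3 := C.nGs_pos (u := u) (i := i)
  have h4 : 0 ≤ p.nGt z u i τ + 2 * p.nGs z u i * σ * τ := by positivity
  unfold nX
  gcongr

omit hii in
-- Strictness comes from the factor `i ^ 2` alone; the other factor is positive and weakly
-- increasing.
theorem nX_lt (hii : i < i') : p.nX z u i τ σ < p.nX z u' i' τ' σ' := by
  have h1 := C.nX_inner_mono hu huu hi hii.le hτ hττ hσ hσσ
  have h2 := C.nGt_pos hu hi hτ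
  have h3 := C.nGs_pos (u := u) (i := i)
  have h4 : 0 < p.nGt z u i τ + 2 * p.nGs z u i * σ * τ := by positivity
  unfold nX
  calc _ < i' ^ 2 * (p.nGt z u i τ + 2 * p.nGs z u i * σ * τ) := by gcongr
    _ ≤ _ := by gcongr

end monotonicity

end Coeffs

end Contact

end

/-! ### The bounds as functions of an inverse length and of `(s / r) ^ κ`. -/

noncomputable section

namespace Contact

variable (p : Contact)

/-- The parameter `(s/r)^κ` of a pair `0 < s < r`. -/
def rho (r s : ℝ) : ℝ := (s / r) ^ p.κ

/-- `s^{-κ} / H_inf` as a function of `(s/r)^κ`. -/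
def rI (ρ : ℝ) : ℝ := p.κ / (p.K1m * (1 - ρ))

/-- `H̃ / H_inf` as a function of `(s/r)^κ`. -/
def rT (ρ : ℝ) : ℝ := (p.K1t + p.K2t * ρ) / (p.K1m * (1 - ρ))

/-- `H_sup / H_inf` as a function of `(s/r)^κ`. -/
def rS (ρ : ℝ) : ℝ := (p.K1M + p.K2M * ρ) / (p.K1m * (1 - ρ))

/-- The coefficient of `Φ̃₁` in the normalised `ε₁ / 2`. -/
def cQ (s : ℝ) : ℝ := p.Q * Real.exp (-s ^ 2) * s⁻¹ ^ (p.μ - 1)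

/-- `ε₁` in the normalised variables. -/
def P₁ (u c ρ : ℝ) : ℝ := 2 * (c * p.nΦt p.zone₁ u (p.rI ρ) (p.rT ρ) +
  p.D₁s * p.nX p.zone₁ u (p.rI ρ) (p.rT ρ) (p.rS ρ))

/-- `ε₂₁` in the normalised variables. -/
def P₂₁ (u ρ : ℝ) : ℝ :=
  2 * p.nΦt p.zone₂ u (ρ * p.rI ρ) (p.rT ρ) * (p.L2M * p.κ) / p.nE p.zone₂ u (ρ * p.rI ρ)

/-- `ε₂₂` in the normalised variables. -/
def P₂₂ (u ρ : ℝ) : ℝ := p.nX p.zone₂ u (ρ * p.rI ρ) (p.rT ρ) (p.rS ρ)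

/-- `G_{2sup} / H_inf²` in the normalised variables. -/
def P₂₃ (u ρ : ℝ) : ℝ := (ρ * p.rI ρ) ^ 2 * p.nGs p.zone₂ u (ρ * p.rI ρ)

/-- `ε₂` in the normalised variables. -/
def P₂ (u ρ : ℝ) : ℝ := p.P₂₁ u ρ + p.D₂s * (p.P₂₂ u ρ +
  (p.L2M / (p.L2m * p.nE p.zone₂ u (ρ * p.rI ρ)) * p.P₂₂ u ρ + p.P₂₃ u ρ * p.P₂₁ u ρ))

/-- `Z_inf` in the normalised variables. -/
def PZ (u ρ : ℝ) : ℝ := p.D₁s * p.nE p.zone₁ u (p.rI ρ) * p.K1m / (2 * p.L1M) *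
  ((1 - ρ) / (p.K1M + p.K2M * ρ)) ^ 2

variable {p}

section ratios

variable (hM : p.Model) {r s : ℝ} (hs : 0 < s) (hsr : s < r)
include hM hs hsr

theorem rho_pos : 0 < p.rho r s := Real.rpow_pos_of_pos (div_pos hs (hs.trans hsr)) _

theorem rho_lt_one : p.rho r s < 1 :=
  Real.rpow_lt_one (div_nonneg hs.le (hs.trans hsr).le) ((div_lt_one (hs.trans hsr)).2 hsr)
    hM.C₁.κ_pos

theorem inv_rpow_κ_eq : r⁻¹ ^ p.κ = p.rho r s * s⁻¹ ^ p.κ := by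
  have hr := hs.trans hsr
  rw [rho, ← Real.mul_rpow (div_nonneg hs.le hr.le) (inv_nonneg.2 hs.le)]
  congr 1
  field_simp

/-- `H_inf` is `s^{-κ} (1 - ρ)` up to a constant, so after division the dependence on `(r, s)` is
through `ρ` only. This makes monotonicity in `r` visible. -/
theorem ratio_i : s⁻¹ ^ p.κ / p.Hinf r s = p.rI (p.rho r s) := by
  have h1 := rho_lt_one hM hs hsr
  have h2 : 0 < p.K1m := hM.C₁.pos.Km
  have h3 := hM.C₁.κ_pos
  have h4 : 0 < s⁻¹ ^ p.κ := Real.rpow_pos_of_pos (inv_pos.2 hs) _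
  have h5 : 0 < 1 - p.rho r s := by linarith
  rw [Hinf_eq hs hsr, inv_rpow_κ_eq hM hs hsr, rI, ← one_sub_mul]
  generalize s⁻¹ ^ p.κ = U at *
  generalize 1 - p.rho r s = t at *
  field_simp

theorem ratio_i' : r⁻¹ ^ p.κ / p.Hinf r s = p.rho r s * p.rI (p.rho r s) := by
  rw [inv_rpow_κ_eq hM hs hsr, mul_div_assoc, ratio_i hM hs hsr]

theorem ratio_τ : p.Ht r s / p.Hinf r s = p.rT (p.rho r s) := by
  have h3 := hM.C₁.κ_pos
  have h := ratio_i hM hs hsr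
  have h4 : p.Ht r s / p.Hinf r s =
      (p.K1t + p.K2t * p.rho r s) / p.κ * (s⁻¹ ^ p.κ / p.Hinf r s) := by
    rw [Ht_eq hs hsr, inv_rpow_κ_eq hM hs hsr]; ring
  rw [h4, h, rI, rT]
  field_simp

theorem ratio_σ : p.Hsup r s / p.Hinf r s = p.rS (p.rho r s) := by
  have h3 := hM.C₁.κ_pos
  have h := ratio_i hM hs hsr
  have h4 : p.Hsup r s / p.Hinf r s =
      (p.K1M + p.K2M * p.rho r s) / p.κ * (s⁻¹ ^ p.κ / p.Hinf r s) := by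
    rw [Hsup_eq hs hsr, inv_rpow_κ_eq hM hs hsr]; ring
  rw [h4, h, rI, rS]
  field_simp

/-- The prefactor `s ^ ν` combines with `s^{-κ}` into `s^{-(μ - 1)}`. The coefficient `cQ` is
therefore decreasing in `s`, although `s ^ ν` is not. -/
theorem ε₁_eq_P₁ : p.ε₁ r s = p.P₁ s⁻¹ (p.cQ s) (p.rho r s) := by
  have h : p.cQ s = s ^ p.ν * p.Q * Real.exp (-s ^ 2) * s⁻¹ ^ p.κ := by
    have e : s⁻¹ ^ (p.μ - 1) = s ^ p.ν * s⁻¹ ^ p.κ := by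
      rw [show s ^ p.ν = s⁻¹ ^ (-p.ν) by rw [Real.inv_rpow hs.le, Real.rpow_neg hs.le, inv_inv],
        ← Real.rpow_add (inv_pos.2 hs), κ]
      ring_nf
    rw [cQ, e]; ring
  rw [ε₁_eq hs, P₁, ratio_i hM hs hsr, ratio_τ hM hs hsr, ratio_σ hM hs hsr, h]
  ring

theorem ε21_eq_P₂₁ : p.ε21 r s = p.P₂₁ r⁻¹ (p.rho r s) := by
  have hr := hs.trans hsr
  have h2 : 0 < p.L2M := hM.C₂.pos.LM
  have h3 := hM.C₁.κ_pos
  have h4 : 0 < r⁻¹ ^ p.κ := Real.rpow_pos_of_pos (inv_pos.2 hr) _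
  rw [ε21, Φ2t_eq hr, Φ2infTop_eq hr, ratio_i' hM hs hsr, ratio_τ hM hs hsr, P₂₁]
  have h5 := Coeffs.nE_pos (p := p) (z := p.zone₂) r⁻¹ (p.rho r s * p.rI (p.rho r s))
  generalize p.nE p.zone₂ r⁻¹ (p.rho r s * p.rI (p.rho r s)) = e at *
  generalize p.nΦt p.zone₂ r⁻¹ (p.rho r s * p.rI (p.rho r s)) (p.rT (p.rho r s)) = f
  generalize r⁻¹ ^ p.κ = U at *
  field_simp

theorem ε22_eq_P₂₂ : p.ε22 r s = p.P₂₂ r⁻¹ (p.rho r s) := by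
  rw [ε22_eq (hs.trans hsr), ratio_i' hM hs hsr, ratio_τ hM hs hsr, ratio_σ hM hs hsr, P₂₂]

theorem G2sup_div_eq : p.G2sup r s / p.Hinf r s ^ 2 = p.P₂₃ r⁻¹ (p.rho r s) := by
  rw [G2sup_eq (hs.trans hsr), mul_div_right_comm, ← div_pow, ratio_i' hM hs hsr, P₂₃]

theorem Φ2sup_div_eq : p.Φ2sup r / p.Φ2infTop r s =
    p.L2M / (p.L2m * p.nE p.zone₂ r⁻¹ (p.rho r s * p.rI (p.rho r s))) := by
  have hr := hs.trans hsr
  have h2 : 0 < p.L2M := hM.C₂.pos.LM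
  have h2' : 0 < p.L2m := hM.C₂.pos.Lm
  have h3 := hM.C₁.κ_pos
  have h4 : 0 < r⁻¹ ^ p.κ := Real.rpow_pos_of_pos (inv_pos.2 hr) _
  rw [Φ2infTop_eq hr, ratio_i' hM hs hsr, Φ2sup, inv_rpow_eq hr]
  have h5 := Coeffs.nE_pos (p := p) (z := p.zone₂) r⁻¹ (p.rho r s * p.rI (p.rho r s))
  generalize p.nE p.zone₂ r⁻¹ (p.rho r s * p.rI (p.rho r s)) = e at *
  generalize r⁻¹ ^ p.κ = U at *
  field_simp

theorem ε₂_eq_P₂ : p.ε₂ r s = p.P₂ r⁻¹ (p.rho r s) := by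
  rw [ε₂, ε23, ε21_eq_P₂₁ hM hs hsr, ε22_eq_P₂₂ hM hs hsr, G2sup_div_eq hM hs hsr,
    Φ2sup_div_eq hM hs hsr, P₂]

theorem q₂_eq : p.q₂ r s = p.P₂₁ r⁻¹ (p.rho r s) + p.D₂s * (2 * p.P₂₂ r⁻¹ (p.rho r s) +
    p.P₂₃ r⁻¹ (p.rho r s) * p.P₂₁ r⁻¹ (p.rho r s)) := by
  rw [q₂, ε21_eq_P₂₁ hM hs hsr, ε22_eq_P₂₂ hM hs hsr, G2sup_div_eq hM hs hsr]

theorem Zinf_eq_PZ : p.Zinf r s = p.PZ s⁻¹ (p.rho r s) := by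
  have hr := hs.trans hsr
  have h1 : (r ^ p.κ - s ^ p.κ) / (p.K1M * r ^ p.κ + p.K2M * s ^ p.κ) =
      (1 - p.rho r s) / (p.K1M + p.K2M * p.rho r s) := by
    have h4 : 0 < r ^ p.κ := Real.rpow_pos_of_pos hr _
    have h5 : s ^ p.κ = p.rho r s * r ^ p.κ := by
      rw [rho, Real.div_rpow hs.le hr.le]; field_simp
    rw [h5, ← one_sub_mul, ← mul_assoc, ← add_mul, mul_div_mul_right _ _ h4.ne']
  rw [Zinf, E1inf_eq hs, ratio_i hM hs hsr, h1, PZ]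

omit hs hsr in
theorem L2m_le_L2M : p.L2m ≤ p.L2M := by
  have h1 := hM.C₂.L_lo 1 0 one_pos
  have h2 := hM.C₂.L_hi 1 0 one_pos
  simp only [Real.one_rpow, mul_one, zone₂] at h1 h2
  exact h1.trans h2

omit hM hs hsr in
-- Strict because the `N`-part of the exponent is positive at `u > 0`. This strictness is what
-- separates `q₂` from `ε₂`.
theorem Coeffs.nE_lt_one {z : Zone} (C : p.Coeffs z) {u i : ℝ} (hu : 0 < u) (hi : 0 ≤ i) :
    p.nE z u i < 1 := by
  obtain ⟨e1, e2, e3, e4, e5, e6, e7, e8⟩ := C.exponents_pos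
  obtain ⟨_, _, _, _, _, _, _, _, _⟩ := C.pos
  have := C.a_pos
  rw [nE, Real.exp_lt_one_iff]
  have : 0 < p.a * (z.NM / (z.Lm * (p.μ - 1))) * u ^ (2 * p.μ - 2) := by positivity
  have : 0 ≤ z.D * z.KM / (z.Lm * (2 * p.μ + p.ν - 1)) * i * u ^ p.μ := by positivity
  linarith

end ratios

section monotone

variable (hM : p.Model) {ρ ρ' : ℝ} (h0 : 0 ≤ ρ) (hρ : ρ ≤ ρ') (h1 : ρ' < 1)
include hM h0 hρ h1

theorem rI_pos : 0 < p.rI ρ :=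
  div_pos hM.C₁.κ_pos (mul_pos hM.C₁.pos.Km (by linarith))

theorem rT_pos : 0 < p.rT ρ := by
  have k1 : 0 < p.K1t := hM.C₁.pos.Kt
  have k2 : 0 < p.K2t := hM.C₂.pos.Kt
  exact div_pos (by positivity) (mul_pos hM.C₁.pos.Km (by linarith))

theorem rS_pos : 0 < p.rS ρ := by
  have k1 : 0 < p.K1M := hM.C₁.pos.KM
  have k2 : 0 < p.K2M := hM.C₂.pos.KM
  exact div_pos (by positivity) (mul_pos hM.C₁.pos.Km (by linarith))

theorem rI_mono : p.rI ρ ≤ p.rI ρ' := by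
  have k1 : 0 < p.K1m := hM.C₁.pos.Km
  have k2 := hM.C₁.κ_pos
  have k3 : 0 < 1 - ρ' := by linarith
  unfold rI; gcongr

theorem rT_mono : p.rT ρ ≤ p.rT ρ' := by
  have k1 : 0 < p.K1m := hM.C₁.pos.Km
  have k2 : 0 < p.K1t := hM.C₁.pos.Kt
  have k4 : 0 < p.K2t := hM.C₂.pos.Kt
  have k3 : 0 < 1 - ρ' := by linarith
  have := h0.trans hρ
  unfold rT; gcongr

theorem rS_mono : p.rS ρ ≤ p.rS ρ' := by
  have k1 : 0 < p.K1m := hM.C₁.pos.Km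
  have k2 : 0 < p.K1M := hM.C₁.pos.KM
  have k4 : 0 < p.K2M := hM.C₂.pos.KM
  have k3 : 0 < 1 - ρ' := by linarith
  have := h0.trans hρ
  unfold rS; gcongr

omit hρ in
theorem rI_lt (hρ : ρ < ρ') : p.rI ρ < p.rI ρ' := by
  have k1 : 0 < p.K1m := hM.C₁.pos.Km
  have k2 := hM.C₁.κ_pos
  have k3 : 0 < 1 - ρ' := by linarith
  unfold rI; gcongr

variable {u u' c c' : ℝ} (hu : 0 ≤ u) (huu : u ≤ u') (hc : 0 ≤ c) (hcc : c ≤ c')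
include hu huu

include hc hcc in
theorem P₁_mono : p.P₁ u c ρ ≤ p.P₁ u' c' ρ' := by
  have hD := D₁s_pos hM
  have a1 := (rI_pos hM h0 hρ h1).le
  have a2 := (rT_pos hM h0 hρ h1).le
  have a3 := (rS_pos hM h0 hρ h1).le
  have m1 := rI_mono hM h0 hρ h1
  have m2 := rT_mono hM h0 hρ h1
  have m3 := rS_mono hM h0 hρ h1
  have b1 := hM.C₁.nΦt_mono hu huu a1 m1 a2 m2
  have b2 := hM.C₁.nX_mono hu huu a1 m1 a2 m2 a3 m3
  have b3 := hM.C₁.nΦt_nonneg hu a1 a2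
  have := hc.trans hcc
  unfold P₁
  gcongr

include hc hcc in
omit hρ in
theorem P₁_lt (hρ : ρ < ρ') : p.P₁ u c ρ < p.P₁ u' c' ρ' := by
  have hD := D₁s_pos hM
  have a1 := (rI_pos hM h0 hρ.le h1).le
  have a2 := (rT_pos hM h0 hρ.le h1).le
  have a3 := (rS_pos hM h0 hρ.le h1).le
  have m1 := rI_lt hM h0 h1 hρ
  have m2 := rT_mono hM h0 hρ.le h1
  have m3 := rS_mono hM h0 hρ.le h1
  have b1 := hM.C₁.nΦt_mono hu huu a1 m1.le a2 m2
  have b2 := hM.C₁.nX_lt hu huu a1 a2 m2 a3 m3 m1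
  have b3 := hM.C₁.nΦt_nonneg hu a1 a2
  have := hc.trans hcc
  have k1 : c * p.nΦt p.zone₁ u (p.rI ρ) (p.rT ρ) ≤
      c' * p.nΦt p.zone₁ u' (p.rI ρ') (p.rT ρ') := by gcongr
  have k2 := mul_lt_mul_of_pos_left b2 hD
  unfold P₁
  linarith

omit hρ in
-- Every ingredient is monotone, and the strict gain comes from the `ε22` term through the strict
-- growth of `ρ * rI ρ`.
theorem P₂_lt (hρ : ρ < ρ') : p.P₂ u ρ < p.P₂ u' ρ' := by
  have hD := D₂s_pos hM
  have hκ := hM.C₁.κ_pos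
  have hL : 0 < p.L2M := hM.C₂.pos.LM
  have hl : 0 < p.L2m := hM.C₂.pos.Lm
  have a1 := (rI_pos hM h0 hρ.le h1).le
  have a2 := (rT_pos hM h0 hρ.le h1).le
  have a3 := (rS_pos hM h0 hρ.le h1).le
  have m1 : ρ * p.rI ρ < ρ' * p.rI ρ' :=
    mul_lt_mul'' hρ (rI_lt hM h0 h1 hρ) h0 a1
  have m2 := rT_mono hM h0 hρ.le h1
  have m3 := rS_mono hM h0 hρ.le h1
  have a0 : 0 ≤ ρ * p.rI ρ := mul_nonneg h0 a1
  have b1 := hM.C₂.nΦt_mono hu huu a0 m1.le a2 m2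
  have b2 := hM.C₂.nX_lt hu huu a0 a2 m2 a3 m3 m1
  have b3 := hM.C₂.nΦt_nonneg hu a0 a2
  have b4 := hM.C₂.nE_anti hu huu a0 m1.le
  have b5 := hM.C₂.nGs_mono hu huu a0 m1.le
  have b6 := hM.C₂.nGs_pos (u := u) (i := ρ * p.rI ρ)
  have e0 := Coeffs.nE_pos (p := p) (z := p.zone₂) u (ρ * p.rI ρ)
  have e1 := Coeffs.nE_pos (p := p) (z := p.zone₂) u' (ρ' * p.rI ρ')
  have x0 : 0 ≤ p.nX p.zone₂ u (ρ * p.rI ρ) (p.rT ρ) (p.rS ρ) := by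
    have := hM.C₂.nGt_pos hu a0 a2
    unfold nX; positivity
  have n1 : 0 ≤ p.nΦt p.zone₂ u' (ρ' * p.rI ρ') (p.rT ρ') := b3.trans b1
  have c1 : p.P₂₁ u ρ ≤ p.P₂₁ u' ρ' := by unfold P₂₁; gcongr
  have c1' : 0 ≤ p.P₂₁ u ρ := by unfold P₂₁; positivity
  have c2 : p.P₂₂ u ρ < p.P₂₂ u' ρ' := b2
  have c2' : 0 ≤ p.P₂₂ u ρ := x0
  have c3 : p.P₂₃ u ρ ≤ p.P₂₃ u' ρ' := by unfold P₂₃; gcongr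
  have c3' : 0 ≤ p.P₂₃ u ρ := by unfold P₂₃; positivity
  have d1 : p.L2M / (p.L2m * p.nE p.zone₂ u (ρ * p.rI ρ)) * p.P₂₂ u ρ ≤
      p.L2M / (p.L2m * p.nE p.zone₂ u' (ρ' * p.rI ρ')) * p.P₂₂ u' ρ' := by gcongr
  have d2 : p.P₂₃ u ρ * p.P₂₁ u ρ ≤ p.P₂₃ u' ρ' * p.P₂₁ u' ρ' :=
    mul_le_mul c3 c1 c1' (c3'.trans c3)
  have k := mul_lt_mul_of_pos_left (add_lt_add_of_lt_of_le c2 (add_le_add d1 d2)) hD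
  exact add_lt_add_of_le_of_lt c1 k

omit hρ in
theorem PZ_lt (hρ : ρ < ρ') : p.PZ u' ρ' < p.PZ u ρ := by
  have hD := D₁s_pos hM
  have k1 : 0 < p.K1m := hM.C₁.pos.Km
  have k2 : 0 < p.K1M := hM.C₁.pos.KM
  have k3 : 0 < p.K2M := hM.C₂.pos.KM
  have k4 : 0 < p.L1M := hM.C₁.pos.LM
  have b := hM.C₁.nE_anti hu huu (rI_pos hM h0 hρ.le h1).le (rI_mono hM h0 hρ.le h1)
  have e := Coeffs.nE_pos (p := p) (z := p.zone₁) u (p.rI ρ)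
  have e' := Coeffs.nE_pos (p := p) (z := p.zone₁) u' (p.rI ρ')
  have k5 : 0 < 1 - ρ' := by linarith
  have k6 : 0 < 1 - ρ := by linarith
  have := h0.trans hρ.le
  unfold PZ
  calc _ < p.D₁s * p.nE p.zone₁ u' (p.rI ρ') * p.K1m / (2 * p.L1M) *
          ((1 - ρ) / (p.K1M + p.K2M * ρ)) ^ 2 := by gcongr
    _ ≤ _ := by gcongr

end monotone

section continuity

variable (hM : p.Model) {ι : Type*} {F : Filter ι} {U c R : ι → ℝ} {u c₀ ρ : ℝ}
  (hU : Tendsto U F (𝓝 u)) (hc : Tendsto c F (𝓝 c₀)) (hR : Tendsto R F (𝓝 ρ)) (hρ : ρ < 1)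
include hM hR hρ

theorem tendsto_ratios : Tendsto (fun x => p.rI (R x)) F (𝓝 (p.rI ρ)) ∧
    Tendsto (fun x => p.rT (R x)) F (𝓝 (p.rT ρ)) ∧
    Tendsto (fun x => p.rS (R x)) F (𝓝 (p.rS ρ)) := by
  have hne : p.K1m * (1 - ρ) ≠ 0 :=
    mul_ne_zero (ne_of_gt (show 0 < p.K1m from hM.C₁.pos.Km)) (by linarith)
  have hd : Tendsto (fun x => p.K1m * (1 - R x)) F (𝓝 (p.K1m * (1 - ρ))) :=
    (hR.const_sub 1).const_mul _
  exact ⟨tendsto_const_nhds.div hd hne, ((hR.const_mul _).const_add _).div hd hne,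
    ((hR.const_mul _).const_add _).div hd hne⟩

include hU

include hc in
theorem tendsto_P₁ : Tendsto (fun x => p.P₁ (U x) (c x) (R x)) F (𝓝 (p.P₁ u c₀ ρ)) := by
  obtain ⟨hI, hT, hS⟩ := tendsto_ratios hM hR hρ
  exact ((hc.mul (hM.C₁.tendsto_nΦt hU hI hT)).add
    ((hM.C₁.tendsto_nX hU hI hT hS).const_mul _)).const_mul _

theorem tendsto_PZ (h0 : 0 ≤ ρ) : Tendsto (fun x => p.PZ (U x) (R x)) F (𝓝 (p.PZ u ρ)) := by
  obtain ⟨hI, hT, hS⟩ := tendsto_ratios hM hR hρ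
  have k2 : 0 < p.K1M := hM.C₁.pos.KM
  have k3 : 0 < p.K2M := hM.C₂.pos.KM
  exact ((((hM.C₁.tendsto_nE hU hI).const_mul _).mul_const _).div_const _).mul
    (((hR.const_sub 1).div ((hR.const_mul _).const_add _)
      (by positivity : 0 < p.K1M + p.K2M * ρ).ne').pow 2)

theorem tendsto_P₂_parts : Tendsto (fun x => p.P₂₁ (U x) (R x)) F (𝓝 (p.P₂₁ u ρ)) ∧
    Tendsto (fun x => p.P₂₂ (U x) (R x)) F (𝓝 (p.P₂₂ u ρ)) ∧
    Tendsto (fun x => p.P₂₃ (U x) (R x)) F (𝓝 (p.P₂₃ u ρ)) := by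
  obtain ⟨hI, hT, hS⟩ := tendsto_ratios hM hR hρ
  have hRI := hR.mul hI
  exact ⟨(((hM.C₂.tendsto_nΦt hU hRI hT).const_mul 2).mul_const _).div
      (hM.C₂.tendsto_nE hU hRI) (Coeffs.nE_pos _ _).ne',
    hM.C₂.tendsto_nX hU hRI hT hS, (hRI.pow 2).mul (hM.C₂.tendsto_nGs hU hRI)⟩

theorem tendsto_P₂ : Tendsto (fun x => p.P₂ (U x) (R x)) F (𝓝 (p.P₂ u ρ)) := by
  obtain ⟨hI, hT, hS⟩ := tendsto_ratios hM hR hρ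
  obtain ⟨h1, h2, h3⟩ := tendsto_P₂_parts hM hU hR hρ
  have hl : 0 < p.L2m := hM.C₂.pos.Lm
  exact h1.add ((h2.add (((tendsto_const_nhds.div
    ((hM.C₂.tendsto_nE hU (hR.mul hI)).const_mul p.L2m)
    (mul_pos hl (Coeffs.nE_pos _ _)).ne').mul h2).add (h3.mul h1))).const_mul _)

end continuity

end Contact

end

/-! ### The thresholds `s₁`, `s₂`, `r₁`, `r₂`, `r_B` and their continuity. -/

noncomputable section

/-- The level `c` of a strictly decreasing continuous function on `(s, ∞)`. -/
theorem exists_level {e : ℝ → ℝ} {s c a b : ℝ} (hanti : StrictAntiOn e (Ioi s))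
    (hcont : ContinuousOn e (Ioi s)) (ha : s < a) (hea : c ≤ e a) (hb : s < b) (heb : e b < c) :
    ∃ t, s < t ∧ e t = c ∧ {r | s < r ∧ e r < c} = Ioi t ∧ {r | s < r ∧ e r ≤ c} = Ici t := by
  have hab : a ≤ b := by
    by_contra! h
    have := hanti hb ha h
    linarith
  obtain ⟨t, ht, het⟩ := intermediate_value_Icc' hab
    (hcont.mono fun x hx => ha.trans_le hx.1) ⟨heb.le, hea⟩
  have hst : s < t := ha.trans_le ht.1
  refine ⟨t, hst, het, ?_, ?_⟩
  · ext r
    simp only [mem_ofPred_eq, mem_Ioi]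
    constructor
    · rintro ⟨h1, h2⟩
      exact (hanti.lt_iff_gt h1 hst).1 (het ▸ h2)
    · intro h
      exact ⟨hst.trans h, het ▸ hanti hst (hst.trans h) h⟩
  · ext r
    simp only [mem_ofPred_eq, mem_Ici]
    constructor
    · rintro ⟨h1, h2⟩
      exact (hanti.le_iff_ge h1 hst).1 (het ▸ h2)
    · intro h
      exact ⟨hst.trans_le h, het ▸ (hanti.le_iff_ge (hst.trans_le h) hst).2 h⟩

/-- A level of a strictly decreasing, jointly continuous function depends continuously on the
parameter. -/
theorem continuousOn_level {e : ℝ → ℝ → ℝ} {c : ℝ} {t : ℝ → ℝ} {O : Set ℝ} (hO : IsOpen O)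
    (hpos : ∀ s ∈ O, 0 < s) (hanti : ∀ s ∈ O, StrictAntiOn (fun r => e r s) (Ioi s))
    (hcont : ContinuousOn (fun q : ℝ × ℝ => e q.1 q.2) {q | 0 < q.2 ∧ q.2 < q.1})
    (ht : ∀ s ∈ O, s < t s) (hlev : ∀ s ∈ O, e (t s) s = c) : ContinuousOn t O := by
  have hD : IsOpen {q : ℝ × ℝ | 0 < q.2 ∧ q.2 < q.1} :=
    (isOpen_lt continuous_const continuous_snd).inter (isOpen_lt continuous_snd continuous_fst)
  intro s hs
  have hmem : ∀ᶠ s' in 𝓝 s, s' ∈ O := hO.mem_nhds hs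
  have hsec : ∀ r, s < r → Tendsto (fun s' => e r s') (𝓝 s) (𝓝 (e r s)) := fun r hr =>
    (hcont.continuousAt (hD.mem_nhds ⟨hpos s hs, hr⟩)).tendsto.comp
      ((Continuous.prodMk_right r).tendsto s)
  refine ContinuousAt.continuousWithinAt (tendsto_order.2 ⟨fun x hx => ?_, fun x hx => ?_⟩)
  -- At a point `y` just below the level point the function exceeds `c`. By continuity in the
  -- parameter this persists nearby, and monotonicity then puts the nearby level points beyond `y`.
  -- The upper half is symmetric.
  · obtain ⟨y, hy1, hy2⟩ := exists_between (max_lt hx (ht s hs))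
    have hsy : s < y := (le_max_right _ _).trans_lt hy1
    have h1 : c < e y s := by
      rw [← hlev s hs]; exact hanti s hs hsy (ht s hs) hy2
    filter_upwards [hmem, (hsec y hsy).eventually_const_lt h1, Iio_mem_nhds hsy] with s' h2 h3 h4
    rw [← hlev s' h2] at h3
    exact ((le_max_left _ _).trans_lt hy1).trans
      (((hanti s' h2).lt_iff_gt (ht s' h2) h4).1 h3)
  · have hsx := (ht s hs).trans hx
    have h1 : e x s < c := by
      rw [← hlev s hs]; exact hanti s hs (ht s hs) hsx hx
    filter_upwards [hmem, (hsec x hsx).eventually_lt_const h1, Iio_mem_nhds hsx] with s' h2 h3 h4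
    rw [← hlev s' h2] at h3
    exact ((hanti s' h2).lt_iff_gt h4 (ht s' h2)).1 h3

/-- The pairs `0 < s < r`. -/
def pairs : Set (ℝ × ℝ) := {q | 0 < q.2 ∧ q.2 < q.1}

theorem isOpen_pairs : IsOpen pairs :=
  (isOpen_lt continuous_const continuous_snd).inter (isOpen_lt continuous_snd continuous_fst)

namespace Contact

variable {p : Contact} (hM : p.Model)
include hM

section joint

variable {q : ℝ × ℝ} (hq : q ∈ pairs)
include hq

omit hM in
theorem tendsto_rho : Tendsto (fun q : ℝ × ℝ => p.rho q.1 q.2) (𝓝 q) (𝓝 (p.rho q.1 q.2)) := by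
  have hr := hq.1.trans hq.2
  exact ((continuous_snd.tendsto q).div (continuous_fst.tendsto q) hr.ne').rpow_const
    (Or.inl (div_pos hq.1 hr).ne')

omit hM in
theorem tendsto_inv : Tendsto (fun q : ℝ × ℝ => q.2⁻¹) (𝓝 q) (𝓝 q.2⁻¹) ∧
    Tendsto (fun q : ℝ × ℝ => q.1⁻¹) (𝓝 q) (𝓝 q.1⁻¹) :=
  ⟨(continuous_snd.tendsto q).inv₀ hq.1.ne',
    (continuous_fst.tendsto q).inv₀ (hq.1.trans hq.2).ne'⟩

theorem continuousAt_ε₁ : ContinuousAt (fun q : ℝ × ℝ => p.ε₁ q.1 q.2) q := by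
  have hc : Tendsto (fun q : ℝ × ℝ => p.cQ q.2) (𝓝 q) (𝓝 (p.cQ q.2)) := by
    have h1 : Tendsto (fun q : ℝ × ℝ => p.Q * Real.exp (-q.2 ^ 2)) (𝓝 q)
        (𝓝 (p.Q * Real.exp (-q.2 ^ 2))) := Continuous.tendsto (by fun_prop) q
    exact h1.mul ((tendsto_inv hq).1.rpow_const (Or.inl (inv_pos.2 hq.1).ne'))
  have h := tendsto_P₁ hM (tendsto_inv hq).1 hc (tendsto_rho (p := p) hq)
    (rho_lt_one hM hq.1 hq.2)
  rw [ContinuousAt, ε₁_eq_P₁ hM hq.1 hq.2]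
  refine h.congr' ?_
  filter_upwards [isOpen_pairs.mem_nhds hq] with q' hq'
  rw [ε₁_eq_P₁ hM hq'.1 hq'.2]

theorem continuousAt_ε₂ : ContinuousAt (fun q : ℝ × ℝ => p.ε₂ q.1 q.2) q := by
  have h := tendsto_P₂ hM (tendsto_inv hq).2 (tendsto_rho (p := p) hq) (rho_lt_one hM hq.1 hq.2)
  rw [ContinuousAt, ε₂_eq_P₂ hM hq.1 hq.2]
  refine h.congr' ?_
  filter_upwards [isOpen_pairs.mem_nhds hq] with q' hq'
  rw [ε₂_eq_P₂ hM hq'.1 hq'.2]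

theorem continuousAt_q₂ : ContinuousAt (fun q : ℝ × ℝ => p.q₂ q.1 q.2) q := by
  obtain ⟨h1, h2, h3⟩ := tendsto_P₂_parts hM (tendsto_inv hq).2 (tendsto_rho (p := p) hq)
    (rho_lt_one hM hq.1 hq.2)
  rw [ContinuousAt, q₂_eq hM hq.1 hq.2]
  refine (h1.add (((h2.const_mul 2).add (h3.mul h1)).const_mul _)).congr' ?_
  filter_upwards [isOpen_pairs.mem_nhds hq] with q' hq'
  rw [q₂_eq hM hq'.1 hq'.2]

theorem continuousAt_Zinf : ContinuousAt (fun q : ℝ × ℝ => p.Zinf q.1 q.2) q := by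
  have h := tendsto_PZ hM (tendsto_inv hq).1 (tendsto_rho (p := p) hq) (rho_lt_one hM hq.1 hq.2)
    (rho_pos hM hq.1 hq.2).le
  rw [ContinuousAt, Zinf_eq_PZ hM hq.1 hq.2]
  refine h.congr' ?_
  filter_upwards [isOpen_pairs.mem_nhds hq] with q' hq'
  rw [Zinf_eq_PZ hM hq'.1 hq'.2]

/-- The two differ in one coefficient of `ε22`: `1` against `L2M / (L2m E2inf)`, which exceeds `1`
since `L2m ≤ L2M` and `E2inf < 1`. The strict inequality keeps the operator contracting where `ε₂ =
1`. -/
theorem q₂_lt_ε₂ : p.q₂ q.1 q.2 < p.ε₂ q.1 q.2 := by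
  have h0 := (rho_pos hM hq.1 hq.2).le
  have h1 := rho_lt_one hM hq.1 hq.2
  have hr := inv_pos.2 (hq.1.trans hq.2)
  have hD := D₂s_pos hM
  have hi : 0 < p.rho q.1 q.2 * p.rI (p.rho q.1 q.2) :=
    mul_pos (rho_pos hM hq.1 hq.2) (rI_pos hM h0 le_rfl h1)
  have hE := hM.C₂.nE_lt_one hr hi.le
  have hE0 := Coeffs.nE_pos (p := p) (z := p.zone₂) q.1⁻¹ (p.rho q.1 q.2 * p.rI (p.rho q.1 q.2))
  have hX : 0 < p.P₂₂ q.1⁻¹ (p.rho q.1 q.2) :=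
    hM.C₂.nX_pos hr.le hi (rT_pos hM h0 le_rfl h1).le (rS_pos hM h0 le_rfl h1).le
  have hL := L2m_le_L2M hM
  have hl : 0 < p.L2m := hM.C₂.pos.Lm
  have hquot : 1 < p.L2M / (p.L2m * p.nE p.zone₂ q.1⁻¹ (p.rho q.1 q.2 * p.rI (p.rho q.1 q.2))) := by
    rw [one_lt_div (by positivity)]
    calc _ < p.L2m * 1 := by gcongr
      _ ≤ _ := by linarith
  rw [q₂_eq hM hq.1 hq.2, ε₂_eq_P₂ hM hq.1 hq.2, P₂]
  have := mul_lt_mul_of_pos_right hquot hX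
  have h5 := mul_lt_mul_of_pos_left this hD
  linarith

end joint

section fixedS

variable {s : ℝ} (hs : 0 < s)
include hs

theorem rho_strictAnti {r r' : ℝ} (h : s < r) (hr : r < r') : p.rho r' s < p.rho r s :=
  Real.rpow_lt_rpow (div_nonneg hs.le (hs.trans (h.trans hr)).le)
    (div_lt_div_of_pos_left hs (hs.trans h) hr) hM.C₁.κ_pos

theorem tendsto_rho_atTop : Tendsto (fun r => p.rho r s) atTop (𝓝 0) := by
  have h : Tendsto (fun r : ℝ => s / r) atTop (𝓝 0) := tendsto_const_nhds.div_atTop tendsto_id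
  have := h.rpow_const (p := p.κ) (Or.inr hM.C₁.κ_pos.le)
  rwa [Real.zero_rpow hM.C₁.κ_pos.ne'] at this

theorem cQ_nonneg : 0 ≤ p.cQ s := by
  have := hM.standing.Q_pos
  have := inv_pos.2 hs
  unfold cQ; positivity

theorem cQ_anti {s' : ℝ} (h : s ≤ s') : p.cQ s' ≤ p.cQ s := by
  have := hM.standing.Q_pos
  obtain ⟨e1, e2, e3, -⟩ := hM.C₁.exponents_pos
  have := inv_pos.2 (hs.trans_le h)
  unfold cQ; gcongr

theorem ε₁_strictAnti : StrictAntiOn (fun r => p.ε₁ r s) (Ioi s) := fun r hr r' hr' h => by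
  simp only [ε₁_eq_P₁ hM hs hr, ε₁_eq_P₁ hM hs hr']
  exact P₁_lt hM (rho_pos hM hs hr').le (rho_lt_one hM hs hr) (inv_pos.2 hs).le le_rfl
    (cQ_nonneg hM hs) le_rfl (rho_strictAnti hM hs hr h)

theorem ε₂_strictAnti : StrictAntiOn (fun r => p.ε₂ r s) (Ioi s) := fun r hr r' hr' h => by
  simp only [ε₂_eq_P₂ hM hs hr, ε₂_eq_P₂ hM hs hr']
  exact P₂_lt hM (rho_pos hM hs hr').le (rho_lt_one hM hs hr)
    (inv_pos.2 (hs.trans hr')).le (inv_anti₀ (hs.trans hr) h.le) (rho_strictAnti hM hs hr h)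

theorem Zinf_strictMono : StrictMonoOn (fun r => p.Zinf r s) (Ioi s) := fun r hr r' hr' h => by
  simp only [Zinf_eq_PZ hM hs hr, Zinf_eq_PZ hM hs hr']
  exact PZ_lt hM (rho_pos hM hs hr').le (rho_lt_one hM hs hr) (inv_pos.2 hs).le le_rfl
    (rho_strictAnti hM hs hr h)

theorem tendsto_ε₁_atTop : Tendsto (fun r => p.ε₁ r s) atTop (𝓝 (p.P₁ s⁻¹ (p.cQ s) 0)) := by
  refine (tendsto_P₁ hM (tendsto_const_nhds (x := s⁻¹)) (tendsto_const_nhds (x := p.cQ s))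
    (tendsto_rho_atTop hM hs) one_pos).congr' ?_
  filter_upwards [eventually_gt_atTop s] with r hr
  rw [ε₁_eq_P₁ hM hs hr]

theorem tendsto_Zinf_atTop : Tendsto (fun r => p.Zinf r s) atTop (𝓝 (p.PZ s⁻¹ 0)) := by
  refine (tendsto_PZ hM (tendsto_const_nhds (x := s⁻¹))
    (tendsto_rho_atTop hM hs) one_pos le_rfl).congr' ?_
  filter_upwards [eventually_gt_atTop s] with r hr
  rw [Zinf_eq_PZ hM hs hr]

theorem j₁_eq : p.j₁ s = p.P₁ s⁻¹ (p.cQ s) 0 := (tendsto_ε₁_atTop hM hs).limUnder_eq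

theorem j₂_eq : p.j₂ s = p.PZ s⁻¹ 0 := (tendsto_Zinf_atTop hM hs).limUnder_eq

omit hs in
theorem nEt_zero {z : Zone} (C : p.Coeffs z) (τ : ℝ) : p.nEt z 0 0 τ = 0 := by
  obtain ⟨e1, e2, e3, e4, e5, e6, e7, e8⟩ := C.exponents_pos
  rw [nEt, Real.zero_rpow e4.ne', Real.zero_rpow e6.ne']
  ring

/-- As `r → ∞` both `r⁻¹` and `ρ` tend to `0`, and each part of `P₂` vanishes there. Hence `r₂`
needs no smallness hypothesis, unlike `r₁`. -/
theorem tendsto_ε₂_atTop : Tendsto (fun r => p.ε₂ r s) atTop (𝓝 0) := by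
  have h := tendsto_P₂ hM tendsto_inv_atTop_zero (tendsto_rho_atTop hM hs) one_pos
  have e0 : p.P₂ 0 0 = 0 := by
    have hμ := hM.C₂.exponents_pos.2.1
    simp [P₂, P₂₁, P₂₂, P₂₃, nΦt, nX, nEt_zero hM hM.C₂, Real.zero_rpow hμ.ne']
  rw [e0] at h
  refine h.congr' ?_
  filter_upwards [eventually_gt_atTop s] with r hr
  rw [ε₂_eq_P₂ hM hs hr]

/-- As `r` decreases to `s`, `H_inf` degenerates and `1 / (1 - ρ)` blows up. The factor `ρ ^ 2`,
harmless since `ρ → 1`, is kept so that one limit serves both zones. -/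
theorem tendsto_rI_nhdsGT : Tendsto (fun r => p.rho r s ^ 2 * p.rI (p.rho r s) ^ 2) (𝓝[>] s)
    atTop := by
  have h1 : Tendsto (fun r => p.rho r s) (𝓝[>] s) (𝓝 1) := by
    have : ContinuousAt (fun r => p.rho r s) s :=
      ContinuousAt.rpow_const (continuousAt_const.div continuousAt_id hs.ne')
        (Or.inl (div_pos hs hs).ne')
    have h := this.tendsto.mono_left (nhdsWithin_le_nhds (s := Ioi s))
    simpa [rho, div_self hs.ne'] using h
  have h2 : Tendsto (fun r => 1 - p.rho r s) (𝓝[>] s) (𝓝[>] 0) := by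
    refine tendsto_nhdsWithin_iff.2 ⟨by simpa using h1.const_sub 1, ?_⟩
    filter_upwards [self_mem_nhdsWithin] with r hr
    exact sub_pos.2 (rho_lt_one hM hs hr)
  have h3 : Tendsto (fun r => p.rI (p.rho r s)) (𝓝[>] s) atTop := by
    have hk : 0 < p.κ / p.K1m := div_pos hM.C₁.κ_pos hM.C₁.pos.Km
    refine (Tendsto.const_mul_atTop hk (tendsto_inv_nhdsGT_zero.comp h2)).congr fun r => ?_
    simp only [Function.comp, rI]
    rw [← div_div, div_eq_mul_inv _ (1 - _)]
  exact Tendsto.pos_mul_atTop one_pos (by simpa using h1.pow 2)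
    ((tendsto_pow_atTop two_ne_zero).comp h3)

omit hM hs in
-- `nGt` stays above its positive value at zero, so `nX` blows up with `i ^ 2`.
theorem Coeffs.nX_ge {z : Zone} (C : p.Coeffs z) {u i τ σ : ℝ} (hu : 0 ≤ u) (hi : 0 ≤ i)
    (hτ : 0 ≤ τ) (hσ : 0 ≤ σ) : i ^ 2 * p.nGt z 0 0 0 ≤ p.nX z u i τ σ := by
  have h1 := C.nGt_mono le_rfl hu le_rfl hi le_rfl hτ
  have h2 := C.nGs_pos (u := u) (i := i)
  have h3 : 0 ≤ 2 * p.nGs z u i * σ * τ := by positivity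
  unfold nX
  exact mul_le_mul_of_nonneg_left (by linarith) (sq_nonneg i)

/-- The blow-up at `r = s` places the level point strictly to the right of `s`. -/
theorem exists_one_le_ε₁ : ∃ r, s < r ∧ 1 ≤ p.ε₁ r s := by
  have hg : 0 < 2 * p.D₁s * p.nGt p.zone₁ 0 0 0 :=
    mul_pos (mul_pos two_pos (D₁s_pos hM)) (hM.C₁.nGt_pos le_rfl le_rfl le_rfl)
  obtain ⟨r, h1, hr⟩ := (((tendsto_rI_nhdsGT hM hs).const_mul_atTop hg).eventually_ge_atTop 1
    |>.and self_mem_nhdsWithin).exists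
  refine ⟨r, hr, h1.trans ?_⟩
  have h0 := (rho_pos hM hs hr).le
  have h1 := rho_lt_one hM hs hr
  have a1 := (rI_pos hM h0 le_rfl h1).le
  have a2 := (rT_pos hM h0 le_rfl h1).le
  have a3 := (rS_pos hM h0 le_rfl h1).le
  have hu := (inv_pos.2 hs).le
  have b1 := hM.C₁.nΦt_nonneg hu a1 a2
  have b2 := hM.C₁.nX_ge hu a1 a2 a3
  have b3 := cQ_nonneg hM hs
  have b4 := mul_le_mul_of_nonneg_left b2 (D₁s_pos hM).le
  have hg' : 0 ≤ p.D₁s * p.nGt p.zone₁ 0 0 0 := by linarith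
  have b5 : p.rho r s ^ 2 * p.rI (p.rho r s) ^ 2 ≤ p.rI (p.rho r s) ^ 2 :=
    mul_le_of_le_one_left (sq_nonneg _) (pow_le_one₀ h0 h1.le)
  have b6 := mul_le_mul_of_nonneg_left b5 hg'
  have b7 := mul_nonneg b3 b1
  rw [ε₁_eq_P₁ hM hs hr, P₁]
  linarith

theorem exists_one_le_ε₂ : ∃ r, s < r ∧ 1 ≤ p.ε₂ r s := by
  have hg : 0 < p.D₂s * p.nGt p.zone₂ 0 0 0 :=
    mul_pos (D₂s_pos hM) (hM.C₂.nGt_pos le_rfl le_rfl le_rfl)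
  obtain ⟨r, h1, hr⟩ := (((tendsto_rI_nhdsGT hM hs).const_mul_atTop hg).eventually_ge_atTop 1
    |>.and self_mem_nhdsWithin).exists
  refine ⟨r, hr, h1.trans ?_⟩
  have h0 := (rho_pos hM hs hr).le
  have h1 := rho_lt_one hM hs hr
  have a1 := (rI_pos hM h0 le_rfl h1).le
  have a2 := (rT_pos hM h0 le_rfl h1).le
  have a3 := (rS_pos hM h0 le_rfl h1).le
  have a0 : 0 ≤ p.rho r s * p.rI (p.rho r s) := mul_nonneg h0 a1
  have hu := (inv_pos.2 (hs.trans hr)).le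
  have b1 := hM.C₂.nΦt_nonneg hu a0 a2
  have b2 : (p.rho r s * p.rI (p.rho r s)) ^ 2 * p.nGt p.zone₂ 0 0 0 ≤
    p.P₂₂ r⁻¹ (p.rho r s) := hM.C₂.nX_ge hu a0 a2 a3
  have hκ := hM.C₁.κ_pos
  have hL : 0 < p.L2M := hM.C₂.pos.LM
  have hl : 0 < p.L2m := hM.C₂.pos.Lm
  have e0 := Coeffs.nE_pos (p := p) (z := p.zone₂) r⁻¹ (p.rho r s * p.rI (p.rho r s))
  have g0 := hM.C₂.nGs_pos (u := r⁻¹) (i := p.rho r s * p.rI (p.rho r s))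
  have g1 := hM.C₂.nGt_pos (u := 0) (i := 0) (τ := 0) le_rfl le_rfl le_rfl
  have c1 : 0 ≤ p.P₂₁ r⁻¹ (p.rho r s) := by unfold P₂₁; positivity
  have c2 : 0 ≤ p.P₂₂ r⁻¹ (p.rho r s) := le_trans (by positivity) b2
  have c3 : 0 ≤ p.P₂₃ r⁻¹ (p.rho r s) := by unfold P₂₃; positivity
  have c4 := mul_le_mul_of_nonneg_left b2 (D₂s_pos hM).le
  have hD := D₂s_pos hM
  have c5 : 0 ≤ p.D₂s * (p.L2M / (p.L2m * p.nE p.zone₂ r⁻¹ (p.rho r s * p.rI (p.rho r s))) *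
      p.P₂₂ r⁻¹ (p.rho r s) + p.P₂₃ r⁻¹ (p.rho r s) * p.P₂₁ r⁻¹ (p.rho r s)) := by positivity
  rw [ε₂_eq_P₂ hM hs hr, P₂, mul_add]
  rw [mul_pow] at c4
  linarith

end fixedS

section thresholds

theorem j₁_anti {s s' : ℝ} (hs : 0 < s) (h : s ≤ s') : p.j₁ s' ≤ p.j₁ s := by
  have hs' := hs.trans_le h
  rw [j₁_eq hM hs, j₁_eq hM hs']
  exact P₁_mono hM le_rfl le_rfl one_pos (inv_pos.2 hs').le (inv_anti₀ hs h) (cQ_nonneg hM hs')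
    (cQ_anti hM hs h)

theorem j₂_strictMono {s s' : ℝ} (hs : 0 < s) (h : s < s') : p.j₂ s < p.j₂ s' := by
  have hs' := hs.trans h
  rw [j₂_eq hM hs, j₂_eq hM hs']
  have hD := D₁s_pos hM
  have k1 : 0 < p.K1m := hM.C₁.pos.Km
  have k2 : 0 < p.K1M := hM.C₁.pos.KM
  have k4 : 0 < p.L1M := hM.C₁.pos.LM
  obtain ⟨e1, e2, e3, e4, e5, e6, e7, e8⟩ := hM.C₁.exponents_pos
  have hlt : p.nE p.zone₁ s⁻¹ (p.rI 0) < p.nE p.zone₁ s'⁻¹ (p.rI 0) := by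
    obtain ⟨_, _, _, _, _, _, _, _, _⟩ := hM.C₁.pos
    have := hM.C₁.a_pos
    have hi := rI_pos hM le_rfl (le_refl 0) one_pos
    have h1 : s'⁻¹ < s⁻¹ := (inv_lt_inv₀ hs' hs).2 h
    have h2 := inv_pos.2 hs'
    unfold nE
    gcongr
  unfold PZ
  simp only [mul_zero, add_zero, sub_zero]
  gcongr

theorem exists_j₁_lt (hEps : p.HipEps1) : ∃ s, 0 < s ∧ p.j₁ s < 1 := by
  have h0 : Tendsto (fun s : ℝ => s⁻¹) atTop (𝓝 0) := tendsto_inv_atTop_zero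
  obtain ⟨e1, e2, e3, e4, e5, e6, e7, e8⟩ := hM.C₁.exponents_pos
  have hQ := hM.standing.Q_pos
  have hc : Tendsto p.cQ atTop (𝓝 0) := by
    have h1 : Tendsto (fun s : ℝ => p.Q * s⁻¹ ^ (p.μ - 1)) atTop (𝓝 0) := by
      have := (h0.rpow_const (p := p.μ - 1) (Or.inr e3.le)).const_mul p.Q
      rwa [Real.zero_rpow e3.ne', mul_zero] at this
    refine squeeze_zero' ?_ ?_ h1
    · filter_upwards [eventually_gt_atTop 0] with s hs
      exact cQ_nonneg hM hs
    · filter_upwards [eventually_gt_atTop 0] with s hs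
      have : Real.exp (-s ^ 2) ≤ 1 := Real.exp_le_one_iff.2 (by nlinarith)
      have := inv_pos.2 hs
      unfold cQ
      calc _ ≤ p.Q * 1 * s⁻¹ ^ (p.μ - 1) := by gcongr
        _ = _ := by ring
  have h := tendsto_P₁ hM h0 hc (tendsto_const_nhds (x := (0 : ℝ))) one_pos
  -- At `u = c = ρ = 0` the exponential bound is `1` and its Lipschitz constant is `0`. What
  -- survives is exactly the left-hand side of `HipEps1`.
  have hlim : p.P₁ 0 0 0 < 1 := by
    refine lt_of_eq_of_lt ?_ hEps
    have k1 : 0 < p.K1m := hM.C₁.pos.Km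
    have k4 : 0 < p.L1m := hM.C₁.pos.Lm
    have hE : p.nE p.zone₁ 0 (p.rI 0) = 1 := by
      rw [nE, Real.zero_rpow e5.ne', Real.zero_rpow e2.ne']; simp
    have hEt : p.nEt p.zone₁ 0 (p.rI 0) (p.rT 0) = 0 := by
      rw [nEt, Real.zero_rpow e4.ne', Real.zero_rpow e6.ne', Real.zero_rpow e2.ne',
        Real.zero_rpow (by positivity)]
      simp
    simp only [P₁, nX, nGt, nGs, nHt, nHs, hE, hEt, nΦt, Real.zero_rpow e2.ne']
    simp only [rI, rT, rS, zone₁]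
    field_simp
    ring
  obtain ⟨s, h1, h2⟩ := ((h.eventually_lt_const hlim).and (eventually_gt_atTop 0)).exists
  exact ⟨s, h2, by rwa [j₁_eq hM h2]⟩

theorem exists_lt_j₂ (hZ : p.HipZinfty) (t : ℝ) : ∃ s, t ≤ s ∧ p.B < p.j₂ s := by
  have h := tendsto_PZ hM tendsto_inv_atTop_zero (tendsto_const_nhds (x := (0 : ℝ))) one_pos le_rfl
  obtain ⟨e1, e2, e3, e4, e5, e6, e7, e8⟩ := hM.C₁.exponents_pos
  have hlim : p.B < p.PZ 0 0 := by
    refine lt_of_lt_of_eq hZ ?_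
    have k1 : 0 < p.K1M := hM.C₁.pos.KM
    have hE : p.nE p.zone₁ 0 (p.rI 0) = 1 := by
      rw [nE, Real.zero_rpow e5.ne', Real.zero_rpow e2.ne']; simp
    have k2 : 0 < p.L1M := hM.C₁.pos.LM
    rw [PZ, hE, mul_zero, add_zero, sub_zero]
    field_simp
  obtain ⟨s, h1, h2, h3⟩ := ((h.eventually_const_lt hlim).and
    ((eventually_gt_atTop 0).and (eventually_ge_atTop t))).exists
  exact ⟨s, h3, by rwa [j₂_eq hM h2]⟩

/-- The term `s^{-(μ - 2)}` of the Lipschitz constant of `E₁` diverges as `s → 0` because `2 < μ`.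
This is what makes `s₁` positive. -/
theorem exists_one_le_j₁ : ∃ δ > 0, ∀ s, 0 < s → s ≤ δ → 1 ≤ p.j₁ s := by
  obtain ⟨e1, e2, e3, e4, e5, e6, e7, e8⟩ := hM.C₁.exponents_pos
  have hD := D₁s_pos hM
  have hi := rI_pos hM le_rfl (le_refl 0) one_pos
  have hT := rT_pos hM le_rfl (le_refl 0) one_pos
  have hS := rS_pos hM le_rfl (le_refl 0) one_pos
  have ha := hM.C₁.a_pos
  have hN := hM.C₁.pos.Nt
  have hL := hM.C₁.pos.Lm
  have hH := hM.C₁.nHs_pos (u := 0) (i := 0)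
  -- `A` is the coefficient of `u ^ (μ - 2)` in `nEt`. The constant `c` below follows this term
  -- through `nΦt`, `nGt`, `nX` and `P₁`.
  set A : ℝ := 2 * p.a * (p.zone₁.Nt / (p.zone₁.Lm * (p.μ - 2))) with hA
  have hApos : 0 < A := by positivity
  set c : ℝ := 2 * (p.D₁s * (p.rI 0 ^ 2 * (p.nHs p.zone₁ 0 0 * (A / (p.zone₁.Lm * p.κ))))) with hc
  have hcpos : 0 < c := by positivity
  obtain ⟨u₀, hu₀⟩ := ((tendsto_rpow_atTop e4).const_mul_atTop hcpos).eventually_ge_atTop 1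
    |>.and (eventually_gt_atTop 0) |>.exists_forall_of_atTop
  refine ⟨u₀⁻¹, inv_pos.2 (hu₀ u₀ le_rfl).2, fun s hs hsu => ?_⟩
  have hu := inv_pos.2 hs
  have h1 : 1 ≤ c * s⁻¹ ^ (p.μ - 2) := (hu₀ s⁻¹ ((le_inv_comm₀ hs (hu₀ u₀ le_rfl).2).1 hsu)).1
  refine h1.trans ?_
  rw [j₁_eq hM hs, P₁]
  have b1 := mul_nonneg (cQ_nonneg hM hs) (hM.C₁.nΦt_nonneg hu.le hi.le hT.le)
  have b2 : A * s⁻¹ ^ (p.μ - 2) ≤ p.nEt p.zone₁ s⁻¹ (p.rI 0) (p.rT 0) := by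
    obtain ⟨_, _, _, _, _, _, _, _, _⟩ := hM.C₁.pos
    rw [nEt, hA, mul_add (2 * p.a), add_assoc, mul_assoc (2 * p.a)]
    exact le_add_of_nonneg_right (by positivity)
  have b3 : A * s⁻¹ ^ (p.μ - 2) / (p.zone₁.Lm * p.κ) ≤ p.nΦt p.zone₁ s⁻¹ (p.rI 0) (p.rT 0) := by
    have := hM.C₁.pos.Lt
    rw [nΦt]
    exact (div_le_div_of_nonneg_right b2 (by positivity)).trans
      (le_add_of_nonneg_right (by positivity))
  have b4 := hM.C₁.nHs_mono le_rfl hu.le le_rfl hi.le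
  have b5 : p.nHs p.zone₁ 0 0 * (A * s⁻¹ ^ (p.μ - 2) / (p.zone₁.Lm * p.κ)) ≤
      p.nGt p.zone₁ s⁻¹ (p.rI 0) (p.rT 0) := by
    have := hM.C₁.nHt_pos hu.le hi.le hT.le
    rw [nGt]
    exact (mul_le_mul b4 b3 (by positivity) (hH.le.trans b4)).trans
      (le_add_of_nonneg_right (by positivity))
  have b6 : p.rI 0 ^ 2 * (p.nHs p.zone₁ 0 0 * (A * s⁻¹ ^ (p.μ - 2) / (p.zone₁.Lm * p.κ))) ≤
      p.nX p.zone₁ s⁻¹ (p.rI 0) (p.rT 0) (p.rS 0) := by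
    have := hM.C₁.nGs_pos (u := s⁻¹) (i := p.rI 0)
    rw [nX]
    exact mul_le_mul_of_nonneg_left (b5.trans (le_add_of_nonneg_right (by positivity)))
      (sq_nonneg _)
  have b7 := mul_le_mul_of_nonneg_left b6 hD.le
  calc _ = 2 * (p.D₁s * (p.rI 0 ^ 2 * (p.nHs p.zone₁ 0 0 *
        (A * s⁻¹ ^ (p.μ - 2) / (p.zone₁.Lm * p.κ))))) := by rw [hc]; ring
    _ ≤ _ := by linarith

theorem s₁_pos (hEps : p.HipEps1) : 0 < p.s₁ := by
  obtain ⟨δ, hδ, h⟩ := exists_one_le_j₁ hM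
  obtain ⟨t, ht⟩ := exists_j₁_lt hM hEps
  refine hδ.trans_le (le_csInf ⟨t, ht⟩ fun s hs => ?_)
  by_contra! hlt
  exact absurd (h s hs.1 hlt.le) (not_le.2 hs.2)

/-- The infimum yields a smaller admissible point, and monotonicity of `j₁` carries the inequality
up to `s`. -/
theorem j₁_lt_one (hEps : p.HipEps1) {s : ℝ} (hs : p.s₁ < s) : p.j₁ s < 1 := by
  obtain ⟨t, ht⟩ := exists_j₁_lt hM hEps
  obtain ⟨t', ht', hlt⟩ := exists_lt_of_csInf_lt ⟨t, ht⟩ hs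
  exact (j₁_anti hM ht'.1 hlt.le).trans_lt ht'.2

theorem s₁_le_s₂ (hZ : p.HipZinfty) : p.s₁ ≤ p.s₂ := by
  obtain ⟨t, ht⟩ := exists_lt_j₂ hM hZ p.s₁
  exact le_csInf ⟨t, ht.1, ht.2.le⟩ fun s hs => hs.1

/-- Strict monotonicity of `j₂` is essential: if `j₂ s` equalled `B`, the strictly increasing `Zinf`
would only approach `B` and `rB` would not be a level point. -/
theorem lt_j₂ (hEps : p.HipEps1) (hZ : p.HipZinfty) {s : ℝ} (hs : p.s₂ < s) : p.B < p.j₂ s := by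
  obtain ⟨t, ht⟩ := exists_lt_j₂ hM hZ p.s₁
  have hne : {s₀ | p.s₁ ≤ s₀ ∧ p.B ≤ p.j₂ s₀}.Nonempty := ⟨t, ht.1, ht.2.le⟩
  obtain ⟨t', ht', hlt⟩ := exists_lt_of_csInf_lt hne hs
  exact ht'.2.trans_lt (j₂_strictMono hM ((s₁_pos hM hEps).trans_le ht'.1) hlt)

theorem r₁_spec (hEps : p.HipEps1) {s : ℝ} (hs : p.s₁ < s) :
    s < p.r₁ s ∧ p.ε₁ (p.r₁ s) s = 1 := by
  have h0 := (s₁_pos hM hEps).trans hs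
  obtain ⟨a, ha, hea⟩ := exists_one_le_ε₁ hM h0
  have hj := j₁_lt_one hM hEps hs
  rw [j₁_eq hM h0] at hj
  obtain ⟨b, heb, hb⟩ := (((tendsto_ε₁_atTop hM h0).eventually_lt_const hj).and
    (eventually_gt_atTop s)).exists
  obtain ⟨t, h1, h2, h3, -⟩ := exists_level (ε₁_strictAnti hM h0) (fun r hr =>
    ((continuousAt_ε₁ hM (q := (r, s)) ⟨h0, hr⟩).comp (f := fun r => (r, s))
      (by fun_prop)).continuousWithinAt) ha hea hb heb
  have : p.r₁ s = t := by rw [r₁, h3, csInf_Ioi]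
  rw [this]
  exact ⟨h1, h2⟩

theorem r₂_spec {s : ℝ} (h0 : 0 < s) : s < p.r₂ s ∧ p.ε₂ (p.r₂ s) s = 1 := by
  obtain ⟨a, ha, hea⟩ := exists_one_le_ε₂ hM h0
  obtain ⟨b, heb, hb⟩ := (((tendsto_ε₂_atTop hM h0).eventually_lt_const one_pos).and
    (eventually_gt_atTop s)).exists
  obtain ⟨t, h1, h2, h3, -⟩ := exists_level (ε₂_strictAnti hM h0) (fun r hr =>
    ((continuousAt_ε₂ hM (q := (r, s)) ⟨h0, hr⟩).comp (f := fun r => (r, s))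
      (by fun_prop)).continuousWithinAt) ha hea hb heb
  have : p.r₂ s = t := by rw [r₂, h3, csInf_Ioi]
  rw [this]
  exact ⟨h1, h2⟩

/-- The point `a` below level `B` is needed because `B` is an arbitrary real. For `B ≤ 0` the set
defining `rB` would be all of `(s, ∞)` and its infimum `s` would not be a level point. `HipXY` later
provides `a = rbar s`. -/
theorem rB_spec (hEps : p.HipEps1) (hZ : p.HipZinfty) {s : ℝ} (hs : p.s₂ < s) {a : ℝ}
    (ha : s < a) (hZa : p.Zinf a s < p.B) : a < p.rB s ∧ p.Zinf (p.rB s) s = p.B := by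
  have h0 := ((s₁_pos hM hEps).trans_le (s₁_le_s₂ hM hZ)).trans hs
  have hj := lt_j₂ hM hEps hZ hs
  rw [j₂_eq hM h0] at hj
  obtain ⟨b, heb, hb⟩ := (((tendsto_Zinf_atTop hM h0).eventually_const_lt hj).and
    (eventually_gt_atTop s)).exists
  obtain ⟨t, h1, h2, -, h3⟩ := exists_level (e := fun r => -p.Zinf r s) (c := -p.B)
    (Zinf_strictMono hM h0).neg (fun r hr =>
    ((continuousAt_Zinf hM (q := (r, s)) ⟨h0, hr⟩).comp (f := fun r => (r, s))
      (by fun_prop)).neg.continuousWithinAt) ha (by linarith) hb (by linarith)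
  simp only [neg_le_neg_iff, neg_inj] at h2 h3
  have : p.rB s = t := by rw [rB, h3, csInf_Ici]
  rw [this]
  refine ⟨?_, h2⟩
  rw [← h2] at hZa
  exact ((Zinf_strictMono hM h0).lt_iff_lt ha h1).1 hZa

theorem continuousOn_rbar (hEps : p.HipEps1) : ContinuousOn p.rbar (Ioi p.s₁) := by
  have hpos : ∀ s ∈ Ioi p.s₁, 0 < s := fun s hs => (s₁_pos hM hEps).trans hs
  exact (continuousOn_level isOpen_Ioi hpos (fun s hs => ε₁_strictAnti hM (hpos s hs))
      (fun q hq => (continuousAt_ε₁ hM hq).continuousWithinAt)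
      (fun s hs => (r₁_spec hM hEps hs).1) fun s hs => (r₁_spec hM hEps hs).2).sup
    (continuousOn_level isOpen_Ioi hpos (fun s hs => ε₂_strictAnti hM (hpos s hs))
      (fun q hq => (continuousAt_ε₂ hM hq).continuousWithinAt)
      (fun s hs => (r₂_spec hM (hpos s hs)).1) fun s hs => (r₂_spec hM (hpos s hs)).2)

theorem lt_rbar (hEps : p.HipEps1) {s : ℝ} (hs : p.s₁ < s) : s < p.rbar s :=
  (r₁_spec hM hEps hs).1.trans_le (le_max_left _ _)

/-- The inequalities are not strict, since `r = rbar s` is included and one of the two bounds equals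
`1` there. -/
theorem ε_le_one (hEps : p.HipEps1) {s r : ℝ} (hs : p.s₁ < s) (hr : p.rbar s ≤ r) :
    p.ε₁ r s ≤ 1 ∧ p.ε₂ r s ≤ 1 := by
  have h0 := (s₁_pos hM hEps).trans hs
  obtain ⟨h1, h2⟩ := r₁_spec hM hEps hs
  obtain ⟨h3, h4⟩ := r₂_spec hM h0
  have hsr := (lt_rbar hM hEps hs).trans_le hr
  exact ⟨h2 ▸ (ε₁_strictAnti hM h0).antitoneOn h1 hsr ((le_max_left _ _).trans hr),
    h4 ▸ (ε₂_strictAnti hM h0).antitoneOn h3 hsr ((le_max_right _ _).trans hr)⟩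

end thresholds

end Contact

end

/-! ### The contraction on the line and uniqueness of the fixed point. -/

noncomputable section

open MeasureTheory

theorem abs_prim_le {φ : ℝ → ℝ} (hφ : Integrable φ) (h : ∀ v, 0 ≤ φ v) (η : ℝ) :
    |prim φ η| ≤ ∫ v, φ v :=
  (abs_of_nonneg (prim_nonneg h η)).trans_le (prim_le_integral hφ h η)

theorem abs_tail_le {φ : ℝ → ℝ} (hφ : Integrable φ) (h : ∀ v, 0 ≤ φ v) (η : ℝ) :
    |(∫ v, φ v) - prim φ η| ≤ ∫ v, φ v := by
  rw [abs_of_nonneg (sub_nonneg.2 (prim_le_integral hφ h η))]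
  exact sub_le_self _ (prim_nonneg h η)

theorem abs_prim_div_le {φ : ℝ → ℝ} (hφ : Integrable φ) (h : ∀ v, 0 ≤ φ v) (h0 : 0 < ∫ v, φ v)
    (η : ℝ) : |prim φ η / ∫ v, φ v| ≤ 1 := by
  rw [abs_div, abs_of_pos h0, div_le_one h0]
  exact abs_prim_le hφ h η

theorem zeroExt_measurable {S : Set ℝ} (hS : MeasurableSet S) {f : S → ℝ} (hf : Continuous f) :
    Measurable (zeroExt f) :=
  (MeasurableEmbedding.subtype_coe hS).measurable_extend hf.measurable measurable_zero

theorem zeroExt_apply {S : Set ℝ} (f : S → ℝ) {v : ℝ} (hv : v ∈ S) : zeroExt f v = f ⟨v, hv⟩ :=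
  Subtype.val_injective.extend_apply f 0 ⟨v, hv⟩

/-- Pairs of bounded continuous functions on the whole line. -/
abbrev LinePair : Type := (ℝ →ᵇ ℝ) × (ℝ →ᵇ ℝ)

/-- The restriction of a pair of functions on the line to `[s, r]` and `[r, ∞)`. -/
def restrictPair (r s : ℝ) (f : LinePair) : LiquidSpace r s × SolidSpace r :=
  (⟨fun η => f.1 η, f.1.continuous.comp continuous_subtype_val⟩,
    f.2.compContinuous ⟨Subtype.val, continuous_subtype_val⟩)

theorem zeroExt_restrictPair_fst {r s : ℝ} (f : LinePair) :
    ∀ v ∈ Ioc s r, zeroExt (restrictPair r s f).1 v = f.1 v := fun _ hv =>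
  zeroExt_apply _ (mem_Icc.2 ⟨hv.1.le, hv.2⟩)

theorem zeroExt_restrictPair_snd {r s : ℝ} (f : LinePair) :
    ∀ v ∈ Ioi r, zeroExt (restrictPair r s f).2 v = f.2 v := fun _ hv =>
  zeroExt_apply _ (mem_Ici.2 (le_of_lt hv))

theorem abs_apply_sub_le_norm {f g : LinePair} (v : ℝ) :
    |f.1 v - g.1 v| ≤ ‖f - g‖ ∧ |f.2 v - g.2 v| ≤ ‖f - g‖ :=
  ⟨((f.1 - g.1).norm_coe_le_norm v).trans (norm_fst_le (f - g)),
    ((f.2 - g.2).norm_coe_le_norm v).trans (norm_snd_le (f - g))⟩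

theorem norm_linePair_le {f : LinePair} {c : ℝ} (hc : 0 ≤ c) (h₁ : ∀ v, |f.1 v| ≤ c)
    (h₂ : ∀ v, |f.2 v| ≤ c) : ‖f‖ ≤ c :=
  norm_prod_le_iff.2 ⟨(BoundedContinuousFunction.norm_le hc).2 h₁,
    (BoundedContinuousFunction.norm_le hc).2 h₂⟩

namespace Contact

variable {p : Contact}

/-- The contraction constant of the system. -/
def cstar (p : Contact) (r s : ℝ) : ℝ := max (p.ε₁ r s / 2) (p.q₂ r s)

/-- The pairs `(r, s)` at which the operator is known to be a contraction. -/
def contractionSet (p : Contact) : Set (ℝ × ℝ) := {q | q ∈ pairs ∧ p.cstar q.1 q.2 < 1}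

/-- `f` is a fixed point of the operator extended to the whole line. -/
def IsLineSolution (p : Contact) (r s : ℝ) (f : LinePair) : Prop :=
  ⇑f.1 = p.tV₁ r s f.1 f.2 ∧ ⇑f.2 = p.tV₂ r s f.1 f.2

variable (hM : p.Model) {r s : ℝ} (hs : 0 < s) (hsr : s < r)
include hM hs hsr

section values

variable {f₁ f₂ : ℝ → ℝ} (hf₁ : Measurable f₁) (hf₂ : Measurable f₂)
include hf₁

theorem tV₁_continuous : Continuous (p.tV₁ r s f₁ f₂) := by
  have T := good₁ hM hs hsr hf₁ (f₂ := f₂)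
  exact (continuous_const.mul (continuous_const.sub (prim_continuous T.phiF_int))).add
    (continuous_const.mul (continuous_const.sub (prim_continuous T.gF_int)))

theorem exists_abs_tV₁_le : ∃ C, ∀ η, |p.tV₁ r s f₁ f₂ η| ≤ C := by
  have T := good₁ hM hs hsr hf₁ (f₂ := f₂)
  refine ⟨_, fun η => (abs_add_le _ _).trans (add_le_add
    ((abs_mul _ _).trans_le (mul_le_mul_of_nonneg_left
      (c := ∫ v, p.tφ₁ r s f₁ f₂ v) ?_ (abs_nonneg _)))
    ((abs_mul _ _).trans_le (mul_le_mul_of_nonneg_left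
      (c := ∫ v, p.tg₁ r s f₁ f₂ v) ?_ (abs_nonneg _))))⟩
  · exact abs_tail_le T.phiF_int T.phiF_nonneg η
  · exact abs_tail_le T.gF_int T.gF_nonneg η

include hf₂

theorem tV₂_continuous : Continuous (p.tV₂ r s f₁ f₂) := by
  have T := good₂ hM hs hsr hf₁ hf₂
  exact (continuous_const.mul ((prim_continuous T.phiF_int).div_const _)).sub
    (continuous_const.mul (prim_continuous T.gF_int))

theorem exists_abs_tV₂_le : ∃ C, ∀ η, |p.tV₂ r s f₁ f₂ η| ≤ C := by
  have T := good₂ hM hs hsr hf₁ hf₂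
  have hΦ := (Φ2infTop_pos hM hs hsr).trans_le (Φ2infTop_le hM hs hsr hf₁ hf₂)
  refine ⟨_, fun η => (abs_sub _ _).trans (add_le_add
    ((abs_mul _ _).trans_le (mul_le_mul_of_nonneg_left (c := 1) ?_ (abs_nonneg _)))
    ((abs_mul _ _).trans_le (mul_le_mul_of_nonneg_left
      (c := ∫ v, p.tg₂ r s f₁ f₂ v) ?_ (abs_nonneg _))))⟩
  · exact abs_prim_div_le T.phiF_int T.phiF_nonneg hΦ η
  · exact abs_prim_le T.gF_int T.gF_nonneg η

/-- The ratio tends to `1`, so with `Y = D₂* G₂(∞) / H²` the limit is `(Y - 1) - Y`. -/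
theorem tV₂_tendsto : Tendsto (p.tV₂ r s f₁ f₂) atTop (𝓝 (-1)) := by
  have T := good₂ hM hs hsr hf₁ hf₂
  have hΦ := (Φ2infTop_pos hM hs hsr).trans_le (Φ2infTop_le hM hs hsr hf₁ hf₂)
  have h := (((prim_tendsto T.phiF_int).div_const (∫ v, p.tφ₂ r s f₁ f₂ v)).const_mul
    (p.D₂s / p.tH r s f₁ f₂ ^ 2 * (∫ v, p.tg₂ r s f₁ f₂ v) - 1)).sub
    ((prim_tendsto T.gF_int).const_mul (p.D₂s / p.tH r s f₁ f₂ ^ 2))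
  refine (h.congr fun η => rfl).trans (le_of_eq ?_)
  congr 1
  change _ * ((∫ v, p.tφ₂ r s f₁ f₂ v) / _) - _ * (∫ v, p.tg₂ r s f₁ f₂ v) = _
  rw [div_self hΦ.ne']
  ring

omit hM hf₁ hf₂ hs in
theorem tV₂_left : p.tV₂ r s f₁ f₂ r = 0 := by
  rw [← V₂_eq f₁ f₂ hsr.le le_rfl, V₂]
  simp [Φ₂, G₂]

omit hM hf₁ hf₂ hs in
-- The densities vanish to the left of `s`. The face temperature can therefore be read off at the
-- fixed point `0` of the line, which does not move with `s`.
theorem tV₁_left {η : ℝ} (h : η ≤ s) : p.tV₁ r s f₁ f₂ η = p.tV₁ r s f₁ f₂ s := by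
  have key : ∀ φ : ℝ → ℝ, ∀ x ≤ s, prim ((Ioc s r).indicator φ) x = 0 := fun φ x hx => by
    refine setIntegral_eq_zero_of_forall_eq_zero fun v hv => indicator_of_notMem (fun h' => ?_) _
    exact absurd h'.1 (not_lt.2 ((mem_Iic.1 hv).trans hx))
  simp only [tV₁, tφ₁_eq f₁ f₂ hsr.le, tg₁_eq f₁ f₂ hsr.le, key _ _ h, key _ _ le_rfl]

end values

/-- The operator extended to the whole line, acting on pairs of bounded continuous functions. -/
def lineMap (f : LinePair) : LinePair :=
  (BoundedContinuousFunction.ofNormedAddCommGroup (p.tV₁ r s f.1 f.2)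
      (tV₁_continuous hM hs hsr f.1.continuous.measurable) _
      (exists_abs_tV₁_le hM hs hsr f.1.continuous.measurable).choose_spec,
    BoundedContinuousFunction.ofNormedAddCommGroup (p.tV₂ r s f.1 f.2)
      (tV₂_continuous hM hs hsr f.1.continuous.measurable f.2.continuous.measurable) _
      (exists_abs_tV₂_le hM hs hsr f.1.continuous.measurable
        f.2.continuous.measurable).choose_spec)

theorem abs_tV_sub_le {f₁ f₂ g₁ g₂ : ℝ → ℝ} (hf₁ : Measurable f₁) (hf₂ : Measurable f₂)
    (hg₁ : Measurable g₁) (hg₂ : Measurable g₂) {d : ℝ} (hd0 : 0 ≤ d)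
    (hd₁ : ∀ v ∈ Ioc s r, |f₁ v - g₁ v| ≤ d) (hd₂ : ∀ v ∈ Ioi r, |f₂ v - g₂ v| ≤ d) (η : ℝ) :
    |p.tV₁ r s f₁ f₂ η - p.tV₁ r s g₁ g₂ η| ≤ d * p.cstar r s ∧
      |p.tV₂ r s f₁ f₂ η - p.tV₂ r s g₁ g₂ η| ≤ d * p.cstar r s :=
  ⟨(abs_tV₁_sub_le hM hs hsr hf₁ hf₂ hg₁ hg₂ hd0 hd₁ hd₂ η).trans
      (mul_le_mul_of_nonneg_left (le_max_left _ _) hd0),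
    (abs_tV₂_sub_le hM hs hsr hf₁ hf₂ hg₁ hg₂ hd0 hd₁ hd₂ η).trans
      (mul_le_mul_of_nonneg_left (le_max_right _ _) hd0)⟩

theorem abs_tV_linePair_sub_le (f g : LinePair) (η : ℝ) :
    |p.tV₁ r s f.1 f.2 η - p.tV₁ r s g.1 g.2 η| ≤ ‖f - g‖ * p.cstar r s ∧
      |p.tV₂ r s f.1 f.2 η - p.tV₂ r s g.1 g.2 η| ≤ ‖f - g‖ * p.cstar r s :=
  abs_tV_sub_le hM hs hsr f.1.continuous.measurable f.2.continuous.measurable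
    g.1.continuous.measurable g.2.continuous.measurable (norm_nonneg _)
    (fun v _ => (abs_apply_sub_le_norm v).1) (fun v _ => (abs_apply_sub_le_norm v).2) η

theorem cstar_nonneg : 0 ≤ p.cstar r s := by
  have h := (abs_nonneg _).trans (abs_tV_sub_le hM hs hsr (measurable_const (a := 0))
    (measurable_const (a := 0)) (measurable_const (a := 0)) (measurable_const (a := 0)) zero_le_one
    (by simp) (by simp) 0).1
  rwa [one_mul] at h

/-- Banach's theorem in a complete space that does not depend on `(r, s)`. The conditions defining
`ℳ` need not be imposed: every value of the operator satisfies them. -/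
theorem exists_isLineSolution (hc : p.cstar r s < 1) : ∃ f, p.IsLineSolution r s f := by
  have hcon : ContractingWith (p.cstar r s).toNNReal (lineMap hM hs hsr) := by
    refine ⟨by rwa [Real.toNNReal_lt_one], LipschitzWith.of_dist_le_mul fun f g => ?_⟩
    rw [dist_eq_norm, dist_eq_norm, Real.coe_toNNReal _ (cstar_nonneg hM hs hsr), mul_comm]
    exact norm_linePair_le (mul_nonneg (norm_nonneg _) (cstar_nonneg hM hs hsr))
      (fun v => (abs_tV_linePair_sub_le hM hs hsr f g v).1)
      (fun v => (abs_tV_linePair_sub_le hM hs hsr f g v).2)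
  have h := hcon.fixedPoint_isFixedPt
  refine ⟨hcon.fixedPoint _, ?_, ?_⟩
  · conv_lhs => rw [← h]
    rfl
  · conv_lhs => rw [← h]
    rfl

section transfer

variable {f : LinePair} (hf : p.IsLineSolution r s f)
include hf

theorem IsLineSolution.isFixedPoint : p.IsFixedPoint r s (restrictPair r s f) := by
  have m₁ := f.1.continuous.measurable
  have m₂ := f.2.continuous.measurable
  refine ⟨⟨?_, ?_⟩, Prod.ext ?_ ?_⟩
  · change f.2 r = 0
    rw [hf.2, tV₂_left hsr]
  · have h := tV₂_tendsto hM hs hsr m₁ m₂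
    rw [← hf.2] at h
    exact tendsto_comp_val_Ici_atTop.2 h
  · funext η
    change p.V₁ r s _ _ η = f.1 η
    rw [V₁_eq _ _ hsr.le η.2.1 η.2.2, tV₁_congr (zeroExt_restrictPair_fst f)
      (zeroExt_restrictPair_snd f), ← hf.1]
  · funext η
    change p.V₂ r s _ _ η = f.2 η
    rw [V₂_eq _ _ hsr.le η.2, tV₂_congr (zeroExt_restrictPair_fst f)
      (zeroExt_restrictPair_snd f), ← hf.2]

end transfer

/-- The Lipschitz estimates need only measurable states and closeness inside the zones. They apply
to zero extensions and give `‖f - g‖ ≤ c ‖f - g‖` with `c < 1`. -/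
theorem IsFixedPoint.eq (hc : p.cstar r s < 1) {f g : LiquidSpace r s × SolidSpace r}
    (hf : p.IsFixedPoint r s f) (hg : p.IsFixedPoint r s g) : f = g := by
  have mf₁ := zeroExt_measurable measurableSet_Icc f.1.continuous
  have mf₂ := zeroExt_measurable measurableSet_Ici f.2.continuous
  have mg₁ := zeroExt_measurable measurableSet_Icc g.1.continuous
  have mg₂ := zeroExt_measurable measurableSet_Ici g.2.continuous
  have b₁ : ∀ v : Icc s r, |f.1 v - g.1 v| ≤ ‖f - g‖ := fun v =>
    ((f.1 - g.1).norm_coe_le_norm v).trans (norm_fst_le (f - g))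
  have b₂ : ∀ v : Ici r, |f.2 v - g.2 v| ≤ ‖f - g‖ := fun v =>
    ((f.2 - g.2).norm_coe_le_norm v).trans (norm_snd_le (f - g))
  have key := abs_tV_sub_le hM hs hsr mf₁ mf₂ mg₁ mg₂ (norm_nonneg (f - g))
    (fun v hv => by
      have hv' : v ∈ Icc s r := ⟨hv.1.le, hv.2⟩
      rw [zeroExt_apply _ hv', zeroExt_apply _ hv']; exact b₁ _)
    (fun v hv => by
      have hv' : v ∈ Ici r := mem_Ici.2 (le_of_lt hv)
      rw [zeroExt_apply _ hv', zeroExt_apply _ hv']; exact b₂ _)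
  have h0 := mul_nonneg (norm_nonneg (f - g)) (cstar_nonneg hM hs hsr)
  have hle : ‖f - g‖ ≤ ‖f - g‖ * p.cstar r s := by
    refine norm_prod_le_iff.2 ⟨(ContinuousMap.norm_le _ h0).2 fun η => ?_,
      (BoundedContinuousFunction.norm_le h0).2 fun η => ?_⟩
    · have h1 := congrFun (congrArg Prod.fst hf.2) η
      have h2 := congrFun (congrArg Prod.fst hg.2) η
      simp only [Ψ, V₁_eq _ _ hsr.le η.2.1 η.2.2] at h1 h2
      change |f.1 η - g.1 η| ≤ _
      rw [← h1, ← h2]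
      exact (key η).1
    · have h1 := congrFun (congrArg Prod.snd hf.2) η
      have h2 := congrFun (congrArg Prod.snd hg.2) η
      simp only [Ψ, V₂_eq _ _ hsr.le η.2] at h1 h2
      change |f.2 η - g.2 η| ≤ _
      rw [← h1, ← h2]
      exact (key η).2
  have := norm_nonneg (f - g)
  exact sub_eq_zero.1 (norm_eq_zero.1 (by nlinarith))

end Contact

end

/-! ### Continuous dependence of the fixed point on `(r, s)`. -/

noncomputable section

open MeasureTheory

/-- Dominated convergence in `L¹`. -/
theorem tendstoL1_of_dominated {ι : Type*} {L : Filter ι} [L.IsCountablyGenerated]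
    {F : ι → ℝ → ℝ} {f b : ℝ → ℝ} (hF : ∀ᶠ i in L, Measurable (F i)) (hf : Measurable f)
    (hb : Integrable b) (hFb : ∀ᶠ i in L, ∀ v, |F i v| ≤ b v) (hfb : ∀ v, |f v| ≤ b v)
    (hlim : ∀ᵐ v, Tendsto (fun i => F i v) L (𝓝 (f v))) : TendstoL1 F L f := by
  have h := tendsto_integral_filter_of_dominated_convergence (μ := volume)
    (F := fun i v => |F i v - f v|) (f := fun _ => 0) (l := L) (fun v => b v + b v)
    (hF.mono fun i hi => ((hi.sub hf).abs).aestronglyMeasurable)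
    (hFb.mono fun i hi => Eventually.of_forall fun v => by
      rw [Real.norm_eq_abs, abs_abs]
      exact (abs_sub _ _).trans (add_le_add (hi v) (hfb v)))
    (hb.add hb) (hlim.mono fun v hv => by
      have := (hv.sub_const (f v)).abs
      simpa using this)
  rwa [integral_zero] at h

theorem tendsto_indicator {ι : Type*} {L : Filter ι} {S : ι → Set ℝ} {S₀ : Set ℝ}
    {ψ : ι → ℝ → ℝ} {ψ₀ : ℝ → ℝ} {v : ℝ} (hS : ∀ᶠ i in L, (v ∈ S i ↔ v ∈ S₀))
    (h : v ∈ S₀ → Tendsto (fun i => ψ i v) L (𝓝 (ψ₀ v))) :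
    Tendsto (fun i => (S i).indicator (ψ i) v) L (𝓝 (S₀.indicator ψ₀ v)) := by
  by_cases hv : v ∈ S₀
  · rw [indicator_of_mem hv]
    refine (h hv).congr' ?_
    filter_upwards [hS] with i hi
    rw [indicator_of_mem (hi.2 hv)]
  · rw [indicator_of_notMem hv]
    refine tendsto_const_nhds.congr' ?_
    filter_upwards [hS] with i hi
    rw [indicator_of_notMem (fun h' => hv (hi.1 h'))]

namespace Contact

variable {p : Contact} {z : Zone}

namespace Coeffs

variable (C : p.Coeffs z) {ι : Type*} {L : Filter ι} [L.IsCountablyGenerated] {ℓ : ℝ}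
  {S : ι → Set ℝ} {S₀ : Set ℝ} (hS : ∀ᶠ i in L, RightOf ℓ (S i)) (hS₀ : RightOf ℓ S₀)
  (hmem : ∀ᵐ v, ∀ᶠ i in L, (v ∈ S i ↔ v ∈ S₀)) {f : ι → ℝ → ℝ} {f₀ : ℝ → ℝ}
  (hf : ∀ i, Measurable (f i)) (hf₀ : Measurable f₀)
  (hlim : ∀ v, Tendsto (fun i => f i v) L (𝓝 (f₀ v)))
include C hS hS₀ hmem hf hf₀ hlim

omit [L.IsCountablyGenerated] hS hS₀ hmem hf hf₀ in
theorem tendsto_coeffs {v : ℝ} (hv : 0 < v) :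
    Tendsto (fun i => p.L v (f i v)) L (𝓝 (p.L v (f₀ v))) ∧
    Tendsto (fun i => p.N v (f i v)) L (𝓝 (p.N v (f₀ v))) ∧
    Tendsto (fun i => p.K v (f i v)) L (𝓝 (p.K v (f₀ v))) :=
  ⟨((continuous_of_abs_sub_le fun x y => C.L_lip v x y hv).tendsto _).comp (hlim v),
    ((continuous_of_abs_sub_le fun x y => C.N_lip v x y hv).tendsto _).comp (hlim v),
    ((continuous_of_abs_sub_le fun x y => C.K_lip v x y hv).tendsto _).comp (hlim v)⟩

theorem tendstoL1_zl : TendstoL1 (fun i => p.zl (S i) (f i)) L (p.zl S₀ f₀) := by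
  refine tendstoL1_of_dominated (hS.mono fun i hi => C.zl_meas hi (hf i)) (C.zl_meas hS₀ hf₀)
    ((tailPow_int C.κ_pos hS₀.pos).const_mul (1 / z.Lm)) (hS.mono fun i hi v => ?_) (fun v => ?_)
    (hmem.mono fun v hv => tendsto_indicator hv fun h => ?_)
  · rw [abs_of_nonneg (C.zl_nonneg hi v)]
    exact C.zl_le hi v
  · rw [abs_of_nonneg (C.zl_nonneg hS₀ v)]
    exact C.zl_le hS₀ v
  · have h0 := hS₀.pos_of_mem h
    obtain ⟨h1, -, -⟩ := C.tendsto_coeffs hlim h0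
    have := C.L_pos h0 (x := f₀ v)
    exact tendsto_const_nhds.div (h1.mul_const _) (by positivity)

theorem tendstoL1_zk : TendstoL1 (fun i => p.zk (S i) (f i)) L (p.zk S₀ f₀) := by
  refine tendstoL1_of_dominated (hS.mono fun i hi => C.zk_meas hi (hf i)) (C.zk_meas hS₀ hf₀)
    ((tailPow_int C.κ_pos hS₀.pos).const_mul z.KM) (hS.mono fun i hi v => ?_) (fun v => ?_)
    (hmem.mono fun v hv => tendsto_indicator hv fun h => ?_)
  · rw [abs_of_nonneg (C.zk_nonneg hi v)]
    exact C.zk_le hi v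
  · rw [abs_of_nonneg (C.zk_nonneg hS₀ v)]
    exact C.zk_le hS₀ v
  · obtain ⟨-, -, h1⟩ := C.tendsto_coeffs hlim (hS₀.pos_of_mem h)
    exact h1.div_const _

theorem tendstoL1_zw {h : ι → ℝ} {h₀ : ℝ} (hh : Tendsto h L (𝓝 h₀)) (hpos : 0 < h₀) :
    TendstoL1 (fun i => p.zw z (S i) (h i) (f i)) L (p.zw z S₀ h₀ f₀) := by
  have hh2 : ∀ᶠ i in L, h₀ / 2 ≤ h i := hh.eventually_const_le (half_lt_self hpos)
  have h2 := half_pos hpos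
  refine tendstoL1_of_dominated (hS.mono fun i hi => C.zw_meas hi (hf i) _) (C.zw_meas hS₀ hf₀ _)
    (C.zw_bound_int hS₀.pos (2 * p.a * z.NM / z.Lm) (z.D / (h₀ / 2) * (z.KM / z.Lm)))
    ((hS.and hh2).mono fun i hi v => ?_) (fun v => ?_)
    (hmem.mono fun v hv => tendsto_indicator hv fun h => ?_)
  · rw [abs_of_nonneg (C.zw_nonneg hi.1 (h2.trans_le hi.2) v)]
    exact C.zw_le hi.1 h2 hi.2 v
  · rw [abs_of_nonneg (C.zw_nonneg hS₀ hpos v)]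
    exact C.zw_le hS₀ h2 (half_le_self hpos.le) v
  · have h0 := hS₀.pos_of_mem h
    obtain ⟨h1, h3, h4⟩ := C.tendsto_coeffs hlim h0
    have := C.L_pos h0 (x := f₀ v)
    exact ((h3.div h1 this.ne').const_mul _).add ((tendsto_const_nhds.div hh hpos.ne').mul
      (h4.div (h1.mul_const _) (by positivity)))

end Coeffs

section convergence

variable (hM : p.Model) {ι : Type*} {L : Filter ι} [L.IsCountablyGenerated] {r s : ι → ℝ}
  {r₀ s₀ : ℝ} (hr : Tendsto r L (𝓝 r₀)) (hs : Tendsto s L (𝓝 s₀)) (h0 : 0 < s₀) (h1 : s₀ < r₀)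

include hr hs h0 h1

omit [L.IsCountablyGenerated] in
theorem eventually_lt : ∀ᶠ i in L, 0 < s i ∧ s i < r i :=
  (hs.eventually_const_lt h0).and (hs.eventually_lt hr h1)

omit [L.IsCountablyGenerated] h1 in
-- Membership can fail to stabilise only at the limiting endpoints `s₀` and `r₀`, a null set.
theorem eventually_mem_Ioc_iff :
    ∀ᵐ v : ℝ, ∀ᶠ i in L, (v ∈ Ioc (s i) (r i) ↔ v ∈ Ioc s₀ r₀) := by
  filter_upwards [compl_mem_ae_iff.2 (measure_singleton s₀),
    compl_mem_ae_iff.2 (measure_singleton r₀)] with v hv hv'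
  have e1 : ∀ᶠ i in L, (s i < v ↔ s₀ < v) := by
    rcases lt_or_gt_of_ne hv with h | h
    · filter_upwards [hs.eventually_const_lt h] with i hi
      exact ⟨fun h' => absurd h' hi.not_gt, fun h' => absurd h' h.not_gt⟩
    · filter_upwards [hs.eventually_lt_const h] with i hi
      exact ⟨fun _ => h, fun _ => hi⟩
  have e2 : ∀ᶠ i in L, (v ≤ r i ↔ v ≤ r₀) := by
    rcases lt_or_gt_of_ne hv' with h | h
    · filter_upwards [hr.eventually_const_lt h] with i hi
      exact ⟨fun _ => h.le, fun _ => hi.le⟩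
    · filter_upwards [hr.eventually_lt_const h] with i hi
      exact ⟨fun h' => absurd h' hi.not_ge, fun h' => absurd h' h.not_ge⟩
  filter_upwards [e1, e2] with i h1 h2
  rw [mem_Ioc, mem_Ioc, h1, h2]

omit [L.IsCountablyGenerated] hs h0 h1 in
theorem eventually_mem_Ioi_iff : ∀ᵐ v : ℝ, ∀ᶠ i in L, (v ∈ Ioi (r i) ↔ v ∈ Ioi r₀) := by
  filter_upwards [compl_mem_ae_iff.2 (measure_singleton r₀)] with v hv
  rcases lt_or_gt_of_ne hv with h | h
  · filter_upwards [hr.eventually_const_lt h] with i hi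
    exact ⟨fun h' => absurd h' hi.not_gt, fun h' => absurd h' h.not_gt⟩
  · filter_upwards [hr.eventually_lt_const h] with i hi
    exact ⟨fun _ => h, fun _ => hi⟩

omit [L.IsCountablyGenerated] hr h1 in
-- The moving intervals eventually lie to the right of `s₀ / 2`, so one tail power dominates all
-- densities.
theorem eventually_rightOf_Ioc : (∀ᶠ i in L, RightOf (s₀ / 2) (Ioc (s i) (r i))) ∧
    RightOf (s₀ / 2) (Ioc s₀ r₀) := by
  have h2 := half_lt_self h0
  exact ⟨(hs.eventually_const_lt h2).mono fun i hi =>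
    ⟨half_pos h0, measurableSet_Ioc, fun v hv => hi.trans hv.1⟩,
    ⟨half_pos h0, measurableSet_Ioc, fun v hv => h2.trans hv.1⟩⟩

omit [L.IsCountablyGenerated] hs in
theorem eventually_rightOf_Ioi : (∀ᶠ i in L, RightOf (s₀ / 2) (Ioi (r i))) ∧
    RightOf (s₀ / 2) (Ioi r₀) := by
  have h2 := (half_lt_self h0).trans h1
  exact ⟨(hr.eventually_const_lt h2).mono fun i hi =>
    ⟨half_pos h0, measurableSet_Ioi, fun v hv => hi.trans hv⟩,
    ⟨half_pos h0, measurableSet_Ioi, fun v hv => h2.trans hv⟩⟩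

variable {f₁ f₂ : ι → ℝ → ℝ} {g₁ g₂ : ℝ → ℝ} (hf₁ : ∀ i, Measurable (f₁ i))
  (hf₂ : ∀ i, Measurable (f₂ i)) (hg₁ : Measurable g₁) (hg₂ : Measurable g₂)
  (hl₁ : ∀ v, Tendsto (fun i => f₁ i v) L (𝓝 (g₁ v)))
  (hl₂ : ∀ v, Tendsto (fun i => f₂ i v) L (𝓝 (g₂ v)))
include hM hf₁ hf₂ hg₁ hg₂ hl₁ hl₂

/-- `L¹` convergence of the building blocks `l`, `k` in both zones. -/
theorem tendstoL1_blocks :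
    TendstoL1 (fun i => p.zl (Ioc (s i) (r i)) (f₁ i)) L (p.zl (Ioc s₀ r₀) g₁) ∧
    TendstoL1 (fun i => p.zk (Ioc (s i) (r i)) (f₁ i)) L (p.zk (Ioc s₀ r₀) g₁) ∧
    TendstoL1 (fun i => p.zl (Ioi (r i)) (f₂ i)) L (p.zl (Ioi r₀) g₂) ∧
    TendstoL1 (fun i => p.zk (Ioi (r i)) (f₂ i)) L (p.zk (Ioi r₀) g₂) := by
  obtain ⟨a1, a2⟩ := eventually_rightOf_Ioc (r := r) (r₀ := r₀) hs h0
  obtain ⟨b1, b2⟩ := eventually_rightOf_Ioi hr h0 h1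
  have a3 := eventually_mem_Ioc_iff hr hs h0
  have b3 := eventually_mem_Ioi_iff hr
  exact ⟨hM.C₁.tendstoL1_zl a1 a2 a3 hf₁ hg₁ hl₁, hM.C₁.tendstoL1_zk a1 a2 a3 hf₁ hg₁ hl₁,
    hM.C₂.tendstoL1_zl b1 b2 b3 hf₂ hg₂ hl₂, hM.C₂.tendstoL1_zk b1 b2 b3 hf₂ hg₂ hl₂⟩

omit [L.IsCountablyGenerated] hl₁ hl₂ hg₁ hg₂ in
theorem eventually_good : (∀ᶠ i in L, GoodTriple (p.tw₁ (r i) (s i) (f₁ i) (f₂ i))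
      (p.zl (Ioc (s i) (r i)) (f₁ i)) (p.zk (Ioc (s i) (r i)) (f₁ i))) ∧
    ∀ᶠ i in L, GoodTriple (p.tw₂ (r i) (s i) (f₁ i) (f₂ i))
      (p.zl (Ioi (r i)) (f₂ i)) (p.zk (Ioi (r i)) (f₂ i)) :=
  ⟨(eventually_lt hr hs h0 h1).mono fun i hi => good₁ hM hi.1 hi.2 (hf₁ i),
    (eventually_lt hr hs h0 h1).mono fun i hi => good₂ hM hi.1 hi.2 (hf₁ i) (hf₂ i)⟩

theorem tendsto_tH : Tendsto (fun i => p.tH (r i) (s i) (f₁ i) (f₂ i)) L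
    (𝓝 (p.tH r₀ s₀ g₁ g₂)) := by
  obtain ⟨-, a, -, b⟩ := tendstoL1_blocks hM hr hs h0 h1 hf₁ hf₂ hg₁ hg₂ hl₁ hl₂
  obtain ⟨c, d⟩ := eventually_good hM hr hs h0 h1 hf₁ hf₂
  exact (a.tendsto_integral (c.mono fun i h => h.k_int) (good₁ hM h0 h1 hg₁ (f₂ := g₂)).k_int).add
    (b.tendsto_integral (d.mono fun i h => h.k_int) (good₂ hM h0 h1 hg₁ hg₂).k_int)

omit hM hf₁ hf₂ hg₂ hl₁ hl₂ hr hs [L.IsCountablyGenerated] in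
theorem tH_pos (hM : p.Model) : 0 < p.tH r₀ s₀ g₁ g₂ :=
  (Hinf_pos hM h0 h1).trans_le (Hinf_le_tH hM h0 h1 hg₁)

/-- `L¹` convergence of the exponents. -/
theorem tendstoL1_tw :
    TendstoL1 (fun i => p.tw₁ (r i) (s i) (f₁ i) (f₂ i)) L (p.tw₁ r₀ s₀ g₁ g₂) ∧
    TendstoL1 (fun i => p.tw₂ (r i) (s i) (f₁ i) (f₂ i)) L (p.tw₂ r₀ s₀ g₁ g₂) := by
  obtain ⟨a1, a2⟩ := eventually_rightOf_Ioc (r := r) (r₀ := r₀) hs h0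
  obtain ⟨b1, b2⟩ := eventually_rightOf_Ioi hr h0 h1
  have a3 := eventually_mem_Ioc_iff hr hs h0
  have b3 := eventually_mem_Ioi_iff hr
  have hH := tendsto_tH hM hr hs h0 h1 hf₁ hf₂ hg₁ hg₂ hl₁ hl₂
  have hp := tH_pos h0 h1 hg₁ hM (g₂ := g₂)
  exact ⟨hM.C₁.tendstoL1_zw a1 a2 a3 hf₁ hg₁ hl₁ hH hp, hM.C₂.tendstoL1_zw b1 b2 b3 hf₂ hg₂ hl₂ hH hp⟩

/-- `L¹` convergence of the densities of `Φ`, `H_i` and `G`. -/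
theorem tendstoL1_densities :
    (TendstoL1 (fun i => p.tφ₁ (r i) (s i) (f₁ i) (f₂ i)) L (p.tφ₁ r₀ s₀ g₁ g₂) ∧
    TendstoL1 (fun i => p.th₁ (r i) (s i) (f₁ i) (f₂ i)) L (p.th₁ r₀ s₀ g₁ g₂) ∧
    TendstoL1 (fun i => p.tg₁ (r i) (s i) (f₁ i) (f₂ i)) L (p.tg₁ r₀ s₀ g₁ g₂)) ∧
    TendstoL1 (fun i => p.tφ₂ (r i) (s i) (f₁ i) (f₂ i)) L (p.tφ₂ r₀ s₀ g₁ g₂) ∧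
    TendstoL1 (fun i => p.tg₂ (r i) (s i) (f₁ i) (f₂ i)) L (p.tg₂ r₀ s₀ g₁ g₂) := by
  obtain ⟨l1, k1, l2, k2⟩ := tendstoL1_blocks hM hr hs h0 h1 hf₁ hf₂ hg₁ hg₂ hl₁ hl₂
  obtain ⟨w1, w2⟩ := tendstoL1_tw hM hr hs h0 h1 hf₁ hf₂ hg₁ hg₂ hl₁ hl₂
  obtain ⟨T1, T2⟩ := eventually_good hM hr hs h0 h1 hf₁ hf₂
  have U1 := good₁ hM h0 h1 hg₁ (f₂ := g₂)
  have U2 := good₂ hM h0 h1 hg₁ hg₂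
  exact ⟨⟨tendstoL1_phiF T1 U1 w1 l1, tendstoL1_hF T1 U1 w1 k1, tendstoL1_gF T1 U1 w1 l1 k1⟩,
    tendstoL1_phiF T2 U2 w2 l2, tendstoL1_gF T2 U2 w2 l2 k2⟩

/-- The boundary term in the second free-boundary equation is continuous. -/
theorem tendsto_tW : Tendsto (fun i => p.tW (r i) (s i) (f₁ i) (f₂ i)) L
    (𝓝 (p.tW r₀ s₀ g₁ g₂)) := by
  obtain ⟨T1, T2⟩ := eventually_good hM hr hs h0 h1 hf₁ hf₂
  have U1 := good₁ hM h0 h1 hg₁ (f₂ := g₂)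
  have U2 := good₂ hM h0 h1 hg₁ hg₂
  have hH := tendsto_tH hM hr hs h0 h1 hf₁ hf₂ hg₁ hg₂ hl₁ hl₂
  have hp := tH_pos h0 h1 hg₁ hM (g₂ := g₂)
  obtain ⟨w1, -⟩ := tendstoL1_tw hM hr hs h0 h1 hf₁ hf₂ hg₁ hg₂ hl₁ hl₂
  obtain ⟨⟨-, d1, -⟩, d2, d3⟩ := tendstoL1_densities hM hr hs h0 h1 hf₁ hf₂ hg₁ hg₂ hl₁ hl₂
  have hE : Tendsto (fun i => expE (p.tw₁ (r i) (s i) (f₁ i) (f₂ i)) (r i)) L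
      (𝓝 (expE (p.tw₁ r₀ s₀ g₁ g₂) r₀)) := by
    have := (tendsto_expE T1 U1 w1 r).add ((U1.expE_continuous.tendsto r₀).comp hr)
    simpa using this
  have i1 := d1.tendsto_integral (T1.mono fun i h => h.hF_int) U1.hF_int
  have i2 := d2.tendsto_integral (T2.mono fun i h => h.phiF_int) U2.phiF_int
  have i3 := d3.tendsto_integral (T2.mono fun i h => h.gF_int) U2.gF_int
  have hΦ := (Φ2infTop_pos hM h0 h1).trans_le (Φ2infTop_le hM h0 h1 hg₁ hg₂)
  have hsν := hs.rpow_const (p := p.ν) (Or.inl h0.ne')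
  have hr0 := h0.trans h1
  have hrν := hr.rpow_const (p := p.ν + 1) (Or.inl hr0.ne')
  have hexp : Tendsto (fun i => p.Q * Real.exp (-s i ^ 2)) L (𝓝 (p.Q * Real.exp (-s₀ ^ 2))) :=
    ((Real.continuous_exp.tendsto _).comp (hs.pow 2).neg).const_mul _
  have hc : ∀ c : ℝ, Tendsto (fun i => c / p.tH (r i) (s i) (f₁ i) (f₂ i) ^ 2) L
      (𝓝 (c / p.tH r₀ s₀ g₁ g₂ ^ 2)) := fun c =>
    tendsto_const_nhds.div (hH.pow 2) (pow_pos hp 2).ne'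
  exact (((hE.mul ((hexp.mul hsν).add ((hc _).mul i1))).sub
    ((tendsto_const_nhds.div i2 hΦ.ne').mul (((hc _).mul i3).const_sub 1)))).div hrν
      (Real.rpow_pos_of_pos hr0 _).ne'

/-- The operator converges uniformly on the line. -/
theorem exists_uniform_bound : ∃ δ : ι → ℝ, Tendsto δ L (𝓝 0) ∧ ∀ᶠ i in L, ∀ η,
    |p.tV₁ (r i) (s i) (f₁ i) (f₂ i) η - p.tV₁ r₀ s₀ g₁ g₂ η| ≤ δ i ∧
    |p.tV₂ (r i) (s i) (f₁ i) (f₂ i) η - p.tV₂ r₀ s₀ g₁ g₂ η| ≤ δ i := by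
  obtain ⟨T1, T2⟩ := eventually_good hM hr hs h0 h1 hf₁ hf₂
  have U1 := good₁ hM h0 h1 hg₁ (f₂ := g₂)
  have U2 := good₂ hM h0 h1 hg₁ hg₂
  have hH := tendsto_tH hM hr hs h0 h1 hf₁ hf₂ hg₁ hg₂ hl₁ hl₂
  have hp := tH_pos h0 h1 hg₁ hM (g₂ := g₂)
  obtain ⟨⟨d0, -, d1⟩, d2, d3⟩ := tendstoL1_densities hM hr hs h0 h1 hf₁ hf₂ hg₁ hg₂ hl₁ hl₂
  have i2 := d2.tendsto_integral (T2.mono fun i h => h.phiF_int) U2.phiF_int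
  have i3 := d3.tendsto_integral (T2.mono fun i h => h.gF_int) U2.gF_int
  have hΦ := (Φ2infTop_pos hM h0 h1).trans_le (Φ2infTop_le hM h0 h1 hg₁ hg₂)
  have hsν := hs.rpow_const (p := p.ν) (Or.inl h0.ne')
  have hexp : Tendsto (fun i => Real.exp (-s i ^ 2)) L (𝓝 (Real.exp (-s₀ ^ 2))) :=
    (Real.continuous_exp.tendsto _).comp (hs.pow 2).neg
  have hc : ∀ c : ℝ, Tendsto (fun i => c / p.tH (r i) (s i) (f₁ i) (f₂ i) ^ 2) L
      (𝓝 (c / p.tH r₀ s₀ g₁ g₂ ^ 2)) := fun c =>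
    tendsto_const_nhds.div (hH.pow 2) (pow_pos hp 2).ne'
  have hb1 := (hsν.mul_const p.Q).mul hexp
  have hb2 := hc p.D₁s
  have hb3 := hc p.D₂s
  have hb4 := ((hb3.mul i3).sub_const 1).div i2 hΦ.ne'
  -- Each of `V₁`, `V₂` is a sum or difference of a scalar coefficient times a tail or primitive.
  -- The coefficients converge, and the `L¹` distance of the densities controls the other factor
  -- uniformly in `η`.
  have key : ∀ {a b : ι → ℝ} {a₀ : ℝ}, Tendsto a L (𝓝 a₀) → Tendsto b L (𝓝 0) → ∀ c : ℝ,
      Tendsto (fun i => |a i| * b i + |a i - a₀| * c) L (𝓝 0) := by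
    intro a b a₀ ha hb c
    simpa using (ha.abs.mul hb).add ((ha.sub_const a₀).abs.mul_const c)
  have mulbd : ∀ a a₀ x x₀ b c : ℝ, |x - x₀| ≤ b → |x₀| ≤ c →
      |a * x - a₀ * x₀| ≤ |a| * b + |a - a₀| * c := by
    intro a a₀ x x₀ b c hb hc
    have e : a * x - a₀ * x₀ = a * (x - x₀) + (a - a₀) * x₀ := by ring
    rw [e]
    refine (abs_add_le _ _).trans ?_
    rw [abs_mul, abs_mul]
    gcongr
  have t1 := key hb1 d0 (∫ v, p.tφ₁ r₀ s₀ g₁ g₂ v)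
  have t2 := key hb2 d1 (∫ v, p.tg₁ r₀ s₀ g₁ g₂ v)
  have t3 := key hb4 d2 (∫ v, p.tφ₂ r₀ s₀ g₁ g₂ v)
  have t4 := key hb3 d3 (∫ v, p.tg₂ r₀ s₀ g₁ g₂ v)
  have t5 := (t1.add t2).max (t3.add t4)
  rw [add_zero, max_self] at t5
  refine ⟨_, t5, ?_⟩
  filter_upwards [T1, T2] with i T1 T2 η
  constructor
  · refine le_trans ?_ (le_max_left _ _)
    have q1 := mulbd (s i ^ p.ν * p.Q * Real.exp (-s i ^ 2)) (s₀ ^ p.ν * p.Q * Real.exp (-s₀ ^ 2))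
      _ _ _ _ (abs_tail_sub_le T1.phiF_int U1.phiF_int η) (abs_tail_le U1.phiF_int U1.phiF_nonneg η)
    have q2 := mulbd (p.D₁s / p.tH (r i) (s i) (f₁ i) (f₂ i) ^ 2) (p.D₁s / p.tH r₀ s₀ g₁ g₂ ^ 2)
      _ _ _ _ (abs_tail_sub_le T1.gF_int U1.gF_int η) (abs_tail_le U1.gF_int U1.gF_nonneg η)
    refine le_trans (le_of_eq ?_) ((abs_add_le _ _).trans (add_le_add q1 q2))
    congr 1
    simp only [tV₁, tφ₁, tg₁]
    ring
  · refine le_trans ?_ (le_max_right _ _)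
    have q1 := mulbd ((p.D₂s / p.tH (r i) (s i) (f₁ i) (f₂ i) ^ 2 *
        (∫ v, p.tg₂ (r i) (s i) (f₁ i) (f₂ i) v) - 1) / ∫ v, p.tφ₂ (r i) (s i) (f₁ i) (f₂ i) v)
      ((p.D₂s / p.tH r₀ s₀ g₁ g₂ ^ 2 * (∫ v, p.tg₂ r₀ s₀ g₁ g₂ v) - 1) /
        ∫ v, p.tφ₂ r₀ s₀ g₁ g₂ v)
      _ _ _ _ (abs_prim_sub_le T2.phiF_int U2.phiF_int η) (abs_prim_le U2.phiF_int U2.phiF_nonneg η)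
    have q2 := mulbd (p.D₂s / p.tH (r i) (s i) (f₁ i) (f₂ i) ^ 2) (p.D₂s / p.tH r₀ s₀ g₁ g₂ ^ 2)
      _ _ _ _ (abs_prim_sub_le T2.gF_int U2.gF_int η) (abs_prim_le U2.gF_int U2.gF_nonneg η)
    refine le_trans (le_of_eq ?_) ((abs_sub _ _).trans (add_le_add q1 q2))
    congr 1
    simp only [tV₂, tφ₂, tg₂]
    ring

end convergence

section solutions

/-- The fixed point of the operator extended to the line, where there is one. -/
def lineSol (p : Contact) (q : ℝ × ℝ) : LinePair :=
  open Classical in if h : ∃ f, p.IsLineSolution q.1 q.2 f then h.choose else 0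

variable (hM : p.Model)
include hM

theorem isLineSolution_lineSol {q : ℝ × ℝ} (hq : q ∈ p.contractionSet) :
    p.IsLineSolution q.1 q.2 (p.lineSol q) := by
  have h := exists_isLineSolution hM hq.1.1 hq.1.2 hq.2
  rw [lineSol, dif_pos h]
  exact h.choose_spec

/-- Inserting the operator at `q'` applied to the fixed point `f` at `q` gives `‖f' - f‖ ≤ c ‖f' -
f‖ + δ`, hence `‖f' - f‖ ≤ δ / (1 - c)`. Here `c` is continuous and below `1`, and `δ → 0`. -/
theorem continuousAt_lineSol {q : ℝ × ℝ} (hq : q ∈ p.contractionSet) :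
    ContinuousAt p.lineSol q := by
  have h0 := hq.1.1
  have h1 := hq.1.2
  set f := p.lineSol q with hf
  have m₁ := f.1.continuous.measurable
  have m₂ := f.2.continuous.measurable
  obtain ⟨δ, hδ, hle⟩ := exists_uniform_bound hM (L := 𝓝 q) (continuous_fst.tendsto q)
    (continuous_snd.tendsto q) h0 h1 (fun _ => m₁) (fun _ => m₂) m₁ m₂
    (fun _ => tendsto_const_nhds) (fun _ => tendsto_const_nhds)
  have hc : ContinuousAt (fun q : ℝ × ℝ => p.cstar q.1 q.2) q :=
    ((continuousAt_ε₁ hM hq.1).div_const 2).sup (continuousAt_q₂ hM hq.1)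
  have hlt := hc.tendsto.eventually_lt_const hq.2
  have hb : Tendsto (fun q' : ℝ × ℝ => δ q' / (1 - p.cstar q'.1 q'.2)) (𝓝 q) (𝓝 (0 / _)) :=
    hδ.div (hc.tendsto.const_sub 1) (sub_pos.2 hq.2).ne'
  rw [zero_div] at hb
  rw [ContinuousAt, tendsto_iff_norm_sub_tendsto_zero]
  refine squeeze_zero' (Eventually.of_forall fun _ => norm_nonneg _) ?_ hb
  filter_upwards [hle, hlt, isOpen_pairs.mem_nhds hq.1] with q' h2 h3 h4
  obtain ⟨e1, e2⟩ := isLineSolution_lineSol hM (q := q') ⟨h4, h3⟩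
  obtain ⟨e3, e4⟩ := isLineSolution_lineSol hM hq
  have hδ0 : 0 ≤ δ q' := (abs_nonneg _).trans (h2 0).1
  have hcn := cstar_nonneg hM h4.1 h4.2
  have hn := norm_nonneg (p.lineSol q' - f)
  have key := abs_tV_linePair_sub_le hM h4.1 h4.2 (p.lineSol q') f
  rw [le_div_iff₀ (sub_pos.2 h3)]
  have hnorm : ‖p.lineSol q' - f‖ ≤ ‖p.lineSol q' - f‖ * p.cstar q'.1 q'.2 + δ q' := by
    refine norm_linePair_le (by positivity) (fun v => ?_) fun v => ?_
    · change |(p.lineSol q').1 v - f.1 v| ≤ _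
      rw [congrFun e1 v, congrFun e3 v]
      exact (abs_sub_le _ (p.tV₁ q'.1 q'.2 f.1 f.2 v) _).trans (add_le_add (key v).1 (h2 v).1)
    · change |(p.lineSol q').2 v - f.2 v| ≤ _
      rw [congrFun e2 v, congrFun e4 v]
      exact (abs_sub_le _ (p.tV₂ q'.1 q'.2 f.1 f.2 v) _).trans (add_le_add (key v).2 (h2 v).2)
  linarith

/-- The value of the liquid temperature at the contact face. -/
theorem continuousOn_face : ContinuousOn (fun q : ℝ × ℝ => p.tV₁ q.1 q.2 (p.lineSol q).1
    (p.lineSol q).2 q.2) p.contractionSet := by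
  -- The point `0` lies to the left of every `s`, where the solution is constant, so no evaluation
  -- at a moving point is needed.
  have h : ContinuousOn (fun q => (p.lineSol q).1 0) p.contractionSet := fun q hq =>
    ((continuous_eval_const (F := ℝ →ᵇ ℝ) (0 : ℝ)).continuousAt.comp
      (continuousAt_fst.comp (continuousAt_lineSol hM hq))).continuousWithinAt
  refine h.congr fun q hq => ?_
  change _ = (p.lineSol q).1 0
  rw [congrFun (isLineSolution_lineSol hM hq).1 0, tV₁_left hq.1.2 hq.1.1.le]

theorem continuousOn_tW : ContinuousOn (fun q : ℝ × ℝ => p.tW q.1 q.2 (p.lineSol q).1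
    (p.lineSol q).2) p.contractionSet := fun q hq => by
  have hc := continuousAt_lineSol hM hq
  exact ContinuousAt.continuousWithinAt (tendsto_tW hM (continuous_fst.tendsto q)
    (continuous_snd.tendsto q) hq.1.1 hq.1.2
    (fun _ => BoundedContinuousFunction.continuous _ |>.measurable)
    (fun _ => BoundedContinuousFunction.continuous _ |>.measurable)
    (BoundedContinuousFunction.continuous _).measurable
    (BoundedContinuousFunction.continuous _).measurable
    (fun v => (continuous_eval_const (F := ℝ →ᵇ ℝ) v).continuousAt.comp
      (continuousAt_fst.comp hc))
    (fun v => (continuous_eval_const (F := ℝ →ᵇ ℝ) v).continuousAt.comp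
      (continuousAt_snd.comp hc)))

end solutions

end Contact

end

/-! ### Lower bounds for `G`, and the bounds `Z_inf`, `W_inf`, `W_sup`. -/

noncomputable section

open MeasureTheory

/-- The integrand is the derivative of `(ℓ⁻¹ ^ q - v ^ (-q)) ^ 2 / (2 q)`. -/
theorem integral_rpow_mul_sub {q ℓ T : ℝ} (hq : 0 < q) (hℓ : 0 < ℓ) (hT : ℓ ≤ T) :
    ∫ v in ℓ..T, v ^ (-(q + 1)) * (ℓ⁻¹ ^ q - v⁻¹ ^ q) = (ℓ⁻¹ ^ q - T⁻¹ ^ q) ^ 2 / (2 * q) := by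
  have hpos : ∀ v ∈ uIcc ℓ T, 0 < v := fun v hv => by
    rw [uIcc_of_le hT] at hv; exact hℓ.trans_le hv.1
  have hd : ∀ v ∈ uIcc ℓ T, HasDerivAt (fun v : ℝ => (ℓ⁻¹ ^ q - v ^ (-q)) ^ 2 / (2 * q))
      (v ^ (-(q + 1)) * (ℓ⁻¹ ^ q - v⁻¹ ^ q)) v := fun v hv => by
    have h0 := hpos v hv
    have h := (((Real.hasDerivAt_rpow_const (p := -q) (Or.inl h0.ne')).const_sub
      (ℓ⁻¹ ^ q)).pow 2).div_const (2 * q)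
    refine h.congr_deriv ?_
    rw [Real.inv_rpow h0.le, ← Real.rpow_neg h0.le, show -(q + 1) = -q - 1 by ring]
    push_cast
    field_simp
  rw [intervalIntegral.integral_eq_sub_of_hasDerivAt hd]
  · rw [Real.rpow_neg hℓ.le, ← Real.inv_rpow hℓ.le, Real.rpow_neg (hℓ.trans_le hT).le,
      ← Real.inv_rpow (hℓ.trans_le hT).le]
    ring
  · refine ContinuousOn.intervalIntegrable fun v hv => ContinuousAt.continuousWithinAt ?_
    have h0 := hpos v hv
    exact (Real.continuousAt_rpow_const _ _ (Or.inl h0.ne')).mul (continuousAt_const.sub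
      ((continuousAt_inv₀ h0.ne').rpow_const (Or.inl (inv_pos.2 h0).ne')))

namespace Contact

variable {p : Contact} {z : Zone}

/-- The inner integral is bounded below by dropping its exponential, which is at most `1` and stands
in a denominator; only the outer exponential costs a factor `e`. The endpoint `T` is separate from
`S` so that an unbounded zone can be exhausted. -/
theorem Coeffs.integral_gF_ge (C : p.Coeffs z) {ℓ T : ℝ} {S : Set ℝ} (hS : RightOf ℓ S)
    (hT : Ioc ℓ T ⊆ S) (hℓT : ℓ ≤ T) {f : ℝ → ℝ} (hf : Measurable f) {h e : ℝ} (hh : 0 < h)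
    (hE : ∀ η, e ≤ expE (p.zw z S h f) η) :
    e * z.Km / (2 * z.LM * p.κ ^ 2) * (ℓ⁻¹ ^ p.κ - T⁻¹ ^ p.κ) ^ 2 ≤
      ∫ v, gF (p.zw z S h f) (p.zl S f) (p.zk S f) v := by
  have G := C.goodTriple hS hf hh
  have hκ := C.κ_pos
  have hLM := C.pos.LM
  have hKm := C.pos.Km
  have hk : ∀ v, ℓ ≤ v → v ≤ T → z.Km / p.κ * (ℓ⁻¹ ^ p.κ - v⁻¹ ^ p.κ) ≤
      prim (hF (p.zw z S h f) (p.zk S f)) v := fun v h1 h2 => by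
    have hfull := C.integral_zk_Ioc_ge hS.pos h1 hf
    refine hfull.trans ?_
    have hS' : RightOf ℓ (Ioc ℓ v) := ⟨hS.pos, measurableSet_Ioc, fun v hv => hv.1⟩
    rw [prim, ← integral_indicator measurableSet_Iic]
    refine integral_mono (C.goodTriple hS' hf one_pos).k_int
      (G.hF_int.indicator measurableSet_Iic) fun x => ?_
    refine indicator_apply_le' (fun hx => ?_) fun _ =>
      indicator_nonneg (fun x _ => G.hF_nonneg x) x
    rw [indicator_of_mem (mem_Iic.2 hx.2), hF, le_div_iff₀ (expE_pos _ _), zk,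
      indicator_of_mem (hT ⟨hx.1, hx.2.trans h2⟩)]
    have h0 := hS.pos.trans hx.1
    exact mul_le_of_le_one_right (div_nonneg (C.K_pos h0).le (Real.rpow_nonneg h0.le _))
      (G.expE_le_one x)
  have hb : IntegrableOn (fun v : ℝ => v ^ (-(p.κ + 1)) * (ℓ⁻¹ ^ p.κ - v⁻¹ ^ p.κ)) (Ioc ℓ T) := by
    refine (ContinuousOn.integrableOn_Icc fun v hv => ContinuousAt.continuousWithinAt ?_).mono_set
      Ioc_subset_Icc_self
    have h0 := hS.pos.trans_le hv.1
    exact (Real.continuousAt_rpow_const _ _ (Or.inl h0.ne')).mul (continuousAt_const.sub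
      ((continuousAt_inv₀ h0.ne').rpow_const (Or.inl (inv_pos.2 h0).ne')))
  have key : ∫ v in Ioc ℓ T, e * z.Km / (z.LM * p.κ) *
      (v ^ (-(p.κ + 1)) * (ℓ⁻¹ ^ p.κ - v⁻¹ ^ p.κ)) ≤
      ∫ v, gF (p.zw z S h f) (p.zl S f) (p.zk S f) v := by
    refine le_trans (setIntegral_mono_on (hb.const_mul _) G.gF_int.integrableOn measurableSet_Ioc
      fun v hv => ?_) (setIntegral_le_integral G.gF_int (Eventually.of_forall G.gF_nonneg))
    have h0 := hS.pos.trans hv.1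
    have h1 := hk v hv.1.le hv.2
    have h2 : 1 / z.LM * v ^ (-(p.κ + 1)) ≤ p.zl S f v := by
      rw [zl, indicator_of_mem (hT hv)]
      exact C.le_l h0
    have h3 : v⁻¹ ^ p.κ ≤ ℓ⁻¹ ^ p.κ :=
      Real.rpow_le_rpow (inv_pos.2 h0).le (inv_anti₀ hS.pos hv.1.le) hκ.le
    have h4 : 0 ≤ z.Km / p.κ * (ℓ⁻¹ ^ p.κ - v⁻¹ ^ p.κ) :=
      mul_nonneg (by positivity) (sub_nonneg.2 h3)
    have h5 : 0 ≤ v ^ (-(p.κ + 1)) := Real.rpow_nonneg h0.le _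
    calc _ = e * (1 / z.LM * v ^ (-(p.κ + 1))) *
          (z.Km / p.κ * (ℓ⁻¹ ^ p.κ - v⁻¹ ^ p.κ)) := by field_simp
      _ ≤ _ := mul_le_mul (mul_le_mul (hE v) h2 (by positivity) (expE_pos _ _).le) h1 h4
          (G.phiF_nonneg v)
  rw [integral_const_mul, ← intervalIntegral.integral_of_le hℓT,
    integral_rpow_mul_sub hκ hS.pos hℓT] at key
  refine le_trans (le_of_eq ?_) key
  field_simp

variable (hM : p.Model) {r s : ℝ} (hs : 0 < s) (hsr : s < r) {f₁ f₂ : ℝ → ℝ}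
  (hf₁ : Measurable f₁) (hf₂ : Measurable f₂)
include hM hs hsr hf₁

/-- The lower bound of `G₁` is divided by `Hsup ^ 2`. The powers of `κ` cancel, and clearing
negative powers gives the quotient in `Zinf`. -/
theorem Zinf_le : p.Zinf r s ≤ p.D₁s / p.tH r s f₁ f₂ ^ 2 * ∫ v, p.tg₁ r s f₁ f₂ v := by
  have hr := hs.trans hsr
  have hH := tH_pos hs hsr hf₁ hM (g₂ := f₂)
  have hle := tH_le_Hsup hM hs hsr (f₁ := f₁) (f₂ := f₂)
  have hg : p.E1inf r s * p.K1m / (2 * p.L1M * p.κ ^ 2) * (s⁻¹ ^ p.κ - r⁻¹ ^ p.κ) ^ 2 ≤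
      ∫ v, p.tg₁ r s f₁ f₂ v :=
    hM.C₁.integral_gF_ge (rightOf_Ioc hs) subset_rfl hsr.le hf₁ hH
      (E1inf_le hM hs hsr hf₁)
  have hD := D₁s_pos hM
  have k1 : 0 < p.K1M := hM.C₁.pos.KM
  have k2 : 0 < p.K2M := hM.C₂.pos.KM
  have k3 : 0 < p.L1M := hM.C₁.pos.LM
  have k4 : 0 < p.K1m := hM.C₁.pos.Km
  have hκ := hM.C₁.κ_pos
  have hE : 0 < p.E1inf r s := Real.exp_pos _
  have hX := Real.rpow_pos_of_pos hs p.κ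
  have hY := Real.rpow_pos_of_pos hr p.κ
  calc p.Zinf r s = p.D₁s / p.Hsup r s ^ 2 *
        (p.E1inf r s * p.K1m / (2 * p.L1M * p.κ ^ 2) * (s⁻¹ ^ p.κ - r⁻¹ ^ p.κ) ^ 2) := by
        rw [Zinf, Hsup_eq hs hsr, Real.inv_rpow hs.le, Real.inv_rpow hr.le]
        field_simp
    _ ≤ _ := by gcongr

include hf₂

/-- The lower bound on `(r, T]` is passed to the limit `T → ∞`. -/
theorem G2infTop_le : p.G2infTop r s ≤ ∫ v, p.tg₂ r s f₁ f₂ v := by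
  have hr := hs.trans hsr
  have hH := tH_pos hs hsr hf₁ hM (g₂ := f₂)
  have hκ := hM.C₁.κ_pos
  have hg : ∀ T, r ≤ T →
      p.E2inf r s * p.K2m / (2 * p.L2M * p.κ ^ 2) * (r⁻¹ ^ p.κ - T⁻¹ ^ p.κ) ^ 2 ≤
      ∫ v, p.tg₂ r s f₁ f₂ v := fun T hT =>
    hM.C₂.integral_gF_ge (rightOf_Ioi hs hsr) Ioc_subset_Ioi_self hT hf₂ hH
      (E2inf_le hM hs hsr hf₁ hf₂)
  have hlim : Tendsto (fun T : ℝ => p.E2inf r s * p.K2m / (2 * p.L2M * p.κ ^ 2) *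
      (r⁻¹ ^ p.κ - T⁻¹ ^ p.κ) ^ 2) atTop
      (𝓝 (p.E2inf r s * p.K2m / (2 * p.L2M * p.κ ^ 2) * (r⁻¹ ^ p.κ - 0 ^ p.κ) ^ 2)) :=
    (((tendsto_inv_atTop_zero.rpow_const (Or.inr hκ.le)).const_sub _).pow 2).const_mul _
  have h := le_of_tendsto hlim (eventually_atTop.2 ⟨r, hg⟩)
  refine le_trans (le_of_eq ?_) h
  rw [G2infTop, inv_rpow_eq hr, Real.zero_rpow hκ.ne', sub_zero]
  ring

/-- After division by `r ^ (ν + 1)`, each positive factor is replaced by its bound and the power of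
`r` by that of `rbar s` or `rB s`. For the upper bound the negative term is discarded and the
exponential replaced by `1`. -/
theorem Winf_le_tW_le_Wsup (hb : 0 < p.rbar s) (h1 : p.rbar s ≤ r) (h2 : r ≤ p.rB s) :
    p.Winf r s ≤ p.tW r s f₁ f₂ ∧ p.tW r s f₁ f₂ ≤ p.Wsup r s := by
  have hr := hs.trans hsr
  have T₁ := good₁ hM hs hsr hf₁ (f₂ := f₂)
  have T₂ := good₂ hM hs hsr hf₁ hf₂
  have hH := tH_pos hs hsr hf₁ hM (g₂ := f₂)
  have a1 := tH_le_Hsup hM hs hsr (f₁ := f₁) (f₂ := f₂)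
  have a2 := Hinf_le_tH hM hs hsr hf₁ (f₂ := f₂)
  have a3 := Hinf_pos hM hs hsr
  have b1 := E1inf_le hM hs hsr hf₁ (f₂ := f₂) r
  have b2 := T₁.expE_le_one r
  have b3 : 0 < p.E1inf r s := Real.exp_pos _
  have c1 : p.H1inf r s ≤ ∫ v, p.th₁ r s f₁ f₂ v := by
    have h := hM.C₁.integral_zk_Ioc_ge hs hsr.le hf₁
    have e : p.H1inf r s = p.zone₁.Km / p.κ * (s⁻¹ ^ p.κ - r⁻¹ ^ p.κ) := by
      rw [H1inf, inv_rpow_eq hs, inv_rpow_eq hr]; rfl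
    rw [e]
    refine h.trans (integral_mono T₁.k_int T₁.hF_int fun v => ?_)
    change _ ≤ p.zk (Ioc s r) f₁ v / expE (p.tw₁ r s f₁ f₂) v
    rw [le_div_iff₀ (expE_pos _ _)]
    exact mul_le_of_le_one_right (T₁.k_nonneg v) (T₁.expE_le_one v)
  have c2 : ∫ v, p.th₁ r s f₁ f₂ v ≤ p.H1sup r s := by
    rw [H1sup_eq hs]
    exact hM.C₁.integral_hF_le (rightOf_Ioc hs) hf₁ a3 a2
  have c3 : 0 ≤ p.H1inf r s := a3.le
  have d1 := Φ2infTop_le hM hs hsr hf₁ hf₂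
  have d0 := Φ2infTop_pos hM hs hsr
  have d2 : ∫ v, p.tφ₂ r s f₁ f₂ v ≤ p.Φ2sup r := by
    refine T₂.integral_phiF_le.trans ((hM.C₂.integral_zl_le (rightOf_Ioi hs hsr)).trans_eq ?_)
    have e : p.zone₂.Lm = p.L2m := rfl
    rw [Φ2sup, inv_rpow_eq hr, e]
    ring
  have e1 := G2infTop_le hM hs hsr hf₁ hf₂
  have e2 : ∫ v, p.tg₂ r s f₁ f₂ v ≤ p.G2sup r s := by
    rw [G2sup_eq hr]
    exact hM.C₂.integral_gF_le (rightOf_Ioi hs hsr) hf₂ a3 a2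
  have e3 : 0 ≤ p.G2infTop r s := by
    have : 0 < p.K2m := hM.C₂.pos.Km
    have : 0 < p.L2M := hM.C₂.pos.LM
    have : 0 < p.E2inf r s := Real.exp_pos _
    unfold G2infTop; positivity
  have hD₁ := D₁s_pos hM
  have hD₂ := D₂s_pos hM
  have hν : 0 ≤ p.ν + 1 := by linarith [hM.C₁.ν_pos]
  have g0 := Real.rpow_pos_of_pos hb (p.ν + 1)
  have g1 := Real.rpow_le_rpow hb.le h1 hν
  have g2 := Real.rpow_le_rpow hr.le h2 hν
  have g3 := Real.rpow_pos_of_pos hr (p.ν + 1)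
  have hA : 0 ≤ p.Q * Real.exp (-s ^ 2) * s ^ p.ν := by
    have := hM.standing.Q_pos
    positivity
  unfold Winf Wsup tW
  generalize expE (p.tw₁ r s f₁ f₂) r = E at *
  generalize (∫ v, p.th₁ r s f₁ f₂ v) = h₁ at *
  generalize (∫ v, p.tφ₂ r s f₁ f₂ v) = φ at *
  generalize (∫ v, p.tg₂ r s f₁ f₂ v) = g at *
  generalize p.Q * Real.exp (-s ^ 2) * s ^ p.ν = A at *
  generalize p.tH r s f₁ f₂ = H at *
  generalize r ^ (p.ν + 1) = ρ at *
  generalize p.rbar s ^ (p.ν + 1) = ρ₀ at *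
  generalize p.rB s ^ (p.ν + 1) = ρ₁ at *
  have hφ := d0.trans_le d1
  have hE := b3.trans_le b1
  have hh := c3.trans c1
  have hg := e3.trans e1
  have e : (E * (A + p.D₁s / H ^ 2 * h₁) - 1 / φ * (1 - p.D₂s / H ^ 2 * g)) / ρ =
      E / ρ * (A + p.D₁s / H ^ 2 * h₁) - 1 / (ρ * φ) + 1 / (ρ * φ) * (p.D₂s / H ^ 2) * g := by
    field_simp
    ring
  have hφs := hφ.trans_le d2
  have hρ₁ := g3.trans_le g2
  rw [e]
  constructor
  · refine add_le_add (sub_le_sub ?_ ?_) ?_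
    · gcongr
    · gcongr
    · gcongr
  · have q1 : E / ρ * (A + p.D₁s / H ^ 2 * h₁) ≤
        1 / ρ₀ * (A + p.D₁s / p.Hinf r s ^ 2 * p.H1sup r s) := by
      have := hh.trans c2
      gcongr
    have q2 : 1 / (ρ * φ) * (p.D₂s / H ^ 2) * g ≤
        1 / (ρ₀ * p.Φ2infTop r s) * (p.D₂s / p.Hinf r s ^ 2) * p.G2sup r s := by
      have := hg.trans e2
      gcongr
    have q3 : 0 ≤ 1 / (ρ * φ) := by positivity
    have q4 : 1 / (ρ₀ * p.Φ2infTop r s) = 1 / ρ₀ * (1 / p.Φ2infTop r s) := by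
      rw [one_div_mul_one_div]
    rw [q4] at q2
    linarith

end Contact

end

/-! ### Reduction to two scalar equations and conclusion. -/

noncomputable section

open MeasureTheory

namespace Contact

/-- The temperature of the contact face at the fixed point. -/
def face (p : Contact) (r s : ℝ) : ℝ :=
  p.tV₁ r s (p.lineSol (r, s)).1 (p.lineSol (r, s)).2 s

/-- The normalised left-hand side of the second free-boundary equation at the fixed point. -/
def flux (p : Contact) (r s : ℝ) : ℝ :=
  p.tW r s (p.lineSol (r, s)).1 (p.lineSol (r, s)).2

variable {p : Contact} (hM : p.Model)
include hM

/-- `Zinf` bounds the `G₁` term alone. The remaining `Q`-term is strictly positive, which makes the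
inequality strict on the upper graph. -/
theorem Zinf_lt_tV₁ {r s : ℝ} (hs : 0 < s) (hsr : s < r) {f₁ f₂ : ℝ → ℝ} (hf₁ : Measurable f₁) :
    p.Zinf r s < p.tV₁ r s f₁ f₂ s := by
  have T := good₁ hM hs hsr hf₁ (f₂ := f₂)
  have hH := tH_pos hs hsr hf₁ hM (g₂ := f₂)
  have hle := Zinf_le hM hs hsr hf₁ (f₂ := f₂)
  have hD := D₁s_pos hM
  have hQ := hM.standing.Q_pos
  have hZ : 0 < p.Zinf r s := by
    -- Positivity of `Zinf` follows from its nonnegativity at a smaller radius and strict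
    -- monotonicity. It passes to `∫ g`, then to `∫ l` by `∫ g ≤ (∫ h) (∫ l)`, and finally to `∫ φ`.
    obtain ⟨r', h1, h2⟩ := exists_between hsr
    refine lt_of_le_of_lt ?_ (Zinf_strictMono hM hs h1 hsr h2)
    have : 0 < p.L1M := hM.C₁.pos.LM
    have : 0 < p.K1m := hM.C₁.pos.Km
    have : 0 < p.E1inf r' s := Real.exp_pos _
    change 0 ≤ p.Zinf r' s
    unfold Zinf; positivity
  have hg : 0 < ∫ v, p.tg₁ r s f₁ f₂ v :=
    pos_of_mul_pos_right (hZ.trans_le hle) (by positivity)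
  have hl : 0 < ∫ v, p.zl (Ioc s r) f₁ v :=
    pos_of_mul_pos_right (hg.trans_le T.integral_gF_le) (integral_nonneg T.hF_nonneg)
  have hφ : 0 < ∫ v, p.tφ₁ r s f₁ f₂ v :=
    (mul_pos (Real.exp_pos _) hl).trans_le (T.le_integral_phiF (E1inf_le hM hs hsr hf₁))
  have e : p.tV₁ r s f₁ f₂ s = s ^ p.ν * p.Q * Real.exp (-s ^ 2) * (∫ v, p.tφ₁ r s f₁ f₂ v) +
      p.D₁s / p.tH r s f₁ f₂ ^ 2 * ∫ v, p.tg₁ r s f₁ f₂ v := by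
    rw [← V₁_eq f₁ f₂ hsr.le le_rfl hsr.le, V₁, Φ₁_right_eq f₁ f₂ hsr.le,
      G₁_right_eq f₁ f₂ hsr.le, H_eq f₁ f₂ hsr.le]
    simp [Φ₁, G₁]
  have h0 : 0 < s ^ p.ν * p.Q * Real.exp (-s ^ 2) * (∫ v, p.tφ₁ r s f₁ f₂ v) := by positivity
  linarith

section fixedPoint

variable {r s : ℝ} (hq : (r, s) ∈ p.contractionSet)
include hq

theorem isFixedPoint_lineSol : p.IsFixedPoint r s (restrictPair r s (p.lineSol (r, s))) :=
  IsLineSolution.isFixedPoint hM hq.1.1 hq.1.2 (isLineSolution_lineSol hM hq)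

theorem eq_restrictPair {f : LiquidSpace r s × SolidSpace r} (hf : p.IsFixedPoint r s f) :
    f = restrictPair r s (p.lineSol (r, s)) :=
  IsFixedPoint.eq hM hq.1.1 hq.1.2 hq.2 hf (isFixedPoint_lineSol hM hq)

omit hM in
theorem tV₁_restrictPair : p.tV₁ r s (zeroExt (restrictPair r s (p.lineSol (r, s))).1)
    (zeroExt (restrictPair r s (p.lineSol (r, s))).2) s = p.face r s := by
  rw [face, tV₁_congr (zeroExt_restrictPair_fst _) (zeroExt_restrictPair_snd _)]

omit hM in
theorem freeBdry₁_restrictPair : p.FreeBdry₁ r s (zeroExt (restrictPair r s (p.lineSol (r, s))).1)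
    (zeroExt (restrictPair r s (p.lineSol (r, s))).2) ↔ p.face r s = p.B := by
  rw [freeBdry₁_iff _ _ hq.1.2.le, tV₁_restrictPair hq]

omit hM in
theorem freeBdry₂_restrictPair : p.FreeBdry₂ r s (zeroExt (restrictPair r s (p.lineSol (r, s))).1)
    (zeroExt (restrictPair r s (p.lineSol (r, s))).2) ↔ p.flux r s = p.M := by
  rw [freeBdry₂_iff _ _ hq.1.2.le (hq.1.1.trans hq.1.2), flux,
    tW_congr (zeroExt_restrictPair_fst _) (zeroExt_restrictPair_snd _)]

end fixedPoint

variable (hEps : p.HipEps1)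
include hEps

/-- The boundary `r = rbar s` is included, thanks to the margins in `ε₁ / 2` and `q₂ < ε₂`. -/
theorem mem_contractionSet {r s : ℝ} (hs : p.s₁ < s) (hr : p.rbar s ≤ r) :
    (r, s) ∈ p.contractionSet := by
  have hq : (r, s) ∈ pairs := ⟨(s₁_pos hM hEps).trans hs, (lt_rbar hM hEps hs).trans_le hr⟩
  obtain ⟨h1, h2⟩ := ε_le_one hM hEps hs hr
  exact ⟨hq, max_lt (by linarith) ((q₂_lt_ε₂ hM hq).trans_le h2)⟩

variable (hZ : p.HipZinfty)
include hZ

/-- Uniqueness of the fixed point removes the existential quantifier and leaves a scalar equation.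
-/
theorem mem_firstSolutions_iff {r s : ℝ} (hs : p.s₂ < s) :
    r ∈ p.firstSolutions s ↔ r ∈ Ioo (p.rbar s) (p.rB s) ∧ p.face r s = p.B := by
  have hs₁ := (s₁_le_s₂ hM hZ).trans_lt hs
  refine and_congr_right fun hr => ?_
  have hq := mem_contractionSet hM hEps hs₁ hr.1.le
  constructor
  · rintro ⟨f, hf, hB⟩
    rw [eq_restrictPair hM hq hf] at hB
    exact (freeBdry₁_restrictPair hq).1 hB
  · exact fun h => ⟨_, isFixedPoint_lineSol hM hq, (freeBdry₁_restrictPair hq).2 h⟩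

theorem flux_bounds {r s : ℝ} (hs : p.s₂ < s) (hr : r ∈ p.firstSolutions s) :
    p.Winf r s ≤ p.flux r s ∧ p.flux r s ≤ p.Wsup r s := by
  have hs₁ := (s₁_le_s₂ hM hZ).trans_lt hs
  have h0 := (s₁_pos hM hEps).trans hs₁
  have hb := lt_rbar hM hEps hs₁
  exact Winf_le_tW_le_Wsup hM h0 (hb.trans hr.1.1) (BoundedContinuousFunction.continuous _).measurable
    (BoundedContinuousFunction.continuous _).measurable (h0.trans hb) hr.1.1.le hr.1.2.le

variable (hXY : p.HipXY)
include hXY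

theorem face_rbar_lt {s : ℝ} (hs : p.s₂ < s) : p.face (p.rbar s) s < p.B := by
  have hs₁ := (s₁_le_s₂ hM hZ).trans_lt hs
  have hq := mem_contractionSet hM hEps hs₁ le_rfl
  have h := hXY s hs _ (isFixedPoint_lineSol hM hq)
  rwa [X_lt_Y_iff _ _ hq.1.2.le, tV₁_restrictPair hq] at h

/-- At `r = rbar s` the chain `Zinf < face < B` holds, so the level `B` of `Zinf` is reached
strictly later. -/
theorem rbar_lt_rB {s : ℝ} (hs : p.s₂ < s) :
    p.rbar s < p.rB s ∧ p.Zinf (p.rB s) s = p.B := by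
  have hs₁ := (s₁_le_s₂ hM hZ).trans_lt hs
  have hq := mem_contractionSet hM hEps hs₁ le_rfl
  exact rB_spec hM hEps hZ hs hq.1.2 ((Zinf_lt_tV₁ hM hq.1.1 hq.1.2
    (BoundedContinuousFunction.continuous _).measurable).trans
      (face_rbar_lt hM hEps hZ hXY hs))

theorem lt_face_rB {s : ℝ} (hs : p.s₂ < s) : p.B < p.face (p.rB s) s := by
  have hs₁ := (s₁_le_s₂ hM hZ).trans_lt hs
  obtain ⟨h1, h2⟩ := rbar_lt_rB hM hEps hZ hXY hs
  have hq := mem_contractionSet hM hEps hs₁ h1.le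
  rw [← h2]
  exact Zinf_lt_tV₁ hM hq.1.1 hq.1.2 (BoundedContinuousFunction.continuous _).measurable

theorem continuousOn_rB : ContinuousOn p.rB (Ioi p.s₂) := by
  have hpos : ∀ s ∈ Ioi p.s₂, 0 < s := fun s hs =>
    (s₁_pos hM hEps).trans ((s₁_le_s₂ hM hZ).trans_lt hs)
  refine continuousOn_level (e := fun r s => -p.Zinf r s) (c := -p.B) isOpen_Ioi hpos
    (fun s hs => (Zinf_strictMono hM (hpos s hs)).neg)
    (fun q hq => (continuousAt_Zinf hM hq).neg.continuousWithinAt) (fun s hs => ?_) fun s hs => ?_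
  · exact (lt_rbar hM hEps ((s₁_le_s₂ hM hZ).trans_lt hs)).trans (rbar_lt_rB hM hEps hZ hXY hs).1
  · rw [(rbar_lt_rB hM hEps hZ hXY hs).2]

/-- A continuous function which is positive on the admitted solutions of the first free-boundary
equation at one parameter and negative at a larger one vanishes on some admitted solution. -/
theorem exists_zero_on_solutions {R : ℝ → Set ℝ} (hR : p.IsRStar R) {G : ℝ → ℝ → ℝ}
    (hG : ContinuousOn (fun q : ℝ × ℝ => G q.1 q.2) p.contractionSet) {a b : ℝ} (ha : p.s₂ < a)
    (hab : a < b) (hleft : ∀ r ∈ R a, 0 < G r a) (hright : ∀ r ∈ R b, G r b < 0) :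
    ∃ s, p.s₂ < s ∧ ∃ r ∈ R s, G r s = 0 := by
  have hlt : ∀ s ∈ Icc a b, p.s₂ < s := fun s hs => ha.trans_le hs.1
  have hlt₁ : ∀ s ∈ Icc a b, p.s₁ < s := fun s hs => (s₁_le_s₂ hM hZ).trans_lt (hlt s hs)
  rcases hR with hR | ⟨ρ, hρ, hR⟩
  -- When all solutions are admitted, they need not form a continuous branch. The planar theorem is
  -- applied between the graphs of `rbar` and `rB`.
  · have hsub : {q : ℝ × ℝ | q.2 ∈ Icc a b ∧ q.1 ∈ Icc (p.rbar q.2) (p.rB q.2)} ⊆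
        p.contractionSet := fun q hq => mem_contractionSet hM hEps (hlt₁ _ hq.1) hq.2.1
    have hsol : ∀ s ∈ Icc a b, ∀ r ∈ Ioo (p.rbar s) (p.rB s), p.face r s - p.B = 0 →
        r ∈ R s := fun s hs r hr h => by
      rw [hR s (hlt s hs), mem_firstSolutions_iff hM hEps hZ (hlt s hs)]
      exact ⟨hr, sub_eq_zero.1 h⟩
    obtain ⟨s, hs, r, hr, h1, h2⟩ := exists_common_zero_between hab
      ((continuousOn_rbar hM hEps).mono hlt₁) ((continuousOn_rB hM hEps hZ hXY).mono hlt)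
      (fun s hs => (rbar_lt_rB hM hEps hZ hXY (hlt s hs)).1)
      (F := fun r s => p.face r s - p.B) (G := G)
      (((continuousOn_face hM).sub continuousOn_const).mono hsub) (hG.mono hsub)
      (fun s hs => sub_neg.2 (face_rbar_lt hM hEps hZ hXY (hlt s hs)))
      (fun s hs => sub_pos.2 (lt_face_rB hM hEps hZ hXY (hlt s hs)))
      (fun r hr h => hleft r (hsol a (left_mem_Icc.2 hab.le) r hr h))
      (fun r hr h => hright r (hsol b (right_mem_Icc.2 hab.le) r hr h))
    exact ⟨s, hlt s hs, r, hsol s hs r hr h1, h2⟩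
  -- Along a given continuous branch, the one-dimensional intermediate value theorem suffices.
  · have hc : ContinuousOn (fun s => G (ρ s) s) (Icc a b) :=
      hG.comp ((hρ.mono hlt).prodMk continuousOn_id) fun s hs =>
        mem_contractionSet hM hEps (hlt₁ s hs) (hR s (hlt s hs)).1.1.1.le
    have hmem : ∀ s ∈ Icc a b, ρ s ∈ R s := fun s hs => by
      rw [(hR s (hlt s hs)).2]; exact mem_singleton _
    obtain ⟨s, hs, h⟩ := intermediate_value_Icc' hab.le hc
      ⟨(hright _ (hmem b (right_mem_Icc.2 hab.le))).le,
        (hleft _ (hmem a (left_mem_Icc.2 hab.le))).le⟩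
    exact ⟨s, hlt s hs, ρ s, hmem s hs, h⟩

theorem exists_flux_eq {R : ℝ → Set ℝ} (hR : p.IsRStar R) (hW : p.HipW R) :
    ∃ s, p.s₂ < s ∧ ∃ r ∈ R s, p.flux r s = p.M := by
  have hsub : ∀ s, p.s₂ < s → R s ⊆ p.firstSolutions s := fun s hs => by
    rcases hR with hR | ⟨ρ, -, hR⟩
    · exact (hR s hs).subset
    · rw [(hR s hs).2]
      exact singleton_subset_iff.2 (hR s hs).1
  have hc := continuousOn_tW hM
  -- In either alternative `a` is taken close to `s₂` and `b > a` large. The second alternative is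
  -- the first with the sign of `flux - M` reversed.
  rcases hW with ⟨h1, h2⟩ | ⟨h1, h2⟩ <;>
    obtain ⟨a, h1, ha⟩ := (h1.and self_mem_nhdsWithin).exists <;>
    obtain ⟨b, h2, hb⟩ := (h2.and (eventually_gt_atTop a)).exists
  · obtain ⟨s, hs, r, hr, h⟩ := exists_zero_on_solutions hM hEps hZ hXY hR
      (G := fun r s => p.flux r s - p.M) (hc.sub continuousOn_const) ha hb
      (fun r hr => sub_pos.2 ((h1 r hr).trans_le
        (flux_bounds hM hEps hZ ha (hsub a ha hr)).1))
      (fun r hr => sub_neg.2 ((flux_bounds hM hEps hZ (ha.trans hb)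
        (hsub b (ha.trans hb) hr)).2.trans_lt (h2 r hr)))
    exact ⟨s, hs, r, hr, sub_eq_zero.1 h⟩
  · obtain ⟨s, hs, r, hr, h⟩ := exists_zero_on_solutions hM hEps hZ hXY hR
      (G := fun r s => p.M - p.flux r s) (continuousOn_const.sub hc) ha hb
      (fun r hr => sub_pos.2 ((flux_bounds hM hEps hZ ha (hsub a ha hr)).2.trans_lt (h1 r hr)))
      (fun r hr => sub_neg.2 ((h2 r hr).trans_le
        (flux_bounds hM hEps hZ (ha.trans hb) (hsub b (ha.trans hb) hr)).1))
    exact ⟨s, hs, r, hr, (sub_eq_zero.1 h).symm⟩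

end Contact

end

theorem mainTheorem1 (p : Contact) (hp : p.Standing) (hc : p.PosConsts)
    (hA1 : p.A1) (hA2 : p.A2) (hA3 : p.A3) (hA4 : p.A4) (hA5 : p.A5)
    (hEps : p.HipEps1) (hXY : p.HipXY) (hZ : p.HipZinfty)
    (Rstar : ℝ → Set ℝ) (hR : p.IsRStar Rstar) (hW : p.HipW Rstar) :
    ∃ s₀ : ℝ, p.s₂ < s₀ ∧ ∃ r₀ ∈ Rstar s₀, (r₀, s₀) ∈ p.sigmaSet ∧
      ∃ f : LiquidSpace r₀ s₀ × SolidSpace r₀,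
        p.IsFixedPoint r₀ s₀ f ∧ (∀ g, p.IsFixedPoint r₀ s₀ g → g = f) ∧
        p.FreeBdry₁ r₀ s₀ (zeroExt f.1) (zeroExt f.2) ∧
        p.FreeBdry₂ r₀ s₀ (zeroExt f.1) (zeroExt f.2) := by
  have hM : p.Model :=
    ⟨hp, Contact.coeffs_zone₁ hp hc hA1 hA3 hA5, Contact.coeffs_zone₂ hp hc hA2 hA4 hA5⟩
  obtain ⟨s, hs, r, hr, h⟩ := Contact.exists_flux_eq hM hEps hZ hXY hR hW
  have hs₁ := (Contact.s₁_le_s₂ hM hZ).trans_lt hs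
  -- Under both readings of `r₀*`, the value found solves the first equation and lies strictly above
  -- `rbar s`.
  have hr' : r ∈ p.firstSolutions s := by
    rcases hR with hR | ⟨ρ, -, hR⟩
    · exact hR s hs ▸ hr
    · rw [(hR s hs).2] at hr
      exact hr ▸ (hR s hs).1
  have hface := ((Contact.mem_firstSolutions_iff hM hEps hZ hs).1 hr').2
  have hq := Contact.mem_contractionSet hM hEps hs₁ hr'.1.1.le
  exact ⟨s, hs, r, hr, ⟨hs₁, hr'.1.1⟩, _, Contact.isFixedPoint_lineSol hM hq,
    fun g hg => Contact.eq_restrictPair hM hq hg, (Contact.freeBdry₁_restrictPair hq).2 hface,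
    (Contact.freeBdry₂_restrictPair hq).2 h⟩
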